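/- **Theorem 3.5.** Let $T>0$, let $H_0,H_1,\dots,H_d\in(1/2,1)$, and put $R_H(a,b)=\tfrac12\big(|a|^{2H}+|b|^{2H}-|a-b|^{2H}\big)$. Let $\beta_1,\dots,\beta_d\in(0,2)$ with $\beta_i<2H_i$ for all $i$ and $$\sum_{i=1}^d(2H_i-\beta_i)<2,$$ and let $\rho:\mathbb R^d\to\mathbb R$ be continuous with $0\le\rho(x)\le C\prod_{i=1}^d(1+|x_i|)^{-\beta_i}$ for some constant $C$. On a probability space let $B=(B_t)_{0\le t\le T}$ be a $d$-dimensional standard Brownian motion and let $W=(W(t,x))_{t\ge0,\,x\in\mathbb R^d}$ be a jointly measurable mean-zero Gaussian field, independent of $B$, with $$\mathbb E[W(t,x)W(s,y)]=R_{H_0}(t,s)\,\rho(x)\rho(y)\prod_{i=1}^dR_{H_i}(x_i,y_i).$$ Let $\mathcal F_t=\sigma\big(B_s,\,0\le s\le t;\ W(r,x),\ r\ge0,\ x\in\mathbb R^d\big)$. For $\varepsilon,\eta>0$ put $\varphi_\eta=\eta^{-1}\mathbf 1_{[0,\eta]}$, $p_\varepsilon(x)=(2\pi\varepsilon)^{-d/2}e^{-|x|^2/(2\varepsilon)}$,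 $$\dot W_{\varepsilon,\eta}(s,x)=\int_0^s\!\int_{\mathbb R^d}\varphi_\eta(s-r)\,p_\varepsilon(x-y)\,W(dr,y)\,dy=\int_{\mathbb R^d}p_\varepsilon(x-y)\,\frac{W(s,y)-W(\max(s-\eta,0),y)}{\eta}\,dy,$$ and $V^{\varepsilon,\eta}_t=\int_t^T\dot W_{\varepsilon,\eta}(s,B_s)\,ds$. Let $\mathcal S^p_{\mathbb F}(0,T;\mathbb R)$ be the space of real $(\mathcal F_t)$-adapted, (almost surely) continuous processes $\psi$ on $[0,T]$ with $\mathbb E\big[\sup_{0\le t\le T}|\psi_t|^p\big]<\infty$. Let $\xi\in L^q(\Omega)$ with $2<q<\infty$. Then, for every $t\in[0,T]$, $V^{\varepsilon,\eta}_t$ converges in $L^2(\Omega)$ as $\varepsilon,\eta\downarrow0$ to a limit, denoted $V_t=\int_t^TW(dr,B_r)$; the variables $\xi e^{V_t}$ and $\xi e^{V^{\varepsilon,\eta}_t}$ are integrable; and the processes $$Y_t=\mathbb E\Big[\xi\exp\Big(\int_t^TW(dr,B_r)\Big)\Big|\mathcal F_t\Big],\qquad Y^{\varepsilon,\eta}_t=\mathbb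 E\Big[\xi\exp\Big(\int_t^T\dot W_{\varepsilon,\eta}(r,B_r)\,dr\Big)\Big|\mathcal F_t\Big]$$ have versions which, for every $p\in[1,q)$, belong to $\mathcal S^p_{\mathbb F}(0,T;\mathbb R)$, and for every $p\in[1,q)$ $$\lim_{\varepsilon,\eta\downarrow0}\mathbb E\Big[\sup_{0\le t\le T}\big|Y^{\varepsilon,\eta}_t-Y_t\big|^p\Big]=0 .$$ -/

import Mathlib

open MeasureTheory ProbabilityTheory Set Filter Topology
open scoped ENNReal NNReal

namespace FracBSDE

noncomputable section

/-- The covariance `R_H(x, y) = (|x|^{2H} + |y|^{2H} - |x - y|^{2H}) / 2` of a (two-sided)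
fractional Brownian motion. -/
def fbmCov (H x y : ℝ) : ℝ :=
  (|x| ^ (2 * H) + |y| ^ (2 * H) - |x - y| ^ (2 * H)) / 2

/-- `B` is a `d`-dimensional standard Brownian motion on the time interval `[0, T]`
(nothing is required of `B t` for `t` outside `[0, T]`). -/
structure IsBrownianOn {Ω : Type*} [MeasurableSpace Ω] {d : ℕ} (T : ℝ)
    (B : ℝ → Ω → (Fin d → ℝ)) (μ : Measure Ω) : Prop where
  measurable : ∀ t ∈ Icc 0 T, Measurable (B t)
  zero : ∀ᵐ ω ∂μ, B 0 ω = 0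
  law_increment : ∀ s t : ℝ, 0 ≤ s → s ≤ t → t ≤ T →
    μ.map (fun ω => B t ω - B s ω) = Measure.pi (fun _ => gaussianReal 0 (t - s).toNNReal)
  indep_increment : ∀ s t : ℝ, 0 ≤ s → s ≤ t → t ≤ T →
    Indep (⨆ u ∈ Icc 0 s, MeasurableSpace.comap (B u) inferInstance)
      (MeasurableSpace.comap (fun ω => B t ω - B s ω) inferInstance) μ
  continuous : ∀ᵐ ω ∂μ, ContinuousOn (fun t => B t ω) (Icc 0 T)

/-- `W = (W(t, x), t ≥ 0, x ∈ ℝᵈ)` is a weighted fractional Brownian field: a (jointly measurable)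
mean-zero Gaussian field with covariance
`E[W(t, x) W(s, y)] = R_{H₀}(t, s) ρ(x) ρ(y) ∏ᵢ R_{Hᵢ}(xᵢ, yᵢ)`. Only times `t ≥ 0` matter. -/
structure IsWeightedFractionalField {Ω : Type*} [MeasurableSpace Ω] {d : ℕ} (H0 : ℝ)
    (H : Fin d → ℝ) (ρ : (Fin d → ℝ) → ℝ) (W : ℝ → (Fin d → ℝ) → Ω → ℝ) (μ : Measure Ω) :
    Prop where
  measurable : Measurable (fun z : Ω × ℝ≥0 × (Fin d → ℝ) => W (z.2.1 : ℝ) z.2.2 z.1)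
  gaussian : IsGaussianProcess (fun (z : ℝ≥0 × (Fin d → ℝ)) ω => W (z.1 : ℝ) z.2 ω) μ
  mean_zero : ∀ t : ℝ, 0 ≤ t → ∀ x, ∫ ω, W t x ω ∂μ = 0
  covariance : ∀ t s : ℝ, 0 ≤ t → 0 ≤ s → ∀ x y,
    ∫ ω, W t x ω * W s y ω ∂μ
      = fbmCov H0 t s * (ρ x * ρ y * ∏ i, fbmCov (H i) (x i) (y i))

section Noise

variable {Ω : Type*} {d : ℕ}

/-- `σ(B_s, 0 ≤ s ≤ t)`. -/
def brownianSigma (B : ℝ → Ω → (Fin d → ℝ)) (t : ℝ) : MeasurableSpace Ω :=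
  ⨆ s ∈ Icc 0 t, MeasurableSpace.comap (B s) inferInstance

/-- `σ(W(r, x), r ≥ 0, x ∈ ℝᵈ)`. -/
def fieldSigma (W : ℝ → (Fin d → ℝ) → Ω → ℝ) : MeasurableSpace Ω :=
  ⨆ r ∈ Ici (0 : ℝ), ⨆ x, MeasurableSpace.comap (W r x) inferInstance

/-- `F_t = σ(B_s, 0 ≤ s ≤ t; W(r, x), r ≥ 0, x ∈ ℝᵈ)`. -/
def sigmaF (B : ℝ → Ω → (Fin d → ℝ)) (W : ℝ → (Fin d → ℝ) → Ω → ℝ) (t : ℝ) :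
    MeasurableSpace Ω :=
  brownianSigma B t ⊔ fieldSigma W

/-- `φ_η(t) = η⁻¹ 1_{[0, η]}(t)`. -/
def timeKernel (η t : ℝ) : ℝ := (Icc 0 η).indicator (fun _ => η⁻¹) t

/-- `p_ε(x) = (2πε)^{-d/2} exp(-|x|² / (2ε))`, with the Euclidean norm `|x|`. -/
def heatKernel (ε : ℝ) (x : Fin d → ℝ) : ℝ :=
  (2 * Real.pi * ε) ^ (-(d : ℝ) / 2) * Real.exp (-(∑ i, x i ^ 2) / (2 * ε))

/-- The stochastic integral `∫∫ 1_{[a, b]}(r) g(y) W(dr, y) dy` of an integrand that is an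
indicator function in time: `W(dr, y)` integrates the indicator to `W(b, y) - W(a, y)`. -/
def stepIntegral (W : ℝ → (Fin d → ℝ) → Ω → ℝ) (a b : ℝ) (g : (Fin d → ℝ) → ℝ) (ω : Ω) : ℝ :=
  ∫ y, g y * (W b y ω - W a y ω)

/-- As a function of `r ∈ [0, s]`, the kernel `φ_η(s - r)` is `η⁻¹` times the indicator of
`[max (s - η) 0, s]`. -/
theorem timeKernel_sub_eq (η s r : ℝ) (hr : r ∈ Icc 0 s) :
    timeKernel η (s - r) = η⁻¹ * (Icc (max (s - η) 0) s).indicator (fun _ => (1 : ℝ)) r := by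
  obtain ⟨h0, hs⟩ := hr
  by_cases h : s - r ≤ η
  · have h1 : s - r ∈ Icc 0 η := ⟨by linarith, h⟩
    have h2 : r ∈ Icc (max (s - η) 0) s := ⟨max_le (by linarith) h0, hs⟩
    simp [timeKernel, h1, h2]
  · have h1 : s - r ∉ Icc 0 η := fun h' => h h'.2
    have h2 : r ∉ Icc (max (s - η) 0) s := fun h' => h (by
      have := (le_max_left (s - η) 0).trans h'.1
      linarith)
    simp [timeKernel, h1, h2]

/-- The regularized noise `Ẇ_{ε,η}(s, x) = ∫₀ˢ ∫ φ_η(s - r) p_ε(x - y) W(dr, y) dy`. In the time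
variable `r ∈ [0, s]` the integrand is `η⁻¹` times the indicator of `[max (s - η) 0, s]`
(`timeKernel_sub_eq`). -/
def noiseApprox (W : ℝ → (Fin d → ℝ) → Ω → ℝ) (ε η s : ℝ) (x : Fin d → ℝ) (ω : Ω) : ℝ :=
  stepIntegral W (max (s - η) 0) s (fun y => η⁻¹ * heatKernel ε (x - y)) ω

/-- `V_t^{ε,η} = ∫_t^T Ẇ_{ε,η}(s, B_s) ds`. -/
def integralApprox (B : ℝ → Ω → (Fin d → ℝ)) (W : ℝ → (Fin d → ℝ) → Ω → ℝ) (T ε η t : ℝ)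
    (ω : Ω) : ℝ :=
  ∫ s in t..T, noiseApprox W ε η s (B s ω) ω

/-- `V` is (a version of) the nonlinear stochastic integral `∫_t^T W(dr, B_r)`, that is, the limit
in `L²(Ω)` of `V_t^{ε,η}` as `ε, η ↓ 0`. It is unique up to almost sure equality. -/
def IsNonlinearIntegral [MeasurableSpace Ω] (B : ℝ → Ω → (Fin d → ℝ))
    (W : ℝ → (Fin d → ℝ) → Ω → ℝ) (μ : Measure Ω) (T t : ℝ) (V : Ω → ℝ) : Prop :=
  (∀ ε > 0, ∀ η > 0, MemLp (integralApprox B W T ε η t) 2 μ) ∧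
  MemLp V 2 μ ∧
  Tendsto (fun z : ℝ × ℝ => eLpNorm (fun ω => integralApprox B W T z.1 z.2 t ω - V ω) 2 μ)
    (𝓝[>] 0 ×ˢ 𝓝[>] 0) (𝓝 0)

/-- `E[sup_{0 ≤ t ≤ T} |ψ_t|^p]`, as an element of `[0, ∞]`. -/
def supMoment [MeasurableSpace Ω] (μ : Measure Ω) (T p : ℝ) (ψ : ℝ → Ω → ℝ) : ℝ≥0∞ :=
  ∫⁻ ω, ⨆ t ∈ Icc 0 T, ‖ψ t ω‖ₑ ^ p ∂μ

/-- `ψ ∈ S^p_F(0, T; ℝ)`: `ψ` is adapted to `F`, almost surely continuous on `[0, T]`, and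
`E[sup_{0 ≤ t ≤ T} |ψ_t|^p] < ∞`. -/
structure MemSp [MeasurableSpace Ω] (F : ℝ → MeasurableSpace Ω) (μ : Measure Ω) (T p : ℝ)
    (ψ : ℝ → Ω → ℝ) : Prop where
  adapted : ∀ t ∈ Icc 0 T, Measurable[F t] (ψ t)
  continuous : ∀ᵐ ω ∂μ, ContinuousOn (fun t => ψ t ω) (Icc 0 T)
  moment : supMoment μ T p ψ < ∞

/-- `ψ` is a version of the process `t ↦ E[ξ exp(V_t) | F_t]`, `0 ≤ t ≤ T`; in particular these
conditional expectations make sense. -/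
def IsCondExpVersion [MeasurableSpace Ω] (F : ℝ → MeasurableSpace Ω) (μ : Measure Ω) (T : ℝ)
    (ξ : Ω → ℝ) (V : ℝ → Ω → ℝ) (ψ : ℝ → Ω → ℝ) : Prop :=
  ∀ t ∈ Icc 0 T, Integrable (fun ω => ξ ω * Real.exp (V t ω)) μ ∧
    ψ t =ᵐ[μ] μ[fun ω => ξ ω * Real.exp (V t ω) | F t]

end Noise

end

end FracBSDE

/-!
Write `X t = ∫_0^t W(dr, B_r)`. Since `X t` is `F t`-measurable, `Y t = exp (-X t) * M t`, where
`M` is the closed martingale `E[ξ exp (X T) | F t]`, and the regularised solutions factor in the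
same way. The theorem follows once both factors are continuous in time, have all the moments
needed, and converge in the supremum over time (`IsExpSolution.tendsto_supMoment_sub`).

*The integral along a fixed path.* For a fixed path the integral is Gaussian, so it is studied as a
Bochner integral in the Hilbert space `L²`. The inner product of two increments of the field is the
increment covariance of fractional Brownian motion, which is nonnegative as `H0 > 1/2`, times the
spatial covariance. Nonnegativity lets the norm of the integral be compared with that of a scalar
fractional Brownian motion: it is at most `κ (t - s) ^ H0`, where `κ` bounds the spatial factor,
uniformly in the smoothing parameters (`norm_avgInt_le`). The same bound applied to differences of
curves shows convergence, by comparison with step curves, along which the limit is a finite sum of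
increments of the field (`exists_tendsto_avgInt`).

*The random path.* The path and the field are independent, so the law of the integral along the
Brownian path is obtained by integrating the law for a frozen path over an independent copy
(`lintegral_diag_eq`). With `A = ∑ (H i - β i / 2)` the conditional variance is at most a constant
times `(1 + sup |B|) ^ (2 A)`. The hypothesis `∑ (2 H i - β i) < 2` says `A < 1`, so that Gaussian
moments of the running maximum make all exponential moments finite, uniformly in the smoothing
parameters (`exists_lintegral_exp_pathInt_le`). Increments over `[s, t]` are of order
`(t - s) ^ H0` in every `Lᵖ`, and chaining over dyadic grids (`exists_supMoment_le`) upgrades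
convergence at fixed times to convergence of `exp (-X)` uniformly in time. The limit `X` is built in
`ExpProcess.exists_limit`.

*The martingale.* Conditional expectations along this filtration have continuous versions
(`IsBrownianOn.hasContCondExp`). For continuous functions of finitely many values of the path, times
the indicator of an event of the field, independence of the increments writes the conditional
expectation as an average over the future of the path, which is continuous in time by dominated
convergence; the general case follows by a monotone class argument and the maximal inequality. The
latter also turns convergence of `ξ exp (X T)` in `Lʳ`, `r < q`, into convergence of the martingales
uniformly in time.
-/

/-! ### Rectangular increments of the fractional covariance -/

namespace FracBSDE

theorem _root_.ConvexOn.add_le_add_of_add_eq {f : ℝ → ℝ} (hf : ConvexOn ℝ univ f) {x y z w : ℝ}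
    (hxy : x ≤ y) (hyw : y ≤ w) (h : y + z = x + w) : f y + f z ≤ f x + f w := by
  rcases eq_or_lt_of_le (hxy.trans hyw) with h0 | h0
  · have h1 : y = x := by linarith
    have h2 : z = w := by linarith
    rw [h1, h2]
  · have hd : 0 < w - x := by linarith
    set θ := (w - y) / (w - x) with hθ
    have hθ0 : 0 ≤ θ := div_nonneg (by linarith) hd.le
    have hθ1 : 0 ≤ 1 - θ := by
      have : θ ≤ 1 := (div_le_one hd).2 (by linarith)
      linarith
    have hθw : θ * (w - x) = w - y := by rw [hθ]; field_simp
    have e1 := hf.2 (mem_univ x) (mem_univ w) hθ0 hθ1 (by ring)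
    have e2 := hf.2 (mem_univ x) (mem_univ w) hθ1 hθ0 (by ring)
    simp only [smul_eq_mul] at e1 e2
    have hy : θ * x + (1 - θ) * w = y := by linarith
    have hz : (1 - θ) * x + θ * w = z := by linarith
    rw [hy] at e1
    rw [hz] at e2
    linarith

theorem convexOn_abs_rpow {p : ℝ} (hp : 1 ≤ p) : ConvexOn ℝ univ (fun x : ℝ => |x| ^ p) := by
  refine ⟨convex_univ, fun x _ y _ a b ha hb hab => ?_⟩
  have h1 : |a • x + b • y| ≤ a * |x| + b * |y| := by
    refine (abs_add_le _ _).trans (le_of_eq ?_)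
    simp [abs_mul, abs_of_nonneg ha, abs_of_nonneg hb]
  calc |a • x + b • y| ^ p ≤ (a * |x| + b * |y|) ^ p :=
        Real.rpow_le_rpow (abs_nonneg _) h1 (by linarith)
    _ ≤ a • |x| ^ p + b • |y| ^ p :=
        (convexOn_rpow hp).2 (abs_nonneg x) (abs_nonneg y) ha hb hab

/-- Increments over disjoint or overlapping time intervals of a fractional Brownian motion with
Hurst parameter at least `1/2` are nonnegatively correlated. -/
theorem fbmCov_rect_nonneg {H : ℝ} (hH : 1 / 2 ≤ H) {a b c d : ℝ} (hab : a ≤ b) (hcd : c ≤ d) :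
    0 ≤ fbmCov H b d - fbmCov H b c - fbmCov H a d + fbmCov H a c := by
  have h := (convexOn_abs_rpow (p := 2 * H) (by linarith)).add_le_add_of_add_eq
    (x := a - d) (y := a - c) (z := b - d) (w := b - c) (by linarith) (by linarith) (by ring)
  simp only [fbmCov]
  linarith

theorem fbmCov_self {H : ℝ} (hH : 0 < H) {t : ℝ} (ht : 0 ≤ t) : fbmCov H t t = t ^ (2 * H) := by
  simp [fbmCov, abs_of_nonneg ht, Real.zero_rpow (by linarith : (2 : ℝ) * H ≠ 0)]

theorem fbmCov_comm (H x y : ℝ) : fbmCov H x y = fbmCov H y x := by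
  simp only [fbmCov, abs_sub_comm x y]; ring

theorem fbmCov_self_sub {H : ℝ} (hH : 0 < H) (t s : ℝ) :
    fbmCov H t t - 2 * fbmCov H t s + fbmCov H s s = |t - s| ^ (2 * H) := by
  simp [fbmCov, Real.zero_rpow (by linarith : (2 : ℝ) * H ≠ 0)]; ring

theorem continuous_fbmCov {H : ℝ} (hH : 0 < H) :
    Continuous (fun z : ℝ × ℝ => fbmCov H z.1 z.2) := by
  have h : ∀ f : ℝ × ℝ → ℝ, Continuous f → Continuous (fun z => |f z| ^ (2 * H)) := fun f hf =>
    hf.abs.rpow_const (fun _ => Or.inr (by linarith))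
  exact (((h _ continuous_fst).add (h _ continuous_snd)).sub
    (h _ (continuous_fst.sub continuous_snd))).div_const 2

/-! ### Averaged increments of Hilbert-valued curves -/

section Hilbert

variable {𝓗 : Type*} [NormedAddCommGroup 𝓗] [InnerProductSpace ℝ 𝓗]

/-- Comparison of two Bochner integrals whose Gram kernels differ by a factor `⟪P r, P r'⟫` with
`‖P‖ ≤ κ`, when the smaller Gram kernel is nonnegative. -/
theorem norm_integral_le_of_inner_eq_mul [CompleteSpace 𝓗] {s t κ : ℝ} (hst : s ≤ t) (hκ : 0 ≤ κ)
    {Θ P e : ℝ → 𝓗}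
    (hΘ : IntervalIntegrable Θ volume s t) (he : IntervalIntegrable e volume s t)
    (h0 : ∀ r ∈ Icc s t, ∀ r' ∈ Icc s t, 0 ≤ inner ℝ (e r) (e r'))
    (hP : ∀ r ∈ Icc s t, ‖P r‖ ≤ κ)
    (hin : ∀ r ∈ Icc s t, ∀ r' ∈ Icc s t,
      inner ℝ (Θ r) (Θ r') = inner ℝ (e r) (e r') * inner ℝ (P r) (P r')) :
    ‖∫ r in s..t, Θ r‖ ≤ κ * ‖∫ r in s..t, e r‖ := by
  have key : ∀ (f : ℝ → 𝓗), IntervalIntegrable f volume s t → ∀ c : 𝓗,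
      inner ℝ c (∫ r in s..t, f r) = ∫ r in s..t, inner ℝ c (f r) := by
    intro f hf c
    exact ((innerSL ℝ c).intervalIntegral_comp_comm hf).symm
  have keyi : ∀ (f : ℝ → 𝓗), IntervalIntegrable f volume s t → ∀ c : 𝓗,
      IntervalIntegrable (fun r => inner ℝ c (f r)) volume s t := by
    intro f hf c
    rw [intervalIntegrable_iff] at hf ⊢
    exact hf.const_inner c
  have h1 : inner ℝ (∫ r in s..t, Θ r) (∫ r in s..t, Θ r)
      ≤ κ ^ 2 * inner ℝ (∫ r in s..t, e r) (∫ r in s..t, e r) := by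
    rw [key Θ hΘ, key e he, ← intervalIntegral.integral_const_mul]
    refine intervalIntegral.integral_mono_on hst (keyi Θ hΘ _) ((keyi e he _).const_mul _) ?_
    intro r hr
    rw [real_inner_comm (Θ r), real_inner_comm (e r), key Θ hΘ, key e he,
      ← intervalIntegral.integral_const_mul]
    refine intervalIntegral.integral_mono_on hst (keyi Θ hΘ _) ((keyi e he _).const_mul _) ?_
    intro r' hr'
    rw [hin r hr r' hr', mul_comm]
    refine mul_le_mul_of_nonneg_right ?_ (h0 r hr r' hr')
    calc inner ℝ (P r) (P r') ≤ ‖P r‖ * ‖P r'‖ := real_inner_le_norm _ _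
      _ ≤ κ * κ := mul_le_mul (hP r hr) (hP r' hr') (norm_nonneg _) hκ
      _ = κ ^ 2 := by ring
  rw [real_inner_self_eq_norm_sq, real_inner_self_eq_norm_sq, ← mul_pow] at h1
  exact (sq_le_sq₀ (norm_nonneg _) (mul_nonneg hκ (norm_nonneg _))).1 h1

/-- Integrating backward increments of step `η` amounts to averaging forward increments. -/
theorem integral_sub_shift {f : ℝ → 𝓗} (hf : Continuous f) (s t η : ℝ) :
    ∫ r in s..t, (f r - f (r - η)) = ∫ h in (0 : ℝ)..η, (f (t - h) - f (s - h)) := by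
  have hi : ∀ a b : ℝ, IntervalIntegrable f volume a b := fun a b => hf.intervalIntegrable a b
  have hi2 : ∀ c a b : ℝ, IntervalIntegrable (fun h => f (c - h)) volume a b := fun c a b =>
    (hf.comp (continuous_const.sub continuous_id)).intervalIntegrable a b
  have hi3 : IntervalIntegrable (fun r => f (r - η)) volume s t :=
    (hf.comp (continuous_id.sub continuous_const)).intervalIntegrable _ _
  rw [intervalIntegral.integral_sub (hi _ _) hi3,
    intervalIntegral.integral_sub (hi2 _ _ _) (hi2 _ _ _),
    intervalIntegral.integral_comp_sub_right, intervalIntegral.integral_comp_sub_left,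
    intervalIntegral.integral_comp_sub_left, sub_zero, sub_zero]
  exact intervalIntegral.integral_interval_sub_interval_comm' (hi _ _) (hi _ _) (hi _ _)

variable {U : Type*} [TopologicalSpace U]

/-- `∫_s^t η⁻¹ (Ψ(r, v_r) - Ψ(r - η, v_r)) dr`: the nonlinear integral of the curve
`r ↦ v_r` against the time derivative of `Ψ`, that derivative being replaced by a difference
quotient. -/
noncomputable def avgInt (Ψ : ℝ → U → 𝓗) (η s t : ℝ) (v : ℝ → U) : 𝓗 :=
  ∫ r in s..t, η⁻¹ • (Ψ r (v r) - Ψ (r - η) (v r))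

/-- `Ψ` is a Hilbert-valued field which is a fractional Brownian motion in time (frozen at
negative times) and whose spatial Gram kernel is that of `ψ`. -/
structure IsFracField (H : ℝ) (Ψ : ℝ → U → 𝓗) (ψ : U → 𝓗) : Prop where
  continuous : Continuous (fun z : ℝ × U => Ψ z.1 z.2)
  continuous_space : Continuous ψ
  inner_eq : ∀ t t' u u', inner ℝ (Ψ t u) (Ψ t' u')
    = fbmCov H (max t 0) (max t' 0) * inner ℝ (ψ u) (ψ u')

namespace IsFracField

variable {H : ℝ} {Ψ : ℝ → U → 𝓗} {ψ : U → 𝓗}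

/-- The common source of the bounds below: when the Gram kernel of the integrand is the increment
covariance of fractional Brownian motion times a kernel of size `κ²`, nonnegativity of the former
(this is where `1 / 2 ≤ H` enters) allows comparison with the averaged increments of a scalar
fractional Brownian motion, whose integral over `[s, t]` has norm at most `(t - s) ^ H`. -/
theorem norm_integral_le [CompleteSpace 𝓗] (hΨ : IsFracField H Ψ ψ) (hH : 1 / 2 ≤ H)
    {η s t κ : ℝ} (hη : 0 < η) (hst : s ≤ t) (hκ : 0 ≤ κ) {Θ P : ℝ → 𝓗}
    (hΘ : IntervalIntegrable Θ volume s t)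
    (hP : ∀ r ∈ Icc s t, ‖P r‖ ≤ κ)
    (hin : ∀ r ∈ Icc s t, ∀ r' ∈ Icc s t,
      inner ℝ (Θ r) (Θ r') = (η⁻¹ ^ 2 * (fbmCov H (max r 0) (max r' 0)
        - fbmCov H (max r 0) (max (r' - η) 0) - fbmCov H (max (r - η) 0) (max r' 0)
        + fbmCov H (max (r - η) 0) (max (r' - η) 0))) * inner ℝ (P r) (P r'))
    (hP0 : (∀ u, ψ u = 0) → ∀ r ∈ Icc s t, P r = 0) :
    ‖∫ r in s..t, Θ r‖ ≤ κ * (t - s) ^ H := by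
  have hpos : 0 ≤ (t - s) ^ H := Real.rpow_nonneg (by linarith) _
  by_cases hψ : ∀ u, ψ u = 0
  · have : ∀ r ∈ Icc s t, Θ r = 0 := by
      intro r hr
      have := hin r hr r hr
      rw [hP0 hψ r hr, inner_zero_left, mul_zero] at this
      exact inner_self_eq_zero.1 this
    rw [intervalIntegral.integral_congr (g := fun _ => (0 : 𝓗))
      (fun r hr => this r (by rwa [uIcc_of_le hst] at hr))]
    simp only [intervalIntegral.integral_zero, norm_zero]
    positivity
  push Not at hψ
  obtain ⟨u₀, hu₀⟩ := hψ
  set E : ℝ → 𝓗 := fun r => ‖ψ u₀‖⁻¹ • Ψ r u₀ with hE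
  have hEc : Continuous E :=
    (hΨ.continuous.comp (continuous_id.prodMk continuous_const)).const_smul _
  have hEi : ∀ r r', inner ℝ (E r) (E r') = fbmCov H (max r 0) (max r' 0) := by
    intro r r'
    simp only [hE, real_inner_smul_left, real_inner_smul_right, hΨ.inner_eq,
      real_inner_self_eq_norm_sq]
    have := norm_ne_zero_iff.2 hu₀
    field_simp
  set e : ℝ → 𝓗 := fun r => η⁻¹ • (E r - E (r - η)) with he
  have hec : Continuous e :=
    (hEc.sub (hEc.comp (continuous_id.sub continuous_const))).const_smul _
  have hei : ∀ r r', inner ℝ (e r) (e r') = η⁻¹ ^ 2 * (fbmCov H (max r 0) (max r' 0)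
        - fbmCov H (max r 0) (max (r' - η) 0) - fbmCov H (max (r - η) 0) (max r' 0)
        + fbmCov H (max (r - η) 0) (max (r' - η) 0)) := by
    intro r r'
    simp only [he, real_inner_smul_left, real_inner_smul_right, inner_sub_left, inner_sub_right,
      hEi]
    ring
  have h1 : ‖∫ r in s..t, Θ r‖ ≤ κ * ‖∫ r in s..t, e r‖ := by
    refine norm_integral_le_of_inner_eq_mul hst hκ hΘ (hec.intervalIntegrable _ _) ?_ hP ?_
    · intro r _ r' _
      rw [hei]
      exact mul_nonneg (by positivity) (fbmCov_rect_nonneg hH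
        (max_le_max (by linarith) le_rfl) (max_le_max (by linarith) le_rfl))
    · intro r hr r' hr'
      rw [hei, hin r hr r' hr']
  refine h1.trans (mul_le_mul_of_nonneg_left ?_ hκ)
  have h2 : ∀ a b : ℝ, ‖E a - E b‖ ≤ |a - b| ^ H := by
    intro a b
    have h3 : ‖E a - E b‖ ^ 2 = |max a 0 - max b 0| ^ (2 * H) := by
      rw [← real_inner_self_eq_norm_sq, ← fbmCov_self_sub (by linarith)]
      simp only [inner_sub_left, inner_sub_right, hEi]
      rw [fbmCov_comm H (max b 0) (max a 0)]
      ring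
    have h4 : |max a 0 - max b 0| ^ (2 * H) ≤ (|a - b| ^ H) ^ 2 := by
      rw [← Real.rpow_natCast (|a - b| ^ H), ← Real.rpow_mul (abs_nonneg _), mul_comm H]
      exact Real.rpow_le_rpow (abs_nonneg _) (abs_max_sub_max_le_abs _ _ _)
        (by norm_num; linarith)
    exact (sq_le_sq₀ (norm_nonneg _) (Real.rpow_nonneg (abs_nonneg _) _)).1 (h3.trans_le h4)
  rw [he, intervalIntegral.integral_smul, integral_sub_shift hEc, norm_smul, Real.norm_eq_abs,
    abs_of_pos (inv_pos.2 hη)]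
  have h5 : ‖∫ h in (0 : ℝ)..η, (E (t - h) - E (s - h))‖ ≤ (t - s) ^ H * |η - 0| := by
    refine intervalIntegral.norm_integral_le_of_norm_le_const fun h _ => ?_
    refine (h2 _ _).trans (le_of_eq ?_)
    rw [sub_sub_sub_cancel_right, abs_of_nonneg (by linarith)]
  rw [sub_zero, abs_of_pos hη] at h5
  calc η⁻¹ * ‖∫ h in (0 : ℝ)..η, (E (t - h) - E (s - h))‖ ≤ η⁻¹ * ((t - s) ^ H * η) := by gcongr
    _ = (t - s) ^ H := by field_simp

theorem continuousOn_comp (hΨ : IsFracField H Ψ ψ) {v : ℝ → U} {S : Set ℝ} (hv : ContinuousOn v S)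
    (η : ℝ) : ContinuousOn (fun r => η⁻¹ • (Ψ r (v r) - Ψ (r - η) (v r))) S :=
  ((hΨ.continuous.comp_continuousOn (continuousOn_id.prodMk hv)).sub
    (hΨ.continuous.comp_continuousOn
      ((continuousOn_id.sub continuousOn_const).prodMk hv))).const_smul _

/-- The nonlinear integral is bounded in terms of the spatial size of the curve, uniformly in the
time-smoothing parameter. -/
theorem norm_avgInt_le [CompleteSpace 𝓗] (hΨ : IsFracField H Ψ ψ) (hH : 1 / 2 ≤ H)
    {η s t κ : ℝ} (hη : 0 < η) (hst : s ≤ t) (hκ : 0 ≤ κ) {v : ℝ → U}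
    (hv : ContinuousOn v (Icc s t)) (hP : ∀ r ∈ Icc s t, ‖ψ (v r)‖ ≤ κ) :
    ‖avgInt Ψ η s t v‖ ≤ κ * (t - s) ^ H := by
  refine hΨ.norm_integral_le hH hη hst hκ
    ((hΨ.continuousOn_comp (by rwa [uIcc_of_le hst]) η).intervalIntegrable) hP ?_
    (fun h r _ => h _)
  intro r _ r' _
  simp only [real_inner_smul_left, real_inner_smul_right, inner_sub_left, inner_sub_right,
    hΨ.inner_eq]
  ring

/-- Closeness of two curves in the spatial seminorm makes their integrals close, uniformly in the
time-smoothing parameter. -/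
theorem norm_avgInt_sub_le [CompleteSpace 𝓗] (hΨ : IsFracField H Ψ ψ) (hH : 1 / 2 ≤ H)
    {η s t κ : ℝ} (hη : 0 < η) (hst : s ≤ t) (hκ : 0 ≤ κ) {v v' : ℝ → U} (hv : ContinuousOn v (Icc s t))
    (hv' : IntervalIntegrable (fun r => η⁻¹ • (Ψ r (v' r) - Ψ (r - η) (v' r))) volume s t)
    (hP : ∀ r ∈ Icc s t, ‖ψ (v r) - ψ (v' r)‖ ≤ κ) :
    ‖avgInt Ψ η s t v - avgInt Ψ η s t v'‖ ≤ κ * (t - s) ^ H := by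
  have hi : IntervalIntegrable (fun r => η⁻¹ • (Ψ r (v r) - Ψ (r - η) (v r))) volume s t :=
    (hΨ.continuousOn_comp (by rwa [uIcc_of_le hst]) η).intervalIntegrable
  rw [avgInt, avgInt, ← intervalIntegral.integral_sub hi hv']
  refine hΨ.norm_integral_le hH hη hst hκ (hi.sub hv') hP ?_ (fun h r _ => by simp [h])
  intro r _ r' _
  simp only [real_inner_smul_left, real_inner_smul_right, inner_sub_left, inner_sub_right,
    hΨ.inner_eq]
  ring

/-- For a constant curve, the nonlinear integral converges to the increment of the field. -/
theorem tendsto_avgInt_const [CompleteSpace 𝓗] (hΨ : IsFracField H Ψ ψ) (s t : ℝ) (u : U) :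
    Tendsto (fun η => avgInt Ψ η s t (fun _ => u)) (𝓝[>] 0) (𝓝 (Ψ t u - Ψ s u)) := by
  have hc : Continuous (fun r => Ψ r u) :=
    hΨ.continuous.comp (continuous_id.prodMk continuous_const)
  have hg : Continuous (fun h => Ψ (t - h) u - Ψ (s - h) u) :=
    (hc.comp (continuous_const.sub continuous_id)).sub
      (hc.comp (continuous_const.sub continuous_id))
  have hd := intervalIntegral.integral_hasDerivAt_right (hg.intervalIntegrable 0 0)
    (hg.stronglyMeasurableAtFilter _ _) hg.continuousAt
  have h1 := hd.tendsto_slope_zero_right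
  simp only [sub_zero, intervalIntegral.integral_same, zero_add] at h1
  refine h1.congr fun η => ?_
  rw [avgInt, intervalIntegral.integral_smul, integral_sub_shift hc]

/-- Uniform convergence of the curves makes the nonlinear integrals converge as the time smoothing
parameter tends to zero: both are compared with the integral along a step curve, for which the
limit is a finite sum of increments of the field. -/
theorem exists_tendsto_avgInt [CompleteSpace 𝓗] (hΨ : IsFracField H Ψ ψ) (hH : 1 / 2 ≤ H)
    {t : ℝ} (ht : 0 ≤ t) {ι : Type*} {l : Filter ι} [l.NeBot] {v : ι → ℝ → U} {v₀ : ℝ → U}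
    (hv : ∀ i, ContinuousOn (v i) (Icc 0 t)) (hv₀ : ContinuousOn v₀ (Icc 0 t))
    (hlim : ∀ κ > 0, ∀ᶠ i in l, ∀ r ∈ Icc 0 t, ‖ψ (v i r) - ψ (v₀ r)‖ ≤ κ) :
    ∃ J, Tendsto (fun z : ι × ℝ => avgInt Ψ z.2 0 t (v z.1)) (l ×ˢ 𝓝[>] 0) (𝓝 J) := by
  rcases eq_or_lt_of_le ht with rfl | ht
  · exact ⟨0, by simp [avgInt]⟩
  suffices key : ∀ κ > 0, ∃ J', ∀ᶠ z : ι × ℝ in l ×ˢ 𝓝[>] 0,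
      ‖avgInt Ψ z.2 0 t (v z.1) - J'‖ < κ by
    refine cauchy_map_iff_exists_tendsto.1 (Metric.cauchy_iff.2 ⟨inferInstance, fun κ hκ => ?_⟩)
    obtain ⟨J', hJ'⟩ := key (κ / 2) (half_pos hκ)
    refine ⟨Metric.ball J' (κ / 2), ?_, ?_⟩
    · refine mem_map.2 ?_
      filter_upwards [hJ'] with z hz
      simpa [dist_eq_norm] using hz
    · intro x hx y hy
      calc dist x y ≤ dist x J' + dist y J' := dist_triangle_right _ _ _
        _ < κ / 2 + κ / 2 := add_lt_add hx hy
        _ = κ := by ring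
  intro κ hκ
  have htH : 0 < t ^ H := Real.rpow_pos_of_pos ht _
  set κ' := κ / (4 * t ^ H) with hκ'
  have hκ'0 : 0 < κ' := by positivity
  have huc : UniformContinuousOn (fun r => ψ (v₀ r)) (Icc 0 t) :=
    isCompact_Icc.uniformContinuousOn_of_continuous (hΨ.continuous_space.comp_continuousOn hv₀)
  obtain ⟨δ₀, hδ₀, hδ⟩ := Metric.uniformContinuousOn_iff.1 huc κ' hκ'0
  obtain ⟨m, hm⟩ := exists_nat_gt (t / δ₀)
  have hm0 : (0 : ℝ) < m := lt_of_le_of_lt (by positivity) hm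
  set δ := t / m with hδdef
  have hδ0 : 0 < δ := by positivity
  have hδlt : δ < δ₀ := by
    rw [hδdef, div_lt_iff₀ hm0]
    rw [div_lt_iff₀ hδ₀] at hm
    linarith
  have hmδ : (m : ℝ) * δ = t := by rw [hδdef]; field_simp
  set v' : ℝ → U := fun r => v₀ (⌈r / δ⌉₊ * δ) with hv'
  have hstep : ∀ k : ℕ, ∀ r ∈ Ioc ((k : ℝ) * δ) ((k + 1 : ℕ) * δ), v' r = v₀ ((k + 1 : ℕ) * δ) := by
    intro k r hr
    have : ⌈r / δ⌉₊ = k + 1 := by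
      rw [Nat.ceil_eq_iff (by omega)]
      constructor
      · rw [Nat.add_sub_cancel, lt_div_iff₀ hδ0]; exact hr.1
      · rw [div_le_iff₀ hδ0]; exact hr.2
    simp only [hv', this]
  have hmono : ∀ k : ℕ, (k : ℝ) * δ ≤ (k + 1 : ℕ) * δ := fun k => by
    push_cast; nlinarith
  have hci : ∀ (η : ℝ) (k : ℕ) (u : U), IntervalIntegrable
      (fun r => η⁻¹ • (Ψ r u - Ψ (r - η) u)) volume (k * δ) ((k + 1 : ℕ) * δ) := fun η k u =>
    (hΨ.continuousOn_comp (v := fun _ => u) continuousOn_const η).intervalIntegrable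
  have hpi : ∀ (η : ℝ) (k : ℕ), IntervalIntegrable
      (fun r => η⁻¹ • (Ψ r (v' r) - Ψ (r - η) (v' r))) volume (k * δ) ((k + 1 : ℕ) * δ) := by
    intro η k
    refine (hci η k (v₀ ((k + 1 : ℕ) * δ))).congr fun r hr => ?_
    rw [uIoc_of_le (hmono k)] at hr
    simp only [hstep k r hr]
  have hint : ∀ η : ℝ, IntervalIntegrable
      (fun r => η⁻¹ • (Ψ r (v' r) - Ψ (r - η) (v' r))) volume 0 t := by
    intro η
    have := IntervalIntegrable.trans_iterate (a := fun k : ℕ => (k : ℝ) * δ) (n := m)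
      (fun k _ => hpi η k)
    simpa [hmδ] using this
  have hsum : ∀ η : ℝ, avgInt Ψ η 0 t v' = ∑ k ∈ Finset.range m,
      avgInt Ψ η (k * δ) ((k + 1 : ℕ) * δ) (fun _ => v₀ ((k + 1 : ℕ) * δ)) := by
    intro η
    have h1 := intervalIntegral.sum_integral_adjacent_intervals
      (a := fun k : ℕ => (k : ℝ) * δ) (n := m) (fun k _ => hpi η k)
    simp only [Nat.cast_zero, zero_mul, hmδ] at h1
    rw [avgInt, ← h1]
    refine Finset.sum_congr rfl fun k _ => ?_
    refine intervalIntegral.integral_congr_ae (ae_of_all _ fun r hr => ?_)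
    rw [uIoc_of_le (hmono k)] at hr
    simp only [hstep k r hr]
  refine ⟨∑ k ∈ Finset.range m, (Ψ ((k + 1 : ℕ) * δ) (v₀ ((k + 1 : ℕ) * δ))
    - Ψ (k * δ) (v₀ ((k + 1 : ℕ) * δ))), ?_⟩
  have hT : Tendsto (fun η => avgInt Ψ η 0 t v') (𝓝[>] 0) (𝓝 (∑ k ∈ Finset.range m,
      (Ψ ((k + 1 : ℕ) * δ) (v₀ ((k + 1 : ℕ) * δ)) - Ψ (k * δ) (v₀ ((k + 1 : ℕ) * δ))))) := by
    simp only [hsum]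
    exact tendsto_finsetSum _ fun k _ => hΨ.tendsto_avgInt_const _ _ _
  have hT' := Metric.tendsto_nhds.1 hT (κ / 2) (half_pos hκ)
  filter_upwards [(hlim κ' hκ'0).prod_mk (hT'.and self_mem_nhdsWithin)] with z hz
  obtain ⟨hz1, hz2, hz3⟩ := hz
  have hclose : ∀ r ∈ Icc 0 t, ‖ψ (v z.1 r) - ψ (v' r)‖ ≤ 2 * κ' := by
    intro r hr
    have hr1 : (⌈r / δ⌉₊ : ℝ) * δ < r + δ := by
      have := Nat.ceil_lt_add_one (div_nonneg hr.1 hδ0.le)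
      calc (⌈r / δ⌉₊ : ℝ) * δ < (r / δ + 1) * δ := by gcongr
        _ = r + δ := by field_simp
    have hr2 : r ≤ (⌈r / δ⌉₊ : ℝ) * δ := by
      rw [← div_le_iff₀ hδ0]; exact Nat.le_ceil _
    have hr3 : (⌈r / δ⌉₊ : ℝ) * δ ≤ t := by
      rw [← hmδ]
      refine mul_le_mul_of_nonneg_right ?_ hδ0.le
      exact_mod_cast Nat.ceil_le.2 (by rw [div_le_iff₀ hδ0, hmδ]; exact hr.2)
    have h2 : ‖ψ (v₀ r) - ψ (v' r)‖ < κ' := by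
      rw [← dist_eq_norm]
      refine hδ r hr _ ⟨hr.1.trans hr2, hr3⟩ ?_
      rw [Real.dist_eq, abs_sub_comm, abs_of_nonneg (by linarith)]
      linarith
    calc ‖ψ (v z.1 r) - ψ (v' r)‖
        ≤ ‖ψ (v z.1 r) - ψ (v₀ r)‖ + ‖ψ (v₀ r) - ψ (v' r)‖ := norm_sub_le_norm_sub_add_norm_sub _ _ _
      _ ≤ 2 * κ' := by linarith [hz1 r hr]
  have h3 := hΨ.norm_avgInt_sub_le hH hz3 ht.le (by positivity) (hv z.1) (hint z.2) hclose
  rw [sub_zero] at h3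
  rw [dist_eq_norm] at hz2
  have h4 : 2 * κ' * t ^ H = κ / 2 := by rw [hκ']; field_simp; norm_num
  calc _ ≤ ‖avgInt Ψ z.2 0 t (v z.1) - avgInt Ψ z.2 0 t v'‖ + _ :=
        norm_sub_le_norm_sub_add_norm_sub _ (avgInt Ψ z.2 0 t v') _
    _ < κ / 2 + κ / 2 := by linarith
    _ = κ := by ring

end IsFracField

end Hilbert

end FracBSDE

/-! ### Gaussian subspaces of `L²` -/

namespace FracBSDE

section GaussianSpace

variable {Ω : Type*} [MeasurableSpace Ω] {μ : Measure Ω}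

/-- The Bochner integral of an `L²`-valued function is computed pointwise. -/
theorem coeFn_integral_Lp [IsProbabilityMeasure μ] {Z : Type*} [MeasurableSpace Z]
    {lam : Measure Z} [SFinite lam] {F : Z → Lp ℝ 2 μ} (hF : Integrable F lam) {f : Z → Ω → ℝ}
    (hf : AEStronglyMeasurable (fun z : Z × Ω => f z.1 z.2) (lam.prod μ))
    (h : ∀ᵐ z ∂lam, F z =ᵐ[μ] f z) :
    Integrable (fun z : Z × Ω => f z.1 z.2) (lam.prod μ) ∧
      ((∫ z, F z ∂lam : Lp ℝ 2 μ) : Ω → ℝ) =ᵐ[μ] fun ω => ∫ z, f z ω ∂lam := by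
  have h1 : ∀ z, Integrable (F z : Ω → ℝ) μ := fun z =>
    (Lp.memLp (F z)).integrable (by norm_num)
  have hle : ∀ X : Lp ℝ 2 μ, ∫ ω, ‖X ω‖ ∂μ ≤ ‖X‖ := by
    intro X
    rw [Lp.norm_def, integral_norm_eq_lintegral_enorm (Lp.aestronglyMeasurable X),
      ← eLpNorm_one_eq_lintegral_enorm]
    exact ENNReal.toReal_mono (Lp.eLpNorm_ne_top X)
      (eLpNorm_le_eLpNorm_of_exponent_le (by norm_num) (Lp.aestronglyMeasurable X))
  have hint : Integrable (fun z : Z × Ω => f z.1 z.2) (lam.prod μ) := by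
    rw [integrable_prod_iff hf]
    refine ⟨?_, hF.norm.mono' hf.norm.integral_prod_right' ?_⟩
    · filter_upwards [h] with z hz
      exact (h1 z).congr hz
    · filter_upwards [h] with z hz
      rw [Real.norm_of_nonneg (integral_nonneg fun _ => norm_nonneg _)]
      refine le_trans (le_of_eq (integral_congr_ae ?_)) (hle (F z))
      filter_upwards [hz] with ω hω
      rw [hω]
  refine ⟨hint, ?_⟩
  refine Integrable.ae_eq_of_forall_setIntegral_eq _ _
    ((Lp.memLp _).integrable (by norm_num)) hint.integral_prod_right ?_
  intro A hA hA'
  have e1 : ∫ ω in A, (∫ z, F z ∂lam : Lp ℝ 2 μ) ω ∂μ = ∫ z, ∫ ω in A, F z ω ∂μ ∂lam := by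
    rw [← L2.inner_indicatorConstLp_one (𝕜 := ℝ) hA hA'.ne,
      ← integral_inner hF]
    simp only [L2.inner_indicatorConstLp_one]
  rw [e1]
  have hint' : Integrable (fun z : Z × Ω => f z.1 z.2) (lam.prod (μ.restrict A)) := by
    refine hint.mono_measure ?_
    exact Measure.prod_mono le_rfl Measure.restrict_le_self
  rw [integral_integral_swap (f := fun ω z => f z ω) (by
    exact hint'.swap)]
  refine integral_congr_ae ?_
  filter_upwards [h] with z hz
  exact integral_congr_ae (ae_restrict_of_ae hz)

/-- The sub-Gaussian bound `E[exp X] ≤ exp(‖X‖² / 2)` passes from a subspace of `L²` to its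
closure. -/
theorem lintegral_exp_le_of_mem_closure {S : Submodule ℝ (Lp ℝ 2 μ)}
    (hS : ∀ X ∈ S, ∫⁻ ω, ENNReal.ofReal (Real.exp (X ω)) ∂μ
      ≤ ENNReal.ofReal (Real.exp (‖X‖ ^ 2 / 2)))
    {X : Lp ℝ 2 μ} (hX : X ∈ S.topologicalClosure) :
    ∫⁻ ω, ENNReal.ofReal (Real.exp (X ω)) ∂μ ≤ ENNReal.ofReal (Real.exp (‖X‖ ^ 2 / 2)) := by
  rw [← SetLike.mem_coe, Submodule.topologicalClosure_coe, mem_closure_iff_seq_limit] at hX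
  obtain ⟨x, hxS, hx⟩ := hX
  obtain ⟨ns, hns, hae⟩ := (tendstoInMeasure_of_tendsto_Lp hx).exists_seq_tendsto_ae
  have h1 : ∫⁻ ω, ENNReal.ofReal (Real.exp (X ω)) ∂μ
      = ∫⁻ ω, liminf (fun i => ENNReal.ofReal (Real.exp (x (ns i) ω))) atTop ∂μ := by
    refine lintegral_congr_ae ?_
    filter_upwards [hae] with ω hω
    exact ((ENNReal.continuous_ofReal.comp Real.continuous_exp).continuousAt.tendsto.comp
      hω).liminf_eq.symm
  rw [h1]
  refine (lintegral_liminf_le' fun i => ?_).trans ?_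
  · exact (Real.measurable_exp.comp_aemeasurable
      (Lp.aestronglyMeasurable _).aemeasurable).ennreal_ofReal
  have h2 : Tendsto (fun i => ENNReal.ofReal (Real.exp (‖x (ns i)‖ ^ 2 / 2))) atTop
      (𝓝 (ENNReal.ofReal (Real.exp (‖X‖ ^ 2 / 2)))) := by
    have h3 : Continuous fun y : Lp ℝ 2 μ => ENNReal.ofReal (Real.exp (‖y‖ ^ 2 / 2)) :=
      ENNReal.continuous_ofReal.comp
        (Real.continuous_exp.comp ((continuous_norm.pow 2).div_const 2))
    exact (h3.tendsto X).comp (hx.comp hns.tendsto_atTop)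
  rw [← h2.liminf_eq]
  exact liminf_le_liminf (Eventually.of_forall fun i => hS _ (hxS _))

theorem _root_.MeasureTheory.Lp.coeFn_finset_sum_smul {ι : Type*} (s : Finset ι) (c : ι → ℝ)
    (F : ι → Lp ℝ 2 μ) :
    ((∑ i ∈ s, c i • F i : Lp ℝ 2 μ) : Ω → ℝ) =ᵐ[μ] fun ω => ∑ i ∈ s, c i * F i ω := by
  classical
  induction s using Finset.induction_on with
  | empty =>
    simp only [Finset.sum_empty]
    exact Lp.coeFn_zero _ _ _
  | insert i s his ih =>
    rw [Finset.sum_insert his]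
    filter_upwards [Lp.coeFn_add (c i • F i) (∑ i ∈ s, c i • F i), Lp.coeFn_smul (c i) (F i), ih]
      with ω h1 h2 h3
    rw [h1, Pi.add_apply, h2, h3, Finset.sum_insert his, Pi.smul_apply, smul_eq_mul]

/-- Finite linear combinations of a centred Gaussian process are sub-Gaussian. -/
theorem lintegral_exp_le_of_mem_span [IsProbabilityMeasure μ] {ι : Type*} {w : ι → Ω → ℝ}
    (hw : IsGaussianProcess w μ) (hw0 : ∀ i, ∫ ω, w i ω ∂μ = 0) {F : ι → Lp ℝ 2 μ}
    (hF : ∀ i, F i =ᵐ[μ] w i) {X : Lp ℝ 2 μ} (hX : X ∈ Submodule.span ℝ (range F)) :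
    ∫⁻ ω, ENNReal.ofReal (Real.exp (X ω)) ∂μ ≤ ENNReal.ofReal (Real.exp (‖X‖ ^ 2 / 2)) := by
  classical
  obtain ⟨c, rfl⟩ := Finsupp.mem_span_range_iff_exists_finsupp.1 hX
  set X : Lp ℝ 2 μ := c.sum fun i a => a • F i with hXdef
  have hae : X =ᵐ[μ] fun ω => ∑ i ∈ c.support, c i * w i ω := by
    have h2 : ∀ᵐ ω ∂μ, ∀ i ∈ c.support, F i ω = w i ω :=
      (ae_ball_iff c.support.countable_toSet).2 fun i _ => hF i
    filter_upwards [Lp.coeFn_finset_sum_smul c.support c F, h2] with ω h1 h2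
    rw [hXdef, Finsupp.sum, h1]
    exact Finset.sum_congr rfl fun i hi => by rw [h2 i hi]
  have hlaw : HasGaussianLaw (fun ω => ∑ i ∈ c.support, c i * w i ω) μ := by
    have h1 := (hw.hasGaussianLaw c.support).map_fun
      (∑ i : c.support, c i • ContinuousLinearMap.proj (R := ℝ) (φ := fun _ : c.support => ℝ) i)
    refine h1.congr (ae_of_all _ fun ω => ?_)
    simp only [sum_apply, smul_apply,
      ContinuousLinearMap.proj_apply, Finset.restrict, smul_eq_mul]
    exact Finset.sum_coe_sort c.support (fun i => c i * w i ω)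
  have hlawX : HasGaussianLaw (X : Ω → ℝ) μ := hlaw.congr hae.symm
  have hwi : ∀ i, Integrable (w i) μ := fun i =>
    ((Lp.memLp (F i)).integrable (by norm_num)).congr (hF i)
  have hmean : ∫ ω, X ω ∂μ = 0 := by
    rw [integral_congr_ae hae, integral_finsetSum _ fun i _ => (hwi i).const_mul _]
    simp [integral_const_mul, hw0]
  have hvar : Var[(X : Ω → ℝ); μ] = ‖X‖ ^ 2 := by
    rw [variance_eq_sub (Lp.memLp X), hmean, ← real_inner_self_eq_norm_sq, L2.inner_def]
    simp [pow_two]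
  have hmap := hlawX.map_eq_gaussianReal
  have hm := mgf_gaussianReal hmap 1
  have hint : Integrable (fun ω => Real.exp (X ω)) μ := by
    have h1 := integrable_exp_mul_gaussianReal (μ := ∫ ω, X ω ∂μ)
      (v := Var[(X : Ω → ℝ); μ].toNNReal) 1
    rw [← hmap] at h1
    simpa [Function.comp_def] using h1.comp_aemeasurable hlawX.aemeasurable
  rw [← ofReal_integral_eq_lintegral_ofReal hint (ae_of_all _ fun _ => (Real.exp_pos _).le)]
  refine ENNReal.ofReal_le_ofReal (le_of_eq ?_)
  simp only [mgf, one_mul, hmean, hvar] at hm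
  rw [hm, Real.coe_toNNReal _ (by positivity)]
  simp

end GaussianSpace

end FracBSDE

/-! ### The standard Gaussian density -/

namespace FracBSDE

section Gauss

variable {d : ℕ}

theorem continuous_heatKernel (ε : ℝ) : Continuous (heatKernel ε : (Fin d → ℝ) → ℝ) := by
  unfold heatKernel
  fun_prop

theorem heatKernel_nonneg {ε : ℝ} (hε : 0 ≤ ε) (x : Fin d → ℝ) : 0 ≤ heatKernel ε x :=
  mul_nonneg (Real.rpow_nonneg (by positivity) _) (Real.exp_pos _).le

/-- The standard Gaussian measure on `ℝᵈ`, with density `p₁`. -/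
noncomputable def stdGauss (d : ℕ) : Measure (Fin d → ℝ) :=
  volume.withDensity fun n => ENNReal.ofReal (heatKernel 1 n)

theorem integral_stdGauss {E : Type*} [NormedAddCommGroup E] [NormedSpace ℝ E]
    (f : (Fin d → ℝ) → E) : ∫ n, f n ∂stdGauss d = ∫ n, heatKernel 1 n • f n := by
  rw [stdGauss, integral_withDensity_eq_integral_toReal_smul
    (continuous_heatKernel 1).measurable.ennreal_ofReal (ae_of_all _ fun _ => ENNReal.ofReal_lt_top)]
  simp only [ENNReal.toReal_ofReal (heatKernel_nonneg zero_le_one _)]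

theorem integrable_exp_stdGauss (c : ℝ) :
    Integrable (fun n : Fin d → ℝ => Real.exp (c * ∑ i, |n i|)) (stdGauss d) := by
  rw [stdGauss, integrable_withDensity_iff_integrable_smul'
    (continuous_heatKernel 1).measurable.ennreal_ofReal (ae_of_all _ fun _ => ENNReal.ofReal_lt_top)]
  simp only [ENNReal.toReal_ofReal (heatKernel_nonneg zero_le_one _)]
  have h1 : Integrable (fun x : ℝ => Real.exp (-(x ^ 2) / 2 + c * |x|)) := by
    refine ((integrable_exp_neg_mul_sq (b := 1 / 4) (by norm_num)).const_mul
      (Real.exp (c ^ 2))).mono' (by fun_prop) (ae_of_all _ fun x => ?_)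
    rw [Real.norm_of_nonneg (Real.exp_pos _).le, ← Real.exp_add]
    refine Real.exp_le_exp.2 ?_
    nlinarith [sq_nonneg (c - |x| / 2), sq_abs x]
  have h2 := (Integrable.fintype_prod (fun _ : Fin d => h1)).const_mul
    ((2 * Real.pi * 1) ^ (-(d : ℝ) / 2))
  refine h2.congr (ae_of_all _ fun n => ?_)
  simp only [heatKernel, smul_eq_mul, ← Real.exp_sum, mul_assoc, ← Real.exp_add]
  congr 3
  rw [Finset.sum_add_distrib, ← Finset.mul_sum, ← Finset.sum_div, Finset.sum_neg_distrib]
  ring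

instance isFiniteMeasure_stdGauss : IsFiniteMeasure (stdGauss d) := by
  have h := integrable_exp_stdGauss (d := d) 0
  simp only [zero_mul, Real.exp_zero] at h
  exact (integrable_const_iff_isFiniteMeasure one_ne_zero).1 h

/-- Scaling of the heat kernel. -/
theorem integral_heatKernel_sub {E : Type*} [NormedAddCommGroup E] [NormedSpace ℝ E]
    {ε : ℝ} (hε : 0 < ε) (x : Fin d → ℝ) (f : (Fin d → ℝ) → E) :
    ∫ y, heatKernel ε (x - y) • f y = ∫ n, f (x + √ε • n) ∂stdGauss d := by
  have h1 := integral_add_left_eq_self (μ := (volume : Measure (Fin d → ℝ)))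
    (fun y => heatKernel ε (x - y) • f y) x
  have hs : 0 < √ε := Real.sqrt_pos.2 hε
  have h2 := Measure.integral_comp_smul (volume : Measure (Fin d → ℝ))
    (fun y => heatKernel ε (x - (x + y)) • f (x + y)) (√ε)
  rw [← h1, integral_stdGauss]
  have h3 : (0 : ℝ) < √ε ^ d := by positivity
  rw [Module.finrank_fin_fun, abs_of_pos (by positivity)] at h2
  have h4 : ∫ y, heatKernel ε (x - (x + y)) • f (x + y)
      = √ε ^ d • ∫ n, heatKernel ε (x - (x + √ε • n)) • f (x + √ε • n) := by
    rw [h2, smul_smul, mul_inv_cancel₀ h3.ne', one_smul]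
  rw [h4, ← integral_smul]
  refine integral_congr_ae (ae_of_all _ fun n => ?_)
  simp only [smul_smul]
  congr 1
  simp only [heatKernel, sub_add_cancel_left, Pi.neg_apply, Pi.smul_apply, smul_eq_mul, neg_sq,
    mul_pow, Real.sq_sqrt hε.le, ← Finset.mul_sum, mul_one]
  have e1 : -(ε * ∑ i, n i ^ 2) / (2 * ε) = -(∑ i, n i ^ 2) / 2 := by field_simp
  have e2 : √ε ^ d * (2 * Real.pi * ε) ^ (-(d : ℝ) / 2) = (2 * Real.pi) ^ (-(d : ℝ) / 2) := by
    rw [Real.mul_rpow (by positivity) hε.le, ← Real.rpow_natCast, Real.sqrt_eq_rpow,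
      ← Real.rpow_mul hε.le, mul_comm, mul_assoc, ← Real.rpow_add hε]
    ring_nf
    simp
  rw [e1, ← mul_assoc, e2]

theorem noiseApprox_eq {Ω : Type*} (W : ℝ → (Fin d → ℝ) → Ω → ℝ) {ε : ℝ} (hε : 0 < ε)
    (η s : ℝ) (x : Fin d → ℝ) (ω : Ω) :
    noiseApprox W ε η s x ω = ∫ n, η⁻¹ * (W s (x + √ε • n) ω - W (max (s - η) 0) (x + √ε • n) ω)
      ∂stdGauss d := by
  rw [noiseApprox, stepIntegral, ← integral_heatKernel_sub hε x
    (fun y => η⁻¹ * (W s y ω - W (max (s - η) 0) y ω))]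
  refine integral_congr_ae (ae_of_all _ fun y => ?_)
  simp only [smul_eq_mul]
  ring

end Gauss

end FracBSDE

/-! ### The field as a curve in its Gaussian Hilbert space -/

namespace FracBSDE

theorem continuous_of_continuous_inner {A 𝓗 : Type*} [TopologicalSpace A] [NormedAddCommGroup 𝓗]
    [InnerProductSpace ℝ 𝓗] {f : A → 𝓗}
    (h : Continuous fun p : A × A => inner ℝ (f p.1) (f p.2)) : Continuous f := by
  rw [continuous_iff_continuousAt]
  intro a
  rw [ContinuousAt, tendsto_iff_norm_sub_tendsto_zero]
  have h1 : Tendsto (fun b => ‖f b - f a‖ ^ 2) (𝓝 a) (𝓝 0) := by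
    have h2 : Continuous fun b => inner ℝ (f b) (f b) - 2 * inner ℝ (f b) (f a)
        + inner ℝ (f a) (f a) :=
      ((h.comp (continuous_id.prodMk continuous_id)).sub
        (continuous_const.mul (h.comp (continuous_id.prodMk continuous_const)))).add
          continuous_const
    have h3 := h2.tendsto a
    have h4 : inner ℝ (f a) (f a) - 2 * inner ℝ (f a) (f a) + inner ℝ (f a) (f a) = (0 : ℝ) := by
      ring
    rw [h4] at h3
    refine h3.congr fun b => ?_
    rw [← real_inner_self_eq_norm_sq, real_inner_sub_sub_self]
  have h5 := (Real.continuous_sqrt.tendsto 0).comp h1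
  rw [Real.sqrt_zero] at h5
  exact h5.congr fun b => Real.sqrt_sq (norm_nonneg _)

theorem inner_integral_eq_mul {Z 𝓗 : Type*} [MeasurableSpace Z] {lam : Measure Z}
    [NormedAddCommGroup 𝓗] [InnerProductSpace ℝ 𝓗] [CompleteSpace 𝓗] {F G F' G' : Z → 𝓗} {c : ℝ}
    (hF : Integrable F lam) (hG : Integrable G lam) (hF' : Integrable F' lam)
    (hG' : Integrable G' lam)
    (h : ∀ z z', inner ℝ (F z) (G z') = c * inner ℝ (F' z) (G' z')) :
    inner ℝ (∫ z, F z ∂lam) (∫ z, G z ∂lam) = c * inner ℝ (∫ z, F' z ∂lam) (∫ z, G' z ∂lam) := by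
  have key : ∀ (f : Z → 𝓗), Integrable f lam → ∀ x : 𝓗,
      inner ℝ (∫ z, f z ∂lam) x = ∫ z, inner ℝ (f z) x ∂lam := by
    intro f hf x
    rw [real_inner_comm, ← integral_inner hf]
    simp only [real_inner_comm]
  rw [key F hF, key F' hF', ← integral_const_mul]
  refine integral_congr_ae (ae_of_all _ fun z => ?_)
  simp only
  rw [← integral_inner hG, ← integral_inner hG', ← integral_const_mul]
  exact integral_congr_ae (ae_of_all _ fun z' => h z z')

variable {Ω : Type*} [MeasurableSpace Ω] {μ : Measure Ω} {d : ℕ} {H0 : ℝ}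
  {H : Fin d → ℝ} {ρ : (Fin d → ℝ) → ℝ} {W : ℝ → (Fin d → ℝ) → Ω → ℝ}

/-- The spatial covariance of the weighted field. -/
noncomputable def spaceCov (H : Fin d → ℝ) (ρ : (Fin d → ℝ) → ℝ) (x y : Fin d → ℝ) : ℝ :=
  ρ x * ρ y * ∏ i, fbmCov (H i) (x i) (y i)

namespace IsWeightedFractionalField

theorem hasGaussianLaw (hW : IsWeightedFractionalField H0 H ρ W μ) (z : ℝ≥0 × (Fin d → ℝ)) :
    HasGaussianLaw (W z.1 z.2) μ := by
  have h := (hW.gaussian.hasGaussianLaw {z}).eval ⟨z, Finset.mem_singleton_self z⟩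
  exact h

theorem memLp (hW : IsWeightedFractionalField H0 H ρ W μ) (z : ℝ≥0 × (Fin d → ℝ)) :
    MemLp (W z.1 z.2) 2 μ :=
  (hW.hasGaussianLaw z).memLp_two

/-- The closed linear span of the field in `L²`. -/
noncomputable def gaussSpace (hW : IsWeightedFractionalField H0 H ρ W μ) :
    Submodule ℝ (Lp ℝ 2 μ) :=
  (Submodule.span ℝ (range fun z => (hW.memLp z).toLp)).topologicalClosure

instance (hW : IsWeightedFractionalField H0 H ρ W μ) : CompleteSpace hW.gaussSpace :=
  (Submodule.isClosed_topologicalClosure _).completeSpace_coe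

theorem lintegral_exp_le [IsProbabilityMeasure μ] (hW : IsWeightedFractionalField H0 H ρ W μ)
    (X : hW.gaussSpace) :
    ∫⁻ ω, ENNReal.ofReal (Real.exp ((X : Lp ℝ 2 μ) ω)) ∂μ
      ≤ ENNReal.ofReal (Real.exp (‖X‖ ^ 2 / 2)) :=
  lintegral_exp_le_of_mem_closure (fun _ hX => lintegral_exp_le_of_mem_span hW.gaussian
    (fun z => hW.mean_zero z.1 z.1.2 z.2) (fun z => (hW.memLp z).coeFn_toLp) hX) X.2

/-- `W(max t 0, x)` as an element of the Gaussian space of the field. -/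
noncomputable def curve (hW : IsWeightedFractionalField H0 H ρ W μ) (t : ℝ) (x : Fin d → ℝ) :
    hW.gaussSpace :=
  ⟨(hW.memLp (t.toNNReal, x)).toLp, Submodule.le_topologicalClosure _
    (Submodule.subset_span (mem_range_self _))⟩

theorem coeFn_curve (hW : IsWeightedFractionalField H0 H ρ W μ) (t : ℝ) (x : Fin d → ℝ) :
    ((hW.curve t x : Lp ℝ 2 μ) : Ω → ℝ) =ᵐ[μ] W (max t 0) x :=
  (hW.memLp (t.toNNReal, x)).coeFn_toLp

theorem inner_curve (hW : IsWeightedFractionalField H0 H ρ W μ) (t t' : ℝ) (x x' : Fin d → ℝ) :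
    inner ℝ (hW.curve t x) (hW.curve t' x')
      = fbmCov H0 (max t 0) (max t' 0) * spaceCov H ρ x x' := by
  rw [spaceCov, ← hW.covariance _ _ (le_max_right _ _) (le_max_right _ _)]
  rw [Submodule.coe_inner, L2.inner_def]
  refine integral_congr_ae ?_
  filter_upwards [hW.coeFn_curve t x, hW.coeFn_curve t' x'] with ω h1 h2
  rw [h1, h2, RCLike.inner_apply, mul_comm]
  rfl

theorem continuous_curve (hW : IsWeightedFractionalField H0 H ρ W μ) (hH0 : 0 < H0)
    (hH : ∀ i, 0 < H i) (hρ : Continuous ρ) :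
    Continuous fun z : ℝ × (Fin d → ℝ) => hW.curve z.1 z.2 := by
  refine continuous_of_continuous_inner ?_
  simp only [hW.inner_curve, spaceCov]
  refine ((continuous_fbmCov hH0).comp ((?_ : Continuous fun p : (ℝ × (Fin d → ℝ)) ×
    (ℝ × (Fin d → ℝ)) => max p.1.1 0).prodMk (?_ : Continuous fun p : (ℝ × (Fin d → ℝ)) ×
    (ℝ × (Fin d → ℝ)) => max p.2.1 0))).mul (Continuous.mul (by fun_prop)
    (continuous_finsetProd _ fun i _ => (continuous_fbmCov (hH i)).comp
      ((?_ : Continuous fun p : (ℝ × (Fin d → ℝ)) × (ℝ × (Fin d → ℝ)) => p.1.2 i).prodMk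
      (?_ : Continuous fun p : (ℝ × (Fin d → ℝ)) × (ℝ × (Fin d → ℝ)) => p.2.2 i))))
  all_goals fun_prop

end IsWeightedFractionalField

/-- The decay assumption on `ρ` bounds the standard deviation of the field by a product of powers
with exponents `Hᵢ - βᵢ / 2`. -/
theorem sqrt_spaceCov_le (hH : ∀ i, H i ∈ Ioo (1 / 2 : ℝ) 1) {β : Fin d → ℝ}
    (hβ : ∀ i, 0 < β i) {C : ℝ} (hC : ∀ x, 0 ≤ ρ x ∧ ρ x ≤ C * ∏ i, (1 + |x i|) ^ (-β i))
    (x : Fin d → ℝ) :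
    √(spaceCov H ρ x x) ≤ C * ∏ i, (1 + |x i|) ^ (H i - β i / 2) := by
  have hpos : ∀ i, 0 < 1 + |x i| := fun i => by positivity
  have h0 : 0 ≤ ∏ i, |x i| ^ H i := Finset.prod_nonneg fun i _ => Real.rpow_nonneg (abs_nonneg _) _
  have h1 : spaceCov H ρ x x = (ρ x * ∏ i, |x i| ^ H i) ^ 2 := by
    rw [spaceCov, mul_pow, ← Finset.prod_pow, pow_two]
    congr 1
    refine Finset.prod_congr rfl fun i _ => ?_
    have : 2 * H i ≠ 0 := by linarith [(hH i).1]
    rw [← Real.rpow_natCast (|x i| ^ H i), ← Real.rpow_mul (abs_nonneg _), mul_comm (H i)]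
    simp [fbmCov, Real.zero_rpow this]
  rw [h1, Real.sqrt_sq (mul_nonneg (hC x).1 h0)]
  have hCnn : 0 ≤ C := by
    have h2 := (hC x).1.trans (hC x).2
    exact nonneg_of_mul_nonneg_left h2
      (Finset.prod_pos fun i _ => Real.rpow_pos_of_pos (hpos i) _)
  calc ρ x * ∏ i, |x i| ^ H i
      ≤ (C * ∏ i, (1 + |x i|) ^ (-β i)) * ∏ i, (1 + |x i|) ^ H i := by
        refine mul_le_mul (hC x).2 ?_ h0 ((hC x).1.trans (hC x).2)
        exact Finset.prod_le_prod (fun i _ => Real.rpow_nonneg (abs_nonneg _) _) fun i _ =>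
          Real.rpow_le_rpow (abs_nonneg _) (by linarith) (by linarith [(hH i).1])
    _ = C * ∏ i, (1 + |x i|) ^ (H i - β i) := by
        rw [mul_assoc, ← Finset.prod_mul_distrib]
        congr 1
        refine Finset.prod_congr rfl fun i _ => ?_
        rw [← Real.rpow_add (hpos i)]
        ring_nf
    _ ≤ C * ∏ i, (1 + |x i|) ^ (H i - β i / 2) := by
        refine mul_le_mul_of_nonneg_left ?_ hCnn
        refine Finset.prod_le_prod (fun i _ => Real.rpow_nonneg (hpos i).le _) fun i _ => ?_
        exact Real.rpow_le_rpow_of_exponent_le (by linarith [abs_nonneg (x i)])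
          (by linarith [hβ i])

/-- A Gaussian shift costs only a factor whose moments under the Gaussian density are finite. -/
theorem prod_weight_le {a : Fin d → ℝ} (ha0 : ∀ i, 0 ≤ a i) (ha1 : ∀ i, a i ≤ 1) (σ : ℝ)
    (x n : Fin d → ℝ) :
    ∏ i, (1 + |(x + σ • n) i|) ^ a i
      ≤ (1 + ‖x‖) ^ (∑ i, a i) * Real.exp (|σ| * ∑ i, |n i|) := by
  have h1 : ∀ i, (1 + |(x + σ • n) i|) ^ a i ≤ (1 + ‖x‖) ^ a i * Real.exp (|σ| * |n i|) := by
    intro i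
    have e1 : 1 + |(x + σ • n) i| ≤ (1 + ‖x‖) * (1 + |σ| * |n i|) := by
      have e2 : |(x + σ • n) i| ≤ |x i| + |σ| * |n i| := by
        rw [← abs_mul]; exact abs_add_le _ _
      have e3 : |x i| ≤ ‖x‖ := norm_le_pi_norm x i
      have e4 : 0 ≤ |σ| * |n i| := by positivity
      nlinarith [norm_nonneg x]
    have e5 : (1 + |σ| * |n i|) ^ a i ≤ Real.exp (|σ| * |n i|) := by
      have e6 : 1 ≤ 1 + |σ| * |n i| := by linarith [mul_nonneg (abs_nonneg σ) (abs_nonneg (n i))]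
      calc (1 + |σ| * |n i|) ^ a i ≤ (1 + |σ| * |n i|) ^ (1 : ℝ) :=
            Real.rpow_le_rpow_of_exponent_le e6 (ha1 i)
        _ = |σ| * |n i| + 1 := by rw [Real.rpow_one]; ring
        _ ≤ _ := Real.add_one_le_exp _
    calc (1 + |(x + σ • n) i|) ^ a i ≤ ((1 + ‖x‖) * (1 + |σ| * |n i|)) ^ a i :=
          Real.rpow_le_rpow (by positivity) e1 (ha0 i)
      _ = (1 + ‖x‖) ^ a i * (1 + |σ| * |n i|) ^ a i :=
          Real.mul_rpow (by positivity) (by positivity)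
      _ ≤ _ := by gcongr
  calc ∏ i, (1 + |(x + σ • n) i|) ^ a i ≤ ∏ i, ((1 + ‖x‖) ^ a i * Real.exp (|σ| * |n i|)) :=
        Finset.prod_le_prod (fun i _ => Real.rpow_nonneg (by positivity) _) fun i _ => h1 i
    _ = _ := by
        rw [Finset.prod_mul_distrib, ← Real.exp_sum, ← Finset.mul_sum,
          Real.rpow_sum_of_pos (by positivity)]

/-- Growth condition on the standard deviation of the field. -/
structure HasGrowth (H : Fin d → ℝ) (ρ : (Fin d → ℝ) → ℝ) (C A : ℝ) : Prop where
  C_nonneg : 0 ≤ C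
  A_nonneg : 0 ≤ A
  le : ∀ (σ : ℝ) (x n : Fin d → ℝ), √(spaceCov H ρ (x + σ • n) (x + σ • n))
    ≤ C * (1 + ‖x‖) ^ A * Real.exp (|σ| * ∑ i, |n i|)

theorem exists_hasGrowth (hH : ∀ i, H i ∈ Ioo (1 / 2 : ℝ) 1) {β : Fin d → ℝ}
    (hβ : ∀ i, 0 < β i) (hβH : ∀ i, β i < 2 * H i)
    (hC : ∃ C : ℝ, ∀ x, 0 ≤ ρ x ∧ ρ x ≤ C * ∏ i, (1 + |x i|) ^ (-β i)) :
    ∃ C, HasGrowth H ρ C (∑ i, (H i - β i / 2)) := by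
  obtain ⟨C, hC⟩ := hC
  have hCnn : 0 ≤ C := by
    have h2 := (hC 0).1.trans (hC 0).2
    simpa using h2
  have ha0 : ∀ i, 0 ≤ H i - β i / 2 := fun i => by linarith [hβH i]
  refine ⟨C, hCnn, Finset.sum_nonneg fun i _ => ha0 i, fun σ x n => ?_⟩
  refine (sqrt_spaceCov_le hH hβ hC _).trans ?_
  rw [mul_assoc]
  exact mul_le_mul_of_nonneg_left
    (prod_weight_le ha0 (fun i => by linarith [(hH i).2, hβ i]) σ x n) hCnn

end FracBSDE

/-! ### Smoothing in space and the integral along a fixed path -/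

namespace FracBSDE

variable {Ω : Type*} [MeasurableSpace Ω] {μ : Measure Ω} {d : ℕ} {H0 : ℝ}
  {H : Fin d → ℝ} {ρ : (Fin d → ℝ) → ℝ} {W : ℝ → (Fin d → ℝ) → Ω → ℝ} {C A : ℝ}

namespace IsWeightedFractionalField

theorem norm_curve (hW : IsWeightedFractionalField H0 H ρ W μ) (hH0 : 0 < H0) (t : ℝ)
    (y : Fin d → ℝ) : ‖hW.curve t y‖ = (max t 0) ^ H0 * √(spaceCov H ρ y y) := by
  rw [norm_eq_sqrt_real_inner, hW.inner_curve, fbmCov_self hH0 (le_max_right _ _),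
    Real.sqrt_mul (by positivity), mul_comm 2 H0, Real.rpow_mul (le_max_right _ _)]
  congr 1
  rw [Real.rpow_two]
  exact Real.sqrt_sq (by positivity)

theorem norm_curve_le (hW : IsWeightedFractionalField H0 H ρ W μ) (hH0 : 0 < H0)
    (hg : HasGrowth H ρ C A) (t σ : ℝ) (x n : Fin d → ℝ) :
    ‖hW.curve t (x + σ • n)‖
      ≤ (max t 0) ^ H0 * (C * (1 + ‖x‖) ^ A * Real.exp (|σ| * ∑ i, |n i|)) := by
  rw [hW.norm_curve hH0]
  exact mul_le_mul_of_nonneg_left (hg.le σ x n) (by positivity)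

/-- The field smoothed in space at scale `σ`: the pair `u = (σ, x)` gives the scale and the
centre. -/
noncomputable def smoothCurve (hW : IsWeightedFractionalField H0 H ρ W μ) (t : ℝ)
    (u : ℝ × (Fin d → ℝ)) : hW.gaussSpace :=
  ∫ n, hW.curve t (u.2 + u.1 • n) ∂stdGauss d

theorem integrable_curve (hW : IsWeightedFractionalField H0 H ρ W μ) (hH0 : 0 < H0)
    (hH : ∀ i, 0 < H i) (hρ : Continuous ρ) (hg : HasGrowth H ρ C A) (t : ℝ)
    (u : ℝ × (Fin d → ℝ)) :
    Integrable (fun n => hW.curve t (u.2 + u.1 • n)) (stdGauss d) := by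
  refine Integrable.mono' (((integrable_exp_stdGauss |u.1|).const_mul (C * (1 + ‖u.2‖) ^ A)).const_mul
    ((max t 0) ^ H0)) ?_ (ae_of_all _ fun n => hW.norm_curve_le hH0 hg t u.1 u.2 n)
  exact ((hW.continuous_curve hH0 hH hρ).comp
    (continuous_const.prodMk (by fun_prop))).aestronglyMeasurable

theorem isFracField (hW : IsWeightedFractionalField H0 H ρ W μ) (hH0 : 0 < H0)
    (hH : ∀ i, 0 < H i) (hρ : Continuous ρ) (hg : HasGrowth H ρ C A) :
    IsFracField H0 hW.smoothCurve (hW.smoothCurve 1) := by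
  have hc : Continuous fun z : ℝ × (ℝ × (Fin d → ℝ)) => hW.smoothCurve z.1 z.2 := by
    rw [continuous_iff_continuousAt]
    rintro ⟨t, σ, x⟩
    refine continuousAt_of_dominated (bound := fun n => (|t| + 1) ^ H0 *
      (C * (1 + (‖x‖ + 1)) ^ A * Real.exp ((|σ| + 1) * ∑ i, |n i|))) ?_ ?_ ?_ ?_
    · refine Eventually.of_forall fun z => ?_
      exact (hW.integrable_curve hH0 hH hρ hg z.1 z.2).aestronglyMeasurable
    · have e1 : ∀ᶠ z : ℝ × (ℝ × (Fin d → ℝ)) in 𝓝 (t, σ, x), |z.1| < |t| + 1 :=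
        (continuous_fst.abs.tendsto (t, σ, x)).eventually (gt_mem_nhds (lt_add_one _))
      have e2 : ∀ᶠ z : ℝ × (ℝ × (Fin d → ℝ)) in 𝓝 (t, σ, x), |z.2.1| < |σ| + 1 :=
        (continuous_snd.fst.abs.tendsto (t, σ, x)).eventually (gt_mem_nhds (lt_add_one _))
      have e3 : ∀ᶠ z : ℝ × (ℝ × (Fin d → ℝ)) in 𝓝 (t, σ, x), ‖z.2.2‖ < ‖x‖ + 1 :=
        (continuous_snd.snd.norm.tendsto (t, σ, x)).eventually (gt_mem_nhds (lt_add_one _))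
      filter_upwards [e1, e2, e3] with z h1 h2 h3
      refine ae_of_all _ fun n => (hW.norm_curve_le hH0 hg z.1 z.2.1 z.2.2 n).trans ?_
      have hm : max z.1 0 ≤ |t| + 1 := max_le ((le_abs_self _).trans h1.le) (by positivity)
      have hC := hg.C_nonneg
      have hA := hg.A_nonneg
      gcongr
    · exact ((integrable_exp_stdGauss (|σ| + 1)).const_mul _).const_mul _
    · refine ae_of_all _ fun n => ?_
      exact ((hW.continuous_curve hH0 hH hρ).comp (f := fun z : ℝ × (ℝ × (Fin d → ℝ)) =>
        (z.1, z.2.2 + z.2.1 • n)) (by fun_prop)).continuousAt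
  refine ⟨hc, hc.comp (continuous_const.prodMk continuous_id), fun t t' u u' => ?_⟩
  refine inner_integral_eq_mul (hW.integrable_curve hH0 hH hρ hg t u)
    (hW.integrable_curve hH0 hH hρ hg t' u') (hW.integrable_curve hH0 hH hρ hg 1 u)
    (hW.integrable_curve hH0 hH hρ hg 1 u') fun z z' => ?_
  have h1 : fbmCov H0 (max 1 0) (max 1 0) = 1 := by
    rw [fbmCov_self hH0 (by norm_num)]; norm_num
  simp only [hW.inner_curve, h1, one_mul]

theorem norm_smoothCurve_one_le (hW : IsWeightedFractionalField H0 H ρ W μ) (hH0 : 0 < H0)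
    (hg : HasGrowth H ρ C A) {σ E : ℝ} (hσ : |σ| ≤ E) (x : Fin d → ℝ) :
    ‖hW.smoothCurve 1 (σ, x)‖
      ≤ (C * ∫ n : Fin d → ℝ, Real.exp (E * ∑ i, |n i|) ∂stdGauss d) * (1 + ‖x‖) ^ A := by
  have h1 : ‖hW.smoothCurve 1 (σ, x)‖ ≤ ∫ n : Fin d → ℝ, C * (1 + ‖x‖) ^ A *
      Real.exp (E * ∑ i, |n i|) ∂stdGauss d := by
    refine norm_integral_le_of_norm_le ((integrable_exp_stdGauss E).const_mul _)
      (ae_of_all _ fun n => (hW.norm_curve_le hH0 hg 1 σ x n).trans ?_)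
    have hC := hg.C_nonneg
    norm_num
    gcongr
  rw [integral_const_mul] at h1
  linarith

/-- Along a fixed continuous path, the time integral of the regularised noise is the nonlinear
integral of the smoothed field. -/
theorem coeFn_avgInt [IsProbabilityMeasure μ] (hW : IsWeightedFractionalField H0 H ρ W μ)
    (hH0 : 0 < H0) (hH : ∀ i, 0 < H i) (hρ : Continuous ρ) (hg : HasGrowth H ρ C A)
    {ε : ℝ} (hε : 0 < ε) (η : ℝ) {s t : ℝ} (hs : 0 ≤ s) (hst : s ≤ t)
    {b : ℝ → Fin d → ℝ} (hb : Continuous b) :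
    ((avgInt hW.smoothCurve η s t fun r => (√ε, b r) : hW.gaussSpace) : Lp ℝ 2 μ) =ᵐ[μ]
      fun ω => ∫ r in s..t, noiseApprox W ε η r (b r) ω := by
  set F : ℝ × (Fin d → ℝ) → hW.gaussSpace := fun z =>
    η⁻¹ • (hW.curve z.1 (b z.1 + √ε • z.2) - hW.curve (z.1 - η) (b z.1 + √ε • z.2)) with hF
  set lam : Measure (ℝ × (Fin d → ℝ)) := (volume.restrict (Ioc s t)).prod (stdGauss d) with hlam
  have hFc : Continuous F := by
    have h1 : Continuous fun z : ℝ × (Fin d → ℝ) => hW.curve z.1 (b z.1 + √ε • z.2) :=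
      (hW.continuous_curve hH0 hH hρ).comp
        (f := fun z : ℝ × (Fin d → ℝ) => (z.1, b z.1 + √ε • z.2)) (by fun_prop)
    have h2 : Continuous fun z : ℝ × (Fin d → ℝ) => hW.curve (z.1 - η) (b z.1 + √ε • z.2) :=
      (hW.continuous_curve hH0 hH hρ).comp
        (f := fun z : ℝ × (Fin d → ℝ) => (z.1 - η, b z.1 + √ε • z.2)) (by fun_prop)
    exact (h1.sub h2).const_smul η⁻¹
  have hFi : Integrable F lam := by
    have hbb : Continuous fun r => |η⁻¹| * (((max r 0) ^ H0 + (max (r - η) 0) ^ H0) *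
        (C * (1 + ‖b r‖) ^ A)) := by
      refine continuous_const.mul (Continuous.mul (Continuous.add ?_ ?_) (continuous_const.mul ?_))
      · exact (continuous_id.max continuous_const).rpow_const fun _ => Or.inr hH0.le
      · have hm : Continuous fun r : ℝ => max (r - η) 0 := by fun_prop
        exact hm.rpow_const fun _ => Or.inr hH0.le
      · exact (continuous_const.add hb.norm).rpow_const fun _ => Or.inr hg.A_nonneg
    have h1 : Integrable (fun r => |η⁻¹| * (((max r 0) ^ H0 + (max (r - η) 0) ^ H0) *
        (C * (1 + ‖b r‖) ^ A))) (volume.restrict (Ioc s t)) :=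
      (hbb.integrableOn_Icc (a := s) (b := t)).mono_set Ioc_subset_Icc_self
    refine (h1.mul_prod (integrable_exp_stdGauss (d := d) |√ε|)).mono'
      hFc.aestronglyMeasurable (ae_of_all _ fun z => ?_)
    rw [hF, norm_smul, Real.norm_eq_abs, mul_assoc]
    refine mul_le_mul_of_nonneg_left ?_ (abs_nonneg _)
    refine (norm_sub_le _ _).trans ((add_le_add (hW.norm_curve_le hH0 hg _ _ _ _)
      (hW.norm_curve_le hH0 hg _ _ _ _)).trans (le_of_eq ?_))
    ring
  set f : ℝ × (Fin d → ℝ) → Ω → ℝ := fun z ω =>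
    η⁻¹ * (W (max z.1 0) (b z.1 + √ε • z.2) ω - W (max (z.1 - η) 0) (b z.1 + √ε • z.2) ω) with hf
  have hfm : Measurable fun z : (ℝ × (Fin d → ℝ)) × Ω => f z.1 z.2 := by
    have h1 := hW.measurable.comp (f := fun z : (ℝ × (Fin d → ℝ)) × Ω =>
      (z.2, z.1.1.toNNReal, b z.1.1 + √ε • z.1.2)) (by fun_prop)
    have h2 := hW.measurable.comp (f := fun z : (ℝ × (Fin d → ℝ)) × Ω =>
      (z.2, (z.1.1 - η).toNNReal, b z.1.1 + √ε • z.1.2)) (by fun_prop)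
    exact (h1.sub h2).const_mul η⁻¹
  obtain ⟨hint, hae⟩ := coeFn_integral_Lp (F := fun z => ((F z : hW.gaussSpace) : Lp ℝ 2 μ))
    (lam := lam) (μ := μ) (hW.gaussSpace.subtypeL.integrable_comp hFi)
    hfm.stronglyMeasurable.aestronglyMeasurable (ae_of_all _ fun z => by
      simp only [hF, hf]
      rw [Submodule.coe_smul, Submodule.coe_sub]
      filter_upwards [Lp.coeFn_smul η⁻¹ ((hW.curve z.1 (b z.1 + √ε • z.2) : Lp ℝ 2 μ)
        - (hW.curve (z.1 - η) (b z.1 + √ε • z.2) : Lp ℝ 2 μ)),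
        Lp.coeFn_sub (hW.curve z.1 (b z.1 + √ε • z.2) : Lp ℝ 2 μ)
          (hW.curve (z.1 - η) (b z.1 + √ε • z.2) : Lp ℝ 2 μ),
        hW.coeFn_curve z.1 (b z.1 + √ε • z.2),
        hW.coeFn_curve (z.1 - η) (b z.1 + √ε • z.2)] with ω h1 h2 h3 h4
      rw [h1, Pi.smul_apply, h2, Pi.sub_apply, h3, h4, smul_eq_mul])
  have e1 : avgInt hW.smoothCurve η s t (fun r => (√ε, b r)) = ∫ z, F z ∂lam := by
    rw [avgInt, intervalIntegral.integral_of_le hst, hlam, integral_prod _ hFi]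
    refine integral_congr_ae (ae_of_all _ fun r => ?_)
    simp only [smoothCurve, hF]
    rw [integral_smul, integral_sub (hW.integrable_curve hH0 hH hρ hg r (√ε, b r))
      (hW.integrable_curve hH0 hH hρ hg (r - η) (√ε, b r))]
  have e2 : ((∫ z, F z ∂lam : hW.gaussSpace) : Lp ℝ 2 μ) = ∫ z, (F z : Lp ℝ 2 μ) ∂lam :=
    (hW.gaussSpace.subtypeL.integral_comp_comm hFi).symm
  rw [e1, e2]
  filter_upwards [hae, hint.prod_left_ae] with ω h1 h2
  rw [h1, hlam, integral_prod _ h2, intervalIntegral.integral_of_le hst]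
  refine setIntegral_congr_fun measurableSet_Ioc fun r hr => ?_
  simp only [hf, noiseApprox_eq W hε, max_eq_left (hs.trans hr.1.le)]

end IsWeightedFractionalField

end FracBSDE

/-! ### Independence and measurability with respect to sub-σ-algebras -/

namespace FracBSDE

theorem sup_eq_generateFrom_inter {Ω : Type*} (b c : MeasurableSpace Ω) :
    b ⊔ c = MeasurableSpace.generateFrom
      (image2 (· ∩ ·) {s | MeasurableSet[b] s} {t | MeasurableSet[c] t}) := by
  refine le_antisymm (sup_le ?_ ?_) (MeasurableSpace.generateFrom_le ?_)
  · exact fun s hs => MeasurableSpace.measurableSet_generateFrom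
      ⟨s, hs, univ, MeasurableSet.univ, inter_univ s⟩
  · exact fun s hs => MeasurableSpace.measurableSet_generateFrom
      ⟨univ, MeasurableSet.univ, s, hs, univ_inter s⟩
  · rintro _ ⟨s, hs, t, ht, rfl⟩
    exact MeasurableSet.inter ((le_sup_left : b ≤ b ⊔ c) s hs) ((le_sup_right : c ≤ b ⊔ c) t ht)

theorem isPiSystem_inter {Ω : Type*} (b c : MeasurableSpace Ω) :
    IsPiSystem (image2 (· ∩ ·) {s | MeasurableSet[b] s} {t | MeasurableSet[c] t}) := by
  rintro _ ⟨s, hs, t, ht, rfl⟩ _ ⟨s', hs', t', ht', rfl⟩ _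
  exact ⟨s ∩ s', MeasurableSet.inter hs hs', t ∩ t', MeasurableSet.inter ht ht',
    by simp only; rw [inter_inter_inter_comm]⟩

theorem indep_sup_right_of_indep_sup {Ω : Type*} {a b c m : MeasurableSpace Ω} {μ : Measure Ω}
    [IsProbabilityMeasure μ] (ha : a ≤ m) (hb : b ≤ m) (hc : c ≤ m)
    (hab : Indep a b μ) (habc : Indep (a ⊔ b) c μ) : Indep a (b ⊔ c) μ := by
  refine IndepSets.indep ha (sup_le hb hc) (@MeasurableSpace.isPiSystem_measurableSet Ω a)
    (isPiSystem_inter b c) (@MeasurableSpace.generateFrom_measurableSet Ω a).symm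
    (sup_eq_generateFrom_inter b c) ?_
  rw [IndepSets_iff]
  rintro s _ hs ⟨t, ht, u, hu, rfl⟩
  have hsa : MeasurableSet[a ⊔ b] s := (le_sup_left : a ≤ a ⊔ b) s hs
  have htb : MeasurableSet[a ⊔ b] t := (le_sup_right : b ≤ a ⊔ b) t ht
  rw [← inter_assoc, (Indep_iff _ _ _).1 habc _ _ (hsa.inter htb) hu,
    (Indep_iff _ _ _).1 hab s t hs ht, (Indep_iff _ _ _).1 habc t u htb hu, mul_assoc]

/-- If every section `f z` is measurable with respect to `G` up to a null set, then so is the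
integral `∫ f z`. Indeed `∫ f z` and its conditional expectation have the same integral over every
event `S`, as one sees on replacing the indicator of `S` by its conditional expectation. -/
theorem aestronglyMeasurable_integral_of_ae {Ω Z : Type*} {G m : MeasurableSpace Ω} (hG : G ≤ m)
    {ν : Measure Ω} [IsFiniteMeasure ν] [MeasurableSpace Z] {lam : Measure Z} [SFinite lam]
    {f : Z → Ω → ℝ} (hint : Integrable (fun z : Z × Ω => f z.1 z.2) (lam.prod ν))
    (hf : ∀ᵐ z ∂lam, AEStronglyMeasurable[G] (f z) ν) :
    AEStronglyMeasurable[G] (fun ω => ∫ z, f z ω ∂lam) ν := by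
  set N : Ω → ℝ := fun ω => ∫ z, f z ω ∂lam with hN
  have hNi : Integrable N ν := hint.integral_prod_right
  have hEi : Integrable (ν[N|G]) ν := integrable_condExp
  -- `∫ f h = ∫ f E[h | G]` for `G`-measurable `f` and bounded `h`
  have pull : ∀ f h : Ω → ℝ, AEStronglyMeasurable[G] f ν → Integrable (f * h) ν → Integrable h ν →
      ∫ ω, f ω * h ω ∂ν = ∫ ω, f ω * (ν[h|G]) ω ∂ν := by
    intro f h hf hfh hh
    have h1 := condExp_mul_of_aestronglyMeasurable_left hf hfh hh
    have h2 := integral_condExp hG (f := f * h) (μ := ν)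
    rw [show (∫ ω, f ω * h ω ∂ν) = ∫ ω, (f * h) ω ∂ν from rfl, ← h2]
    exact integral_congr_ae h1
  suffices h : N =ᵐ[ν] ν[N|G] from
    ⟨ν[N|G], stronglyMeasurable_condExp, h⟩
  refine Integrable.ae_eq_of_forall_setIntegral_eq _ _ hNi hEi fun S hS _ => ?_
  set φ : Ω → ℝ := S.indicator fun _ => 1 with hφ
  have hφi : Integrable φ ν := (integrable_const 1).indicator hS
  have hφ1 : ∀ ω, ‖φ ω‖ ≤ 1 := fun ω => by
    by_cases h : ω ∈ S <;> simp [hφ, h]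
  set g : Ω → ℝ := ν[φ|G] with hg
  have hgG : StronglyMeasurable[G] g := stronglyMeasurable_condExp
  have hgm : AEStronglyMeasurable g ν := (hgG.mono hG).aestronglyMeasurable
  have hg1 : ∀ᵐ ω ∂ν, ‖g ω‖ ≤ 1 := by
    have := ae_bdd_abs_condExp_of_ae_bdd_abs (m := G) (μ := ν) (f := φ) (R := 1)
      (ae_of_all _ fun ω => by simpa using hφ1 ω)
    simpa using this
  have hset : ∀ h : Ω → ℝ, ∫ ω in S, h ω ∂ν = ∫ ω, h ω * φ ω ∂ν := by
    intro h
    rw [← integral_indicator hS]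
    refine integral_congr_ae (ae_of_all _ fun ω => ?_)
    by_cases hω : ω ∈ S <;> simp [hφ, hω]
  have bdmul : ∀ h : Ω → ℝ, Integrable h ν → Integrable (h * φ) ν := fun h hh =>
    hh.mul_bdd (c := 1) hφi.aestronglyMeasurable (ae_of_all _ hφ1)
  have bdmul' : ∀ h : Ω → ℝ, Integrable h ν → Integrable (h * g) ν := fun h hh =>
    hh.mul_bdd (c := 1) hgm hg1
  have e1 : ∫ ω in S, N ω ∂ν = ∫ z, ∫ ω in S, f z ω ∂ν ∂lam := by
    have hint' : Integrable (fun z : Z × Ω => f z.1 z.2) (lam.prod (ν.restrict S)) :=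
      hint.mono_measure (Measure.prod_mono le_rfl Measure.restrict_le_self)
    exact integral_integral_swap (f := fun ω z => f z ω) hint'.swap
  have e2 : ∫ z, ∫ ω in S, f z ω ∂ν ∂lam = ∫ z, ∫ ω, f z ω * g ω ∂ν ∂lam := by
    refine integral_congr_ae ?_
    filter_upwards [hf, hint.prod_right_ae] with z h1 h2
    rw [hset, pull (f z) φ h1 (bdmul _ h2) hφi]
  have hgint : Integrable (fun z : Z × Ω => f z.1 z.2 * g z.2) (lam.prod ν) := by
    refine hint.mul_bdd (c := 1) ?_ ?_
    · exact hgm.comp_snd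
    · exact Measure.quasiMeasurePreserving_snd.ae hg1
  have e3 : ∫ z, ∫ ω, f z ω * g ω ∂ν ∂lam = ∫ ω, N ω * g ω ∂ν := by
    rw [integral_integral_swap hgint]
    refine integral_congr_ae (ae_of_all _ fun ω => ?_)
    exact integral_mul_const _ _
  have e4 : ∫ ω, N ω * g ω ∂ν = ∫ ω, (ν[N|G]) ω * g ω ∂ν := by
    have := pull g N hgG.aestronglyMeasurable (by rw [mul_comm]; exact bdmul' _ hNi) hNi
    simpa only [mul_comm] using this
  have e5 : ∫ ω, (ν[N|G]) ω * g ω ∂ν = ∫ ω in S, (ν[N|G]) ω ∂ν := by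
    rw [hset, pull _ φ stronglyMeasurable_condExp.aestronglyMeasurable (bdmul _ hEi) hφi]
  rw [e1, e2, e3, e4, e5]

section Diagonal

variable {Ω : Type*} {G₁ G₂ m : MeasurableSpace Ω} {μ : Measure Ω}

/-- The sum of the product measure `μ ⊗ μ` and of the image of `μ` on the diagonal. Identities
holding almost everywhere for it hold both for independent copies and on the diagonal. -/
noncomputable def diagSum (μ : Measure Ω) : Measure (Ω × Ω) :=
  μ.prod μ + μ.map fun ω => (ω, ω)

instance [IsFiniteMeasure μ] : IsFiniteMeasure (diagSum μ) := by
  unfold diagSum; infer_instance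

theorem ae_of_ae_diagSum {p : Ω × Ω → Prop} (h : ∀ᵐ w ∂diagSum μ, p w) :
    (∀ᵐ w ∂μ.prod μ, p w) ∧ ∀ᵐ ω ∂μ, p (ω, ω) := by
  rw [diagSum, ae_add_measure_iff] at h
  exact ⟨h.1, ae_of_ae_map (by fun_prop) h.2⟩

/-- Functionals measurable with respect to the product of two independent σ-algebras have the same
law on the diagonal as for independent copies. -/
theorem lintegral_diag_eq [IsProbabilityMeasure μ] (h₁ : G₁ ≤ m) (h₂ : G₂ ≤ m)
    (hind : Indep G₁ G₂ μ) {f : Ω × Ω → ℝ}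
    (hf : AEStronglyMeasurable[MeasurableSpace.prod G₁ G₂] f (diagSum μ)) {Φ : ℝ → ℝ≥0∞}
    (hΦ : Measurable Φ) :
    ∫⁻ ω, Φ (f (ω, ω)) ∂μ = ∫⁻ w, Φ (f w) ∂μ.prod μ := by
  obtain ⟨f', hf', hff'⟩ := hf
  obtain ⟨e1, e2⟩ := ae_of_ae_diagSum hff'
  have hle : MeasurableSpace.prod G₁ G₂ ≤ MeasurableSpace.prod m m :=
    sup_le_sup (MeasurableSpace.comap_mono h₁) (MeasurableSpace.comap_mono h₂)
  have hdiag : Measurable[m, MeasurableSpace.prod m m] fun ω : Ω => (ω, ω) :=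
    measurable_id.prodMk measurable_id
  have htrim : (μ.map fun ω => (ω, ω)).trim hle = (μ.prod μ).trim hle := by
    refine @ext_of_generate_finite _ (MeasurableSpace.prod G₁ G₂) _ _
      (image2 (· ×ˢ ·) {s | MeasurableSet[G₁] s} {t | MeasurableSet[G₂] t})
      (@generateFrom_prod _ _ G₁ G₂).symm (@isPiSystem_prod _ _ G₁ G₂) inferInstance ?_ ?_
    · rintro _ ⟨s, hs, t, ht, rfl⟩
      have hst : MeasurableSet[MeasurableSpace.prod G₁ G₂] (s ×ˢ t) :=
        @MeasurableSet.prod _ _ G₁ G₂ _ _ hs ht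
      rw [trim_measurableSet_eq hle hst, trim_measurableSet_eq hle hst,
        Measure.map_apply hdiag (hle _ hst), Measure.prod_prod]
      exact (Indep_iff _ _ _).1 hind s t hs ht
    · rw [trim_measurableSet_eq hle MeasurableSet.univ, trim_measurableSet_eq hle MeasurableSet.univ,
        Measure.map_apply hdiag MeasurableSet.univ]
      simp
  have hm : Measurable[MeasurableSpace.prod G₁ G₂] fun w => Φ (f' w) := hΦ.comp hf'.measurable
  calc ∫⁻ ω, Φ (f (ω, ω)) ∂μ = ∫⁻ ω, Φ (f' (ω, ω)) ∂μ :=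
        lintegral_congr_ae (by filter_upwards [e2] with ω h; rw [h])
    _ = ∫⁻ w, Φ (f' w) ∂(μ.map fun ω => (ω, ω)) :=
        (lintegral_map (hm.mono hle le_rfl) hdiag).symm
    _ = ∫⁻ w, Φ (f' w) ∂(μ.prod μ) := by
        rw [← lintegral_trim hle hm, htrim, lintegral_trim hle hm]
    _ = ∫⁻ w, Φ (f w) ∂μ.prod μ :=
        lintegral_congr_ae (by filter_upwards [e1] with w h; rw [h])

end Diagonal

end FracBSDE

/-! ### Decoupling the path and the field -/

namespace FracBSDE

variable {Ω : Type*} {d : ℕ}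

theorem integrable_heatKernel_sub {ε : ℝ} (hε : 0 < ε) (x : Fin d → ℝ) {f : (Fin d → ℝ) → ℝ}
    (hf : Integrable (fun n => f (x + √ε • n)) (stdGauss d)) :
    Integrable fun y => heatKernel ε (x - y) * f y := by
  have hs : √ε ≠ 0 := (Real.sqrt_pos.2 hε).ne'
  rw [stdGauss, integrable_withDensity_iff_integrable_smul'
    (continuous_heatKernel 1).measurable.ennreal_ofReal (ae_of_all _ fun _ => ENNReal.ofReal_lt_top)]
    at hf
  simp only [ENNReal.toReal_ofReal (heatKernel_nonneg zero_le_one _), smul_eq_mul] at hf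
  suffices h : Integrable fun n => heatKernel ε (x - (x + n)) * f (x + n) by
    simpa using h.comp_add_left (-x)
  rw [← integrable_comp_smul_iff volume _ hs]
  refine (hf.const_mul (ε ^ (-(d : ℝ) / 2))).congr (ae_of_all _ fun n => ?_)
  simp only [heatKernel, sub_add_cancel_left, Pi.neg_apply, Pi.smul_apply, smul_eq_mul, neg_sq,
    mul_pow, Real.sq_sqrt hε.le, ← Finset.mul_sum, mul_one]
  have e1 : -(ε * ∑ i, n i ^ 2) / (2 * ε) = -(∑ i, n i ^ 2) / 2 := by field_simp
  rw [e1, Real.mul_rpow (by positivity) hε.le]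
  ring

section FieldSigma

theorem measurable_fieldSigma (W : ℝ → (Fin d → ℝ) → Ω → ℝ) {r : ℝ} (hr : 0 ≤ r)
    (x : Fin d → ℝ) : Measurable[fieldSigma W] (W r x) := by
  refine Measurable.mono (comap_measurable (W r x)) ?_ le_rfl
  exact le_iSup₂_of_le r hr (le_iSup (fun x => MeasurableSpace.comap (W r x) inferInstance) x)

theorem measurable_brownianSigma (B : ℝ → Ω → (Fin d → ℝ)) {s t : ℝ} (hs : s ∈ Icc 0 t) :
    Measurable[brownianSigma B t] (B s) :=
  Measurable.mono (comap_measurable (B s))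
    (le_iSup₂_of_le (f := fun s _ => MeasurableSpace.comap (B s) inferInstance) s hs le_rfl) le_rfl

theorem brownianSigma_mono (B : ℝ → Ω → (Fin d → ℝ)) {s t : ℝ} (hst : s ≤ t) :
    brownianSigma B s ≤ brownianSigma B t :=
  iSup₂_le fun _ hu => (measurable_brownianSigma B ⟨hu.1, hu.2.trans hst⟩).comap_le

theorem sigmaF_mono (B : ℝ → Ω → (Fin d → ℝ)) (W : ℝ → (Fin d → ℝ) → Ω → ℝ) {s t : ℝ}
    (hst : s ≤ t) : sigmaF B W s ≤ sigmaF B W t :=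
  sup_le_sup_right (brownianSigma_mono B hst) _

end FieldSigma

variable [MeasurableSpace Ω] {μ : Measure Ω} {T H0 : ℝ}
  {H : Fin d → ℝ} {ρ : (Fin d → ℝ) → ℝ} {C A : ℝ}
  {B b : ℝ → Ω → (Fin d → ℝ)} {W : ℝ → (Fin d → ℝ) → Ω → ℝ} {M : Ω → ℝ}

/-- The standing assumptions: `b` is a version of the process `B` all of whose paths are continuous
and are bounded on `[0, T]` by a variable `M` with the exponential moments needed below, and `W` is
a weighted fractional field independent of `B`. -/
structure Model (μ : Measure Ω) (T H0 : ℝ) (H : Fin d → ℝ) (ρ : (Fin d → ℝ) → ℝ) (C A : ℝ)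
    (B b : ℝ → Ω → (Fin d → ℝ)) (W : ℝ → (Fin d → ℝ) → Ω → ℝ) (M : Ω → ℝ) : Prop where
  T_pos : 0 < T
  H0_mem : H0 ∈ Ioo (1 / 2 : ℝ) 1
  H_pos : ∀ i, 0 < H i
  ρ_cont : Continuous ρ
  growth : HasGrowth H ρ C A
  field : IsWeightedFractionalField H0 H ρ W μ
  measurable_B : ∀ t ∈ Icc 0 T, Measurable (B t)
  indep : Indep (brownianSigma B T) (fieldSigma W) μ
  continuous_b : ∀ ω, Continuous fun t => b t ω
  measurable_b : ∀ t, Measurable (b t)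
  ae_eq : ∀ᵐ ω ∂μ, ∀ t ∈ Icc 0 T, b t ω = B t ω
  norm_le : ∀ ω, ∀ t ∈ Icc 0 T, ‖b t ω‖ ≤ M ω
  exp_moment : ∀ c : ℝ, ∫⁻ ω, ENNReal.ofReal (Real.exp (c * (1 + M ω) ^ (2 * A))) ∂μ < ∞

/-- The integral of the regularised noise along the path of the first argument, the field being
evaluated at the second argument. -/
noncomputable def pathInt (W : ℝ → (Fin d → ℝ) → Ω → ℝ) (b : ℝ → Ω → (Fin d → ℝ))
    (ε η s t : ℝ) (w : Ω × Ω) : ℝ :=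
  ∫ r in s..t, noiseApprox W ε η r (b r w.1) w.2

/-- The integrand of `pathInt`, as a function of the time and space variables. -/
noncomputable def noiseKernel (W : ℝ → (Fin d → ℝ) → Ω → ℝ) (b : ℝ → Ω → (Fin d → ℝ))
    (ε η : ℝ) (z : ℝ × (Fin d → ℝ)) (w : Ω × Ω) : ℝ :=
  heatKernel ε (b z.1 w.1 - z.2) * (η⁻¹ * (W (max z.1 0) z.2 w.2 - W (max (z.1 - η) 0) z.2 w.2))

theorem ae_diagSum_fst {p : Ω → Prop} (h : ∀ᵐ ω ∂μ, p ω) :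
    ∀ᵐ w ∂diagSum μ, p w.1 := by
  rw [diagSum, ae_add_measure_iff]
  refine ⟨Measure.quasiMeasurePreserving_fst.ae h, ?_⟩
  have : Measure.QuasiMeasurePreserving (Prod.fst : Ω × Ω → Ω) (μ.map fun ω => (ω, ω)) μ := by
    refine ⟨measurable_fst, ?_⟩
    rw [Measure.map_map measurable_fst (by fun_prop)]
    exact (Measure.map_id (μ := μ)).le.absolutelyContinuous
  exact this.ae h

namespace Model

theorem fieldSigma_le (hm : Model μ T H0 H ρ C A B b W M) :
    fieldSigma W ≤ (inferInstance : MeasurableSpace Ω) := by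
  refine iSup₂_le fun r hr => iSup_le fun x => Measurable.comap_le ?_
  exact hm.field.measurable.comp (f := fun ω : Ω => (ω, (⟨r, hr⟩ : ℝ≥0), x)) (by fun_prop)

theorem brownianSigma_le (hm : Model μ T H0 H ρ C A B b W M) {t : ℝ} (ht : t ≤ T) :
    brownianSigma B t ≤ (inferInstance : MeasurableSpace Ω) :=
  iSup₂_le fun s hs => (hm.measurable_B s ⟨hs.1, hs.2.trans ht⟩).comap_le

theorem sigmaF_le (hm : Model μ T H0 H ρ C A B b W M) {t : ℝ} (ht : t ≤ T) :
    sigmaF B W t ≤ (inferInstance : MeasurableSpace Ω) :=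
  sup_le (hm.brownianSigma_le ht) hm.fieldSigma_le

theorem measurable_b_uncurry (hm : Model μ T H0 H ρ C A B b W M) :
    Measurable fun z : ℝ × Ω => b z.1 z.2 :=
  measurable_uncurry_of_continuous_of_measurable hm.continuous_b hm.measurable_b

theorem M_nonneg (hm : Model μ T H0 H ρ C A B b W M) (ω : Ω) : 0 ≤ M ω :=
  (norm_nonneg _).trans (hm.norm_le ω 0 ⟨le_rfl, hm.T_pos.le⟩)

theorem measurable_noiseKernel (hm : Model μ T H0 H ρ C A B b W M) (ε η : ℝ) :
    Measurable fun p : (ℝ × (Fin d → ℝ)) × (Ω × Ω) => noiseKernel W b ε η p.1 p.2 := by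
  have h1 := hm.field.measurable.comp (f := fun p : (ℝ × (Fin d → ℝ)) × (Ω × Ω) =>
    (p.2.2, p.1.1.toNNReal, p.1.2)) (by fun_prop)
  have h2 := hm.field.measurable.comp (f := fun p : (ℝ × (Fin d → ℝ)) × (Ω × Ω) =>
    (p.2.2, (p.1.1 - η).toNNReal, p.1.2)) (by fun_prop)
  have h3 : Measurable fun p : (ℝ × (Fin d → ℝ)) × (Ω × Ω) => b p.1.1 p.2.1 :=
    hm.measurable_b_uncurry.comp (f := fun p : (ℝ × (Fin d → ℝ)) × (Ω × Ω) => (p.1.1, p.2.1))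
      (by fun_prop)
  exact ((continuous_heatKernel ε).measurable.comp (h3.sub (by fun_prop))).mul
    ((h1.sub h2).const_mul η⁻¹)

/-- At a fixed time and a fixed point of space, the integrand is measurable with respect to the
product of the σ-algebras of the path and of the field. -/
theorem aestronglyMeasurable_noiseKernel [IsProbabilityMeasure μ]
    (hm : Model μ T H0 H ρ C A B b W M) (ε η : ℝ) {z : ℝ × (Fin d → ℝ)} (hz : z.1 ∈ Icc 0 T) :
    AEStronglyMeasurable[MeasurableSpace.prod (brownianSigma B T) (fieldSigma W)]
      (noiseKernel W b ε η z) (diagSum μ) := by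
  refine ⟨noiseKernel W B ε η z, ?_, ?_⟩
  · have hB : Measurable[MeasurableSpace.prod (brownianSigma B T) (fieldSigma W)]
        fun w : Ω × Ω => B z.1 w.1 :=
      (measurable_brownianSigma B hz).comp (@measurable_fst _ _ (brownianSigma B T) (fieldSigma W))
    have hWm : ∀ r, Measurable[MeasurableSpace.prod (brownianSigma B T) (fieldSigma W)]
        fun w : Ω × Ω => W (max r 0) z.2 w.2 := fun r =>
      (measurable_fieldSigma W (le_max_right r 0) z.2).comp
        (@measurable_snd _ _ (brownianSigma B T) (fieldSigma W))
    refine Measurable.stronglyMeasurable ?_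
    refine Measurable.mul ?_ (Measurable.const_mul ((hWm _).sub (hWm _)) _)
    exact (continuous_heatKernel ε).measurable.comp (hB.sub_const z.2)
  · filter_upwards [ae_diagSum_fst hm.ae_eq] with w hw
    simp only [noiseKernel, hw z.1 hz]

theorem lintegral_field_le [IsProbabilityMeasure μ] (hm : Model μ T H0 H ρ C A B b W M)
    {η r : ℝ} (hη : 0 < η) (hr : r ≤ T) (y : Fin d → ℝ) :
    ∫⁻ ω, ‖η⁻¹ * (W (max r 0) y ω - W (max (r - η) 0) y ω)‖ₑ ∂μ
      ≤ ENNReal.ofReal (2 * η⁻¹ * T ^ H0 * √(spaceCov H ρ y y)) := by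
  have hH0 : 0 < H0 := by linarith [hm.H0_mem.1]
  have h1 : ∀ t ≤ T, eLpNorm (W (max t 0) y) 1 μ ≤ ENNReal.ofReal (T ^ H0 * √(spaceCov H ρ y y)) := by
    intro t ht
    have hcm := hm.field.memLp (t.toNNReal, y)
    calc eLpNorm (W (max t 0) y) 1 μ ≤ eLpNorm (W (max t 0) y) 2 μ :=
          eLpNorm_le_eLpNorm_of_exponent_le (by norm_num) hcm.aestronglyMeasurable
      _ = ‖hm.field.curve t y‖ₑ := by
          rw [← eLpNorm_congr_ae (hm.field.coeFn_curve t y)]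
          exact (Lp.enorm_def _).symm
      _ = ENNReal.ofReal ((max t 0) ^ H0 * √(spaceCov H ρ y y)) := by
          rw [← hm.field.norm_curve hH0, ofReal_norm]
      _ ≤ _ := by
          have : max t 0 ≤ T := max_le ht hm.T_pos.le
          have h0 : 0 ≤ max t 0 := le_max_right _ _
          gcongr
  have hmeas : ∀ t, AEStronglyMeasurable (W (max t 0) y) μ := fun t =>
    (hm.field.memLp (t.toNNReal, y)).aestronglyMeasurable
  calc ∫⁻ ω, ‖η⁻¹ * (W (max r 0) y ω - W (max (r - η) 0) y ω)‖ₑ ∂μ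
      = ‖η⁻¹‖ₑ * eLpNorm (W (max r 0) y - W (max (r - η) 0) y) 1 μ := by
        rw [eLpNorm_one_eq_lintegral_enorm, ← lintegral_const_mul' _ _ (by simp)]
        simp only [enorm_mul, Pi.sub_apply]
    _ ≤ ‖η⁻¹‖ₑ * (ENNReal.ofReal (T ^ H0 * √(spaceCov H ρ y y))
          + ENNReal.ofReal (T ^ H0 * √(spaceCov H ρ y y))) := by
        gcongr
        exact (eLpNorm_sub_le (hmeas _) (hmeas _) le_rfl).trans
          (add_le_add (h1 _ hr) (h1 _ (by linarith)))
    _ = _ := by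
        have : 0 ≤ T ^ H0 * √(spaceCov H ρ y y) :=
          mul_nonneg (Real.rpow_nonneg hm.T_pos.le _) (Real.sqrt_nonneg _)
        rw [← ENNReal.ofReal_add this this, Real.enorm_eq_ofReal (inv_pos.2 hη).le,
          ← ENNReal.ofReal_mul (inv_pos.2 hη).le]
        congr 1
        ring

theorem lintegral_M_rpow_lt_top (hm : Model μ T H0 H ρ C A B b W M) {K : ℝ} (hK : 0 ≤ K) :
    ∫⁻ ω, ENNReal.ofReal (K * (1 + M ω) ^ A) ∂μ < ∞ := by
  have h1 : ∀ ω, ENNReal.ofReal (K * (1 + M ω) ^ A)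
      ≤ ENNReal.ofReal K * ENNReal.ofReal (Real.exp (1 * (1 + M ω) ^ (2 * A))) := by
    intro ω
    rw [← ENNReal.ofReal_mul hK, one_mul]
    refine ENNReal.ofReal_le_ofReal (mul_le_mul_of_nonneg_left ?_ hK)
    calc (1 + M ω) ^ A ≤ (1 + M ω) ^ (2 * A) :=
          Real.rpow_le_rpow_of_exponent_le (by linarith [hm.M_nonneg ω])
            (by linarith [hm.growth.A_nonneg])
      _ ≤ (1 + M ω) ^ (2 * A) + 1 := by linarith
      _ ≤ _ := Real.add_one_le_exp _
  refine lt_of_le_of_lt (lintegral_mono h1) ?_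
  rw [lintegral_const_mul' _ _ ENNReal.ofReal_ne_top]
  exact ENNReal.mul_lt_top ENNReal.ofReal_lt_top (hm.exp_moment 1)

theorem continuous_sqrt_spaceCov (hm : Model μ T H0 H ρ C A B b W M) :
    Continuous fun y => √(spaceCov H ρ y y) := by
  have h1 : ∀ i, Continuous fun y : Fin d → ℝ => fbmCov (H i) (y i) (y i) := fun i =>
    (continuous_fbmCov (hm.H_pos i)).comp (f := fun y : Fin d → ℝ => (y i, y i)) (by fun_prop)
  exact Real.continuous_sqrt.comp
    ((hm.ρ_cont.mul hm.ρ_cont).mul (continuous_finsetProd _ fun i _ => h1 i))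

/-- Smoothing at scale `√ε` preserves the polynomial growth of the standard deviation of the field. -/
theorem lintegral_heatKernel_mul_le (hm : Model μ T H0 H ρ C A B b W M) {ε : ℝ} (hε : 0 < ε)
    {k : ℝ} (hk : 0 ≤ k) (x : Fin d → ℝ) :
    ∫⁻ y, ENNReal.ofReal (heatKernel ε (x - y) * (k * √(spaceCov H ρ y y)))
      ≤ ENNReal.ofReal ((k * (C * ∫ n : Fin d → ℝ, Real.exp (|√ε| * ∑ i, |n i|) ∂stdGauss d))
        * (1 + ‖x‖) ^ A) := by
  set φ : (Fin d → ℝ) → ℝ := fun n => √(spaceCov H ρ (x + √ε • n) (x + √ε • n)) with hφ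
  have hφc : Continuous φ := hm.continuous_sqrt_spaceCov.comp
    (by fun_prop : Continuous fun n : Fin d → ℝ => x + √ε • n)
  have hbd : Integrable (fun n : Fin d → ℝ => C * (1 + ‖x‖) ^ A * Real.exp (|√ε| * ∑ i, |n i|))
    (stdGauss d) := (integrable_exp_stdGauss |√ε|).const_mul (C * (1 + ‖x‖) ^ A)
  have hφi : Integrable φ (stdGauss d) := by
    refine hbd.mono' hφc.aestronglyMeasurable (ae_of_all _ fun n => ?_)
    rw [Real.norm_of_nonneg (Real.sqrt_nonneg _)]
    exact hm.growth.le _ _ _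
  rw [← ofReal_integral_eq_lintegral_ofReal
    (integrable_heatKernel_sub hε x (f := fun y => k * √(spaceCov H ρ y y)) (hφi.const_mul k))
    (ae_of_all _ fun y => mul_nonneg (heatKernel_nonneg hε.le _) (by positivity))]
  refine ENNReal.ofReal_le_ofReal ?_
  have h1 := integral_heatKernel_sub hε x (fun y => k * √(spaceCov H ρ y y))
  simp only [smul_eq_mul] at h1
  rw [h1, integral_const_mul]
  have h2 : ∫ n, φ n ∂stdGauss d
      ≤ C * (1 + ‖x‖) ^ A * ∫ n : Fin d → ℝ, Real.exp (|√ε| * ∑ i, |n i|) ∂stdGauss d := by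
    rw [← integral_const_mul]
    exact integral_mono hφi hbd fun n => hm.growth.le _ _ _
  calc k * ∫ n, φ n ∂stdGauss d ≤ k * _ := mul_le_mul_of_nonneg_left h2 hk
    _ = _ := by ring

/-- Fubini's theorem applies to the integrand, both for independent copies and on the diagonal. -/
theorem integrable_noiseKernel [IsProbabilityMeasure μ] (hm : Model μ T H0 H ρ C A B b W M)
    {ε η : ℝ} (hε : 0 < ε) (hη : 0 < η) :
    Integrable (fun p : (ℝ × (Fin d → ℝ)) × (Ω × Ω) => noiseKernel W b ε η p.1 p.2)
      (((volume.restrict (Ioc 0 T)).prod volume).prod (diagSum μ)) := by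
  have hmeas := hm.measurable_noiseKernel ε η
  refine ⟨hmeas.aestronglyMeasurable, ?_⟩
  have hT := hm.T_pos
  set lam : Measure (ℝ × (Fin d → ℝ)) := (volume.restrict (Ioc 0 T)).prod volume with hlam
  have hlamT : ∀ᵐ z ∂lam, z.1 ∈ Icc 0 T := by
    refine Measure.quasiMeasurePreserving_fst.ae ?_
    filter_upwards [ae_restrict_mem measurableSet_Ioc] with r hr
    exact Ioc_subset_Icc_self hr
  set I : ℝ := ∫ n : Fin d → ℝ, Real.exp (|√ε| * ∑ i, |n i|) ∂stdGauss d with hI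
  set K : ℝ := 2 * η⁻¹ * T ^ H0 * (C * I) with hK
  have hKnn : 0 ≤ K := by
    have hC := hm.growth.C_nonneg
    have : 0 ≤ I := integral_nonneg fun _ => (Real.exp_pos _).le
    positivity
  have hspace := fun x : Fin d → ℝ => hm.lintegral_heatKernel_mul_le hε
    (k := 2 * η⁻¹ * T ^ H0) (by positivity) x
  rw [hasFiniteIntegral_iff_enorm, lintegral_prod _ hmeas.enorm.aemeasurable]
  have hdiag : ∀ᵐ z ∂lam, ∫⁻ w, ‖noiseKernel W b ε η z w‖ₑ ∂diagSum μ
      = 2 * ∫⁻ w, ‖noiseKernel W b ε η z w‖ₑ ∂μ.prod μ := by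
    filter_upwards [hlamT] with z hz
    have hmz : Measurable fun w => ‖noiseKernel W b ε η z w‖ₑ :=
      (hmeas.comp (measurable_const.prodMk measurable_id)).enorm
    rw [diagSum, lintegral_add_measure, lintegral_map hmz (by fun_prop),
      lintegral_diag_eq (hm.brownianSigma_le le_rfl) hm.fieldSigma_le hm.indep
        (hm.aestronglyMeasurable_noiseKernel ε η hz) (Φ := fun x => ‖x‖ₑ) measurable_enorm,
      two_mul]
  rw [lintegral_congr_ae hdiag, lintegral_const_mul' _ _ (by norm_num)]
  refine ENNReal.mul_lt_top (by norm_num) ?_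
  have hswap : ∫⁻ z, ∫⁻ w, ‖noiseKernel W b ε η z w‖ₑ ∂μ.prod μ ∂lam
      = ∫⁻ ω, ∫⁻ z, ∫⁻ ω', ‖noiseKernel W b ε η z (ω, ω')‖ₑ ∂μ ∂lam ∂μ := by
    have e1 : ∀ z, ∫⁻ w, ‖noiseKernel W b ε η z w‖ₑ ∂μ.prod μ
        = ∫⁻ ω, ∫⁻ ω', ‖noiseKernel W b ε η z (ω, ω')‖ₑ ∂μ ∂μ := fun z =>
      lintegral_prod _ (hmeas.comp (measurable_const.prodMk measurable_id)).enorm.aemeasurable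
    simp only [e1]
    refine lintegral_lintegral_swap ?_
    refine Measurable.aemeasurable ?_
    exact Measurable.lintegral_prod_right' (ν := μ)
      (f := fun q : ((ℝ × (Fin d → ℝ)) × Ω) × Ω => ‖noiseKernel W b ε η q.1.1 (q.1.2, q.2)‖ₑ)
      (hmeas.comp (f := fun q : ((ℝ × (Fin d → ℝ)) × Ω) × Ω => (q.1.1, q.1.2, q.2))
        (by fun_prop)).enorm
  rw [hswap]
  refine lt_of_le_of_lt (lintegral_mono fun ω => ?_)
    (hm.lintegral_M_rpow_lt_top (K := T * K) (by positivity))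
  calc ∫⁻ z, ∫⁻ ω', ‖noiseKernel W b ε η z (ω, ω')‖ₑ ∂μ ∂lam
      ≤ ∫⁻ z, ENNReal.ofReal (heatKernel ε (b z.1 ω - z.2) *
          (2 * η⁻¹ * T ^ H0 * √(spaceCov H ρ z.2 z.2))) ∂lam := by
        refine lintegral_mono_ae ?_
        filter_upwards [hlamT] with z hz
        simp only [noiseKernel]
        simp_rw [enorm_mul (heatKernel ε _)]
        rw [lintegral_const_mul' _ _ (by simp),
          Real.enorm_eq_ofReal (heatKernel_nonneg hε.le _),
          ENNReal.ofReal_mul (heatKernel_nonneg hε.le _)]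
        exact mul_le_mul_right (hm.lintegral_field_le hη hz.2 _) _
    _ = ∫⁻ r in Ioc 0 T, ∫⁻ y, ENNReal.ofReal (heatKernel ε (b r ω - y) *
          (2 * η⁻¹ * T ^ H0 * √(spaceCov H ρ y y))) := by
        have hc : Continuous fun z : ℝ × (Fin d → ℝ) => heatKernel ε (b z.1 ω - z.2) *
            (2 * η⁻¹ * T ^ H0 * √(spaceCov H ρ z.2 z.2)) := by
          have h1 : Continuous fun z : ℝ × (Fin d → ℝ) => b z.1 ω - z.2 :=
            ((hm.continuous_b ω).comp continuous_fst).sub continuous_snd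
          exact ((continuous_heatKernel ε).comp h1).mul
            (continuous_const.mul (hm.continuous_sqrt_spaceCov.comp continuous_snd))
        rw [hlam, lintegral_prod _ hc.measurable.ennreal_ofReal.aemeasurable]
    _ ≤ ∫⁻ r in Ioc 0 T, ENNReal.ofReal (K * (1 + M ω) ^ A) := by
        refine setLIntegral_mono measurable_const fun r hr => (hspace _).trans ?_
        refine ENNReal.ofReal_le_ofReal ?_
        have h1 := hm.norm_le ω r (Ioc_subset_Icc_self hr)
        have hA := hm.growth.A_nonneg
        gcongr
    _ = ENNReal.ofReal (T * K * (1 + M ω) ^ A) := by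
        rw [setLIntegral_const, Real.volume_Ioc, sub_zero, mul_comm, ← ENNReal.ofReal_mul hT.le]
        congr 1
        ring

end Model

end FracBSDE

/-! ### Moment estimates for the integral along the random path -/

namespace FracBSDE

theorem _root_.Real.pow_le_factorial_mul_exp {x : ℝ} (hx : 0 ≤ x) (k : ℕ) :
    x ^ k ≤ k.factorial * Real.exp x := by
  have h := Real.pow_div_factorial_le_exp x hx k
  rwa [div_le_iff₀ (by positivity), mul_comm] at h

theorem noiseApprox_eq_integral {Ω : Type*} {d : ℕ} {b : ℝ → Ω → (Fin d → ℝ)}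
    {W : ℝ → (Fin d → ℝ) → Ω → ℝ} (ε η : ℝ) {r : ℝ} (hr : 0 ≤ r) (w : Ω × Ω) :
    noiseApprox W ε η r (b r w.1) w.2 = ∫ y, noiseKernel W b ε η (r, y) w := by
  rw [noiseApprox, stepIntegral]
  refine integral_congr_ae (ae_of_all _ fun y => ?_)
  simp only [noiseKernel, max_eq_left hr]
  ring

variable {Ω : Type*} {d : ℕ} [MeasurableSpace Ω] {μ : Measure Ω} {T H0 : ℝ}
  {H : Fin d → ℝ} {ρ : (Fin d → ℝ) → ℝ} {C A : ℝ}
  {B b : ℝ → Ω → (Fin d → ℝ)} {W : ℝ → (Fin d → ℝ) → Ω → ℝ} {M : Ω → ℝ}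

namespace IsWeightedFractionalField

theorem lintegral_exp_mul_le [IsProbabilityMeasure μ] (hW : IsWeightedFractionalField H0 H ρ W μ)
    (X : hW.gaussSpace) (a : ℝ) :
    ∫⁻ ω, ENNReal.ofReal (Real.exp (a * (X : Lp ℝ 2 μ) ω)) ∂μ
      ≤ ENNReal.ofReal (Real.exp (a ^ 2 * ‖X‖ ^ 2 / 2)) := by
  have h := hW.lintegral_exp_le (a • X)
  rw [norm_smul, mul_pow, Real.norm_eq_abs, sq_abs] at h
  refine le_trans (le_of_eq (lintegral_congr_ae ?_)) h
  filter_upwards [Lp.coeFn_smul a (X : Lp ℝ 2 μ)] with ω hω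
  rw [Submodule.coe_smul, hω, Pi.smul_apply, smul_eq_mul]

/-- All moments of an element of the Gaussian space are controlled by its `L²` norm. -/
theorem lintegral_pow_le [IsProbabilityMeasure μ] (hW : IsWeightedFractionalField H0 H ρ W μ)
    (X : hW.gaussSpace) {k : ℕ} (hk : k ≠ 0) :
    ∫⁻ ω, ‖(X : Lp ℝ 2 μ) ω‖ₑ ^ k ∂μ
      ≤ ENNReal.ofReal (2 * Real.exp (1 / 2) * k.factorial * ‖X‖ ^ k) := by
  rcases eq_or_ne X 0 with rfl | hX
  · have h0 : ∫⁻ ω, ‖((0 : hW.gaussSpace) : Lp ℝ 2 μ) ω‖ₑ ^ k ∂μ = ∫⁻ _, 0 ∂μ := by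
      refine lintegral_congr_ae ?_
      filter_upwards [Lp.coeFn_zero ℝ 2 μ] with ω hω
      rw [Submodule.coe_zero, hω]
      simp [hk]
    rw [h0]
    simp
  have hn : 0 < ‖X‖ := norm_pos_iff.2 hX
  have h1 : ∀ ω, ‖(X : Lp ℝ 2 μ) ω‖ₑ ^ k ≤ ENNReal.ofReal (‖X‖ ^ k * k.factorial) *
      (ENNReal.ofReal (Real.exp (‖X‖⁻¹ * (X : Lp ℝ 2 μ) ω))
        + ENNReal.ofReal (Real.exp ((-‖X‖⁻¹) * (X : Lp ℝ 2 μ) ω))) := by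
    intro ω
    set x := (X : Lp ℝ 2 μ) ω with hx
    rw [Real.enorm_eq_ofReal_abs, ← ENNReal.ofReal_pow (abs_nonneg _),
      ← ENNReal.ofReal_add (Real.exp_pos _).le (Real.exp_pos _).le,
      ← ENNReal.ofReal_mul (by positivity)]
    refine ENNReal.ofReal_le_ofReal ?_
    have h2 := Real.pow_le_factorial_mul_exp (x := |‖X‖⁻¹ * x|) (abs_nonneg _) k
    have h3 : |x| = ‖X‖ * |‖X‖⁻¹ * x| := by
      rw [abs_mul, abs_inv, abs_norm]; field_simp
    have h4 : Real.exp |‖X‖⁻¹ * x| ≤ Real.exp (‖X‖⁻¹ * x) + Real.exp (-‖X‖⁻¹ * x) := by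
      rw [neg_mul]; exact Real.exp_abs_le _
    calc |x| ^ k = ‖X‖ ^ k * |‖X‖⁻¹ * x| ^ k := by rw [h3, mul_pow]
      _ ≤ ‖X‖ ^ k * (k.factorial * (Real.exp (‖X‖⁻¹ * x) + Real.exp (-‖X‖⁻¹ * x))) := by
          gcongr
          exact h2.trans (by gcongr)
      _ = _ := by ring
  have hmeas : ∀ a : ℝ, AEMeasurable (fun ω => ENNReal.ofReal (Real.exp (a * (X : Lp ℝ 2 μ) ω))) μ :=
    fun a => (Real.measurable_exp.comp_aemeasurable
      ((Lp.aestronglyMeasurable _).aemeasurable.const_mul a)).ennreal_ofReal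
  refine (lintegral_mono h1).trans ?_
  rw [lintegral_const_mul' _ _ ENNReal.ofReal_ne_top, lintegral_add_left' (hmeas _)]
  have h5 : ∀ a : ℝ, a ^ 2 = ‖X‖⁻¹ ^ 2 →
      ∫⁻ ω, ENNReal.ofReal (Real.exp (a * (X : Lp ℝ 2 μ) ω)) ∂μ
        ≤ ENNReal.ofReal (Real.exp (1 / 2)) := by
    intro a ha
    refine (hW.lintegral_exp_mul_le X a).trans (le_of_eq ?_)
    rw [ha]
    congr 2
    field_simp
  refine (mul_le_mul_right (add_le_add (h5 _ rfl) (h5 _ (by ring))) _).trans (le_of_eq ?_)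
  rw [← ENNReal.ofReal_add (Real.exp_pos _).le (Real.exp_pos _).le,
    ← ENNReal.ofReal_mul (by positivity)]
  congr 1
  ring

end IsWeightedFractionalField

namespace Model

theorem ae_integrable_noiseKernel [IsProbabilityMeasure μ] (hm : Model μ T H0 H ρ C A B b W M)
    {ε η : ℝ} (hε : 0 < ε) (hη : 0 < η) :
    ∀ᵐ w ∂diagSum μ, Integrable (fun z => noiseKernel W b ε η z w)
      ((volume.restrict (Ioc 0 T)).prod volume) :=
  (hm.integrable_noiseKernel hε hη).prod_left_ae

theorem ae_intervalIntegrable [IsProbabilityMeasure μ] (hm : Model μ T H0 H ρ C A B b W M)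
    {ε η : ℝ} (hε : 0 < ε) (hη : 0 < η) :
    ∀ᵐ w ∂diagSum μ, IntervalIntegrable (fun r => noiseApprox W ε η r (b r w.1) w.2)
      volume 0 T := by
  filter_upwards [hm.ae_integrable_noiseKernel hε hη] with w hw
  rw [intervalIntegrable_iff_integrableOn_Ioc_of_le hm.T_pos.le]
  refine hw.integral_prod_left.congr ?_
  filter_upwards [ae_restrict_mem measurableSet_Ioc] with r hr
  exact (noiseApprox_eq_integral ε η hr.1.le w).symm

theorem restrict_prod_le {t : ℝ} (ht : t ≤ T) :
    (volume.restrict (Ioc 0 t)).prod (volume : Measure (Fin d → ℝ))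
      ≤ (volume.restrict (Ioc 0 T)).prod volume :=
  Measure.prod_mono (Measure.restrict_mono (Ioc_subset_Ioc_right ht) le_rfl) le_rfl

theorem pathInt_eq_integral [IsProbabilityMeasure μ] (hm : Model μ T H0 H ρ C A B b W M)
    {ε η : ℝ} (hε : 0 < ε) (hη : 0 < η) {t : ℝ} (ht : t ∈ Icc 0 T) :
    ∀ᵐ w ∂diagSum μ, pathInt W b ε η 0 t w
      = ∫ z, noiseKernel W b ε η z w ∂((volume.restrict (Ioc 0 t)).prod volume) := by
  filter_upwards [hm.ae_integrable_noiseKernel hε hη] with w hw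
  rw [integral_prod _ (hw.mono_measure (restrict_prod_le ht.2)), pathInt,
    intervalIntegral.integral_of_le ht.1]
  exact setIntegral_congr_fun measurableSet_Ioc fun r hr => noiseApprox_eq_integral ε η hr.1.le w

theorem pathInt_eq_sub [IsProbabilityMeasure μ] (hm : Model μ T H0 H ρ C A B b W M)
    {ε η : ℝ} (hε : 0 < ε) (hη : 0 < η) :
    ∀ᵐ w ∂diagSum μ, ∀ s ∈ Icc 0 T, ∀ t ∈ Icc 0 T,
      pathInt W b ε η s t w = pathInt W b ε η 0 t w - pathInt W b ε η 0 s w := by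
  filter_upwards [hm.ae_intervalIntegrable hε hη] with w hw s hs t ht
  have h : ∀ t ∈ Icc 0 T, IntervalIntegrable (fun r => noiseApprox W ε η r (b r w.1) w.2)
      volume 0 t := fun t ht => hw.mono_set (uIcc_subset_uIcc_left (by
        rw [uIcc_of_le hm.T_pos.le]; exact ht))
  exact (intervalIntegral.integral_interval_sub_left (h t ht) (h s hs)).symm

/-- The paths of the integral are continuous. -/
theorem ae_continuousOn_pathInt [IsProbabilityMeasure μ] (hm : Model μ T H0 H ρ C A B b W M)
    {ε η : ℝ} (hε : 0 < ε) (hη : 0 < η) :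
    ∀ᵐ ω ∂μ, ContinuousOn (fun t => pathInt W b ε η 0 t (ω, ω)) (Icc 0 T) := by
  filter_upwards [(ae_of_ae_diagSum (hm.ae_intervalIntegrable hε hη)).2] with ω hω
  have h := intervalIntegral.continuousOn_primitive_interval
    ((intervalIntegrable_iff').1 hω)
  rwa [uIcc_of_le hm.T_pos.le] at h

theorem aestronglyMeasurable_pathInt_zero [IsProbabilityMeasure μ]
    (hm : Model μ T H0 H ρ C A B b W M) {ε η : ℝ} (hε : 0 < ε) (hη : 0 < η) {t : ℝ}
    (ht : t ∈ Icc 0 T) :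
    AEStronglyMeasurable[MeasurableSpace.prod (brownianSigma B T) (fieldSigma W)]
      (pathInt W b ε η 0 t) (diagSum μ) := by
  have hle : MeasurableSpace.prod (brownianSigma B T) (fieldSigma W)
      ≤ (inferInstance : MeasurableSpace (Ω × Ω)) :=
    sup_le_sup (MeasurableSpace.comap_mono (hm.brownianSigma_le le_rfl))
      (MeasurableSpace.comap_mono hm.fieldSigma_le)
  refine (aestronglyMeasurable_integral_of_ae hle ((hm.integrable_noiseKernel hε hη).mono_measure
    (Measure.prod_mono (restrict_prod_le ht.2) le_rfl)) ?_).congr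
    (by filter_upwards [hm.pathInt_eq_integral hε hη ht] with w hw using hw.symm)
  have : ∀ᵐ z : ℝ × (Fin d → ℝ) ∂(volume.restrict (Ioc 0 t)).prod volume, z.1 ∈ Icc 0 T := by
    refine Measure.quasiMeasurePreserving_fst.ae ?_
    filter_upwards [ae_restrict_mem measurableSet_Ioc] with r hr
    exact ⟨hr.1.le, hr.2.trans ht.2⟩
  filter_upwards [this] with z hz
  exact hm.aestronglyMeasurable_noiseKernel ε η hz

theorem aestronglyMeasurable_pathInt [IsProbabilityMeasure μ]
    (hm : Model μ T H0 H ρ C A B b W M) {ε η : ℝ} (hε : 0 < ε) (hη : 0 < η) {s t : ℝ}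
    (hs : s ∈ Icc 0 T) (ht : t ∈ Icc 0 T) :
    AEStronglyMeasurable[MeasurableSpace.prod (brownianSigma B T) (fieldSigma W)]
      (pathInt W b ε η s t) (diagSum μ) := by
  refine ((hm.aestronglyMeasurable_pathInt_zero hε hη ht).sub
    (hm.aestronglyMeasurable_pathInt_zero hε hη hs)).congr ?_
  filter_upwards [hm.pathInt_eq_sub hε hη] with w hw
  exact (hw s hs t ht).symm

/-- The integral up to time `t` is adapted, up to null sets. -/
theorem aestronglyMeasurable_sigmaF_pathInt [IsProbabilityMeasure μ]
    (hm : Model μ T H0 H ρ C A B b W M) {ε η : ℝ} (hε : 0 < ε) (hη : 0 < η) {t : ℝ}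
    (ht : t ∈ Icc 0 T) :
    AEStronglyMeasurable[sigmaF B W t] (fun ω => pathInt W b ε η 0 t (ω, ω)) μ := by
  have hint : Integrable (fun p : (ℝ × (Fin d → ℝ)) × Ω => noiseKernel W b ε η p.1 (p.2, p.2))
      (((volume.restrict (Ioc 0 t)).prod volume).prod μ) := by
    have h1 := (hm.integrable_noiseKernel hε hη).mono_measure
      (Measure.prod_mono (restrict_prod_le ht.2)
        (show (μ.map fun ω => (ω, ω)) ≤ diagSum μ from Measure.le_add_left le_rfl))
    have h2 := Measure.map_prod_map ((volume.restrict (Ioc 0 t)).prod (volume : Measure (Fin d → ℝ)))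
      μ measurable_id (show Measurable fun ω : Ω => (ω, ω) by fun_prop)
    rw [Measure.map_id] at h2
    rw [h2] at h1
    exact h1.comp_measurable
      (g := fun p : (ℝ × (Fin d → ℝ)) × (Ω × Ω) => noiseKernel W b ε η p.1 p.2)
      (measurable_id.prodMap (show Measurable fun ω : Ω => (ω, ω) by fun_prop))
  refine (aestronglyMeasurable_integral_of_ae (f := fun z ω => noiseKernel W b ε η z (ω, ω))
    (hm.sigmaF_le ht.2) hint ?_).congr
    (by filter_upwards [(ae_of_ae_diagSum (hm.pathInt_eq_integral hε hη ht)).2] with ω hω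
        using hω.symm)
  have : ∀ᵐ z : ℝ × (Fin d → ℝ) ∂(volume.restrict (Ioc 0 t)).prod volume, z.1 ∈ Icc 0 t := by
    refine Measure.quasiMeasurePreserving_fst.ae ?_
    filter_upwards [ae_restrict_mem measurableSet_Ioc] with r hr
    exact ⟨hr.1.le, hr.2⟩
  filter_upwards [this] with z hz
  refine ⟨fun ω => noiseKernel W B ε η z (ω, ω), ?_, ?_⟩
  · have hB : Measurable[sigmaF B W t] (B z.1) :=
      (measurable_brownianSigma B hz).mono le_sup_left le_rfl
    have hWm : ∀ r, Measurable[sigmaF B W t] (W (max r 0) z.2) := fun r =>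
      (measurable_fieldSigma W (le_max_right r 0) z.2).mono le_sup_right le_rfl
    refine Measurable.stronglyMeasurable ?_
    refine Measurable.mul ?_ (Measurable.const_mul ((hWm _).sub (hWm _)) _)
    exact (continuous_heatKernel ε).measurable.comp (hB.sub_const z.2)
  · filter_upwards [hm.ae_eq] with ω hω
    simp only [noiseKernel, hω z.1 ⟨hz.1, hz.2.trans ht.2⟩]

/-- The integral of the regularised noise along a frozen path, in the Gaussian space. -/
noncomputable def frozenInt (hm : Model μ T H0 H ρ C A B b W M) (ε η s t : ℝ) (ω : Ω) :
    hm.field.gaussSpace :=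
  avgInt hm.field.smoothCurve η s t fun r => (√ε, b r ω)

theorem coeFn_frozenInt [IsProbabilityMeasure μ] (hm : Model μ T H0 H ρ C A B b W M)
    {ε : ℝ} (hε : 0 < ε) (η : ℝ) {s t : ℝ} (hs : 0 ≤ s) (hst : s ≤ t) (ω : Ω) :
    (hm.frozenInt ε η s t ω : Lp ℝ 2 μ) =ᵐ[μ] fun ω' => pathInt W b ε η s t (ω, ω') :=
  hm.field.coeFn_avgInt (by linarith [hm.H0_mem.1]) hm.H_pos hm.ρ_cont hm.growth hε η hs hst
    (hm.continuous_b ω)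

/-- With the path frozen the integral is Gaussian, and its standard deviation is controlled by the
running maximum of the path, uniformly in the smoothing parameters. -/
theorem exists_norm_frozenInt_le (hm : Model μ T H0 H ρ C A B b W M) (E : ℝ) :
    ∃ K, 0 ≤ K ∧ ∀ ε ≤ E, ∀ η > 0, ∀ s ∈ Icc 0 T, ∀ t ∈ Icc s T, ∀ ω,
      ‖hm.frozenInt ε η s t ω‖ ≤ K * (1 + M ω) ^ A * (t - s) ^ H0 := by
  have hH0 : 0 < H0 := by linarith [hm.H0_mem.1]
  have hC := hm.growth.C_nonneg
  refine ⟨C * ∫ n : Fin d → ℝ, Real.exp (√E * ∑ i, |n i|) ∂stdGauss d,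
    mul_nonneg hC (integral_nonneg fun _ => (Real.exp_pos _).le),
    fun ε hε η hη s hs t ht ω => ?_⟩
  have hK : 0 ≤ C * ∫ n : Fin d → ℝ, Real.exp (√E * ∑ i, |n i|) ∂stdGauss d :=
    mul_nonneg hC (integral_nonneg fun _ => (Real.exp_pos _).le)
  have hM := hm.M_nonneg ω
  refine (hm.field.isFracField hH0 hm.H_pos hm.ρ_cont hm.growth).norm_avgInt_le
    hm.H0_mem.1.le hη ht.1 (by positivity)
    (continuous_const.prodMk (hm.continuous_b ω)).continuousOn fun r hr => ?_
  refine (hm.field.norm_smoothCurve_one_le hH0 hm.growth (E := √E)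
    (by rw [abs_of_nonneg (Real.sqrt_nonneg _)]; exact Real.sqrt_le_sqrt hε) (b r ω)).trans ?_
  refine mul_le_mul_of_nonneg_left ?_ hK
  have h1 := hm.norm_le ω r ⟨hs.1.trans hr.1, hr.2.trans ht.2⟩
  exact Real.rpow_le_rpow (by positivity) (by linarith) hm.growth.A_nonneg

/-- With the path frozen, the regularised integrals converge in `L²` as both smoothing parameters
tend to `0` independently of each other. -/
theorem exists_tendsto_frozenInt (hm : Model μ T H0 H ρ C A B b W M) {t : ℝ} (ht : 0 ≤ t) (ω : Ω) :
    ∃ J, Tendsto (fun z : ℝ × ℝ => hm.frozenInt z.1 z.2 0 t ω) (𝓝[>] 0 ×ˢ 𝓝[>] 0) (𝓝 J) := by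
  have hH0 : 0 < H0 := by linarith [hm.H0_mem.1]
  have hF := hm.field.isFracField hH0 hm.H_pos hm.ρ_cont hm.growth
  refine hF.exists_tendsto_avgInt hm.H0_mem.1.le ht (v := fun ε r => (√ε, b r ω))
    (v₀ := fun r => ((0 : ℝ), b r ω))
    (fun ε => (continuous_const.prodMk (hm.continuous_b ω)).continuousOn)
    (continuous_const.prodMk (hm.continuous_b ω)).continuousOn fun κ hκ => ?_
  have hc : Continuous fun p : ℝ × ℝ => hm.field.smoothCurve 1 (p.1, b p.2 ω) :=
    hF.continuous_space.comp
      (continuous_fst.prodMk ((hm.continuous_b ω).comp continuous_snd))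
  have huc := (isCompact_Icc (a := (0 : ℝ)) (b := 1)).prod (isCompact_Icc (a := (0 : ℝ)) (b := t))
    |>.uniformContinuousOn_of_continuous hc.continuousOn
  obtain ⟨δ, hδ, h⟩ := Metric.uniformContinuousOn_iff.1 huc κ hκ
  have h1 : Tendsto (fun ε : ℝ => √ε) (𝓝[>] 0) (𝓝 0) := by
    have := Real.continuous_sqrt.tendsto 0
    rw [Real.sqrt_zero] at this
    exact this.mono_left nhdsWithin_le_nhds
  filter_upwards [h1.eventually (gt_mem_nhds hδ), h1.eventually (gt_mem_nhds one_pos)]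
    with ε h2 h3 r hr
  rw [← dist_eq_norm]
  refine (h (√ε, r) ⟨⟨Real.sqrt_nonneg _, h3.le⟩, hr⟩ (0, r) ⟨⟨le_rfl, zero_le_one⟩, hr⟩ ?_).le
  rw [Prod.dist_eq, dist_self, Real.dist_eq, sub_zero, abs_of_nonneg (Real.sqrt_nonneg _)]
  exact max_lt h2 hδ

theorem lintegral_M_pow_lt_top (hm : Model μ T H0 H ρ C A B b W M) {K : ℝ} (hK : 0 ≤ K) (k : ℕ) :
    ∫⁻ ω, ENNReal.ofReal (K * ((1 + M ω) ^ A) ^ k) ∂μ < ∞ := by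
  have h1 : ∀ ω, ENNReal.ofReal (K * ((1 + M ω) ^ A) ^ k)
      ≤ ENNReal.ofReal (K * k.factorial) * ENNReal.ofReal (Real.exp (1 * (1 + M ω) ^ (2 * A))) := by
    intro ω
    have hM := hm.M_nonneg ω
    rw [← ENNReal.ofReal_mul (by positivity), one_mul, mul_assoc]
    refine ENNReal.ofReal_le_ofReal (mul_le_mul_of_nonneg_left ?_ hK)
    refine (Real.pow_le_factorial_mul_exp (by positivity) k).trans ?_
    gcongr
    · linarith
    · linarith [hm.growth.A_nonneg]
  refine lt_of_le_of_lt (lintegral_mono h1) ?_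
  rw [lintegral_const_mul' _ _ ENNReal.ofReal_ne_top]
  exact ENNReal.mul_lt_top ENNReal.ofReal_lt_top (hm.exp_moment 1)

/-- Decoupling: in law, the integral of the field along its own independent path is the integral of
an independent copy of the field, for which the path may be frozen. -/
theorem lintegral_pathInt_eq [IsProbabilityMeasure μ] (hm : Model μ T H0 H ρ C A B b W M)
    {ε η : ℝ} (hε : 0 < ε) (hη : 0 < η) {s t : ℝ}
    (hs : s ∈ Icc 0 T) (ht : t ∈ Icc 0 T) {Φ : ℝ → ℝ≥0∞} (hΦ : Measurable Φ) :
    ∫⁻ ω, Φ (pathInt W b ε η s t (ω, ω)) ∂μ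
      = ∫⁻ ω, ∫⁻ ω', Φ (pathInt W b ε η s t (ω, ω')) ∂μ ∂μ := by
  have hmeas := hm.aestronglyMeasurable_pathInt hε hη hs ht
  rw [lintegral_diag_eq (hm.brownianSigma_le le_rfl) hm.fieldSigma_le hm.indep hmeas hΦ,
    lintegral_prod]
  have hle : MeasurableSpace.prod (brownianSigma B T) (fieldSigma W)
      ≤ (inferInstance : MeasurableSpace (Ω × Ω)) :=
    sup_le_sup (MeasurableSpace.comap_mono (hm.brownianSigma_le le_rfl))
      (MeasurableSpace.comap_mono hm.fieldSigma_le)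
  exact hΦ.comp_aemeasurable ((hmeas.mono hle).mono_measure
    (Measure.le_add_right le_rfl)).aemeasurable

/-- Moments of the increments. -/
theorem exists_lintegral_pathInt_pow_le [IsProbabilityMeasure μ]
    (hm : Model μ T H0 H ρ C A B b W M) (E : ℝ) {k : ℕ} (hk : k ≠ 0) :
    ∃ K, 0 ≤ K ∧ ∀ ε ∈ Ioc 0 E, ∀ η > 0, ∀ s ∈ Icc 0 T, ∀ t ∈ Icc s T,
      ∫⁻ ω, ‖pathInt W b ε η s t (ω, ω)‖ₑ ^ k ∂μ ≤ ENNReal.ofReal (K * ((t - s) ^ H0) ^ k) := by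
  obtain ⟨K, hK0, hK⟩ := hm.exists_norm_frozenInt_le E
  set c : ℝ := 2 * Real.exp (1 / 2) * k.factorial with hc
  have hfin := hm.lintegral_M_pow_lt_top (K := c * K ^ k) (by positivity) k
  refine ⟨(∫⁻ ω, ENNReal.ofReal (c * K ^ k * ((1 + M ω) ^ A) ^ k) ∂μ).toReal,
    ENNReal.toReal_nonneg, fun ε hε η hη s hs t ht => ?_⟩
  have hpos : 0 ≤ (t - s) ^ H0 := Real.rpow_nonneg (by linarith [ht.1]) _
  rw [hm.lintegral_pathInt_eq hε.1 hη hs ⟨hs.1.trans ht.1, ht.2⟩ (Φ := fun x => ‖x‖ₑ ^ k)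
    (by fun_prop), ENNReal.ofReal_mul ENNReal.toReal_nonneg, ENNReal.ofReal_toReal hfin.ne,
    ← lintegral_mul_const' _ _ ENNReal.ofReal_ne_top]
  refine lintegral_mono fun ω => ?_
  calc ∫⁻ ω', ‖pathInt W b ε η s t (ω, ω')‖ₑ ^ k ∂μ
      = ∫⁻ ω', ‖(hm.frozenInt ε η s t ω : Lp ℝ 2 μ) ω'‖ₑ ^ k ∂μ := by
        refine lintegral_congr_ae ?_
        filter_upwards [hm.coeFn_frozenInt hε.1 η hs.1 ht.1 ω] with ω' h
        rw [h]
    _ ≤ ENNReal.ofReal (c * ‖hm.frozenInt ε η s t ω‖ ^ k) := hm.field.lintegral_pow_le _ hk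
    _ ≤ _ := by
        have hM := hm.M_nonneg ω
        rw [← ENNReal.ofReal_mul (by positivity)]
        refine ENNReal.ofReal_le_ofReal ?_
        calc c * ‖hm.frozenInt ε η s t ω‖ ^ k ≤ c * (K * (1 + M ω) ^ A * (t - s) ^ H0) ^ k := by
              gcongr
              exact hK ε hε.2 η hη s hs t ht ω
          _ = _ := by ring

/-- Exponential moments, uniformly in the regularisation. -/
theorem exists_lintegral_exp_pathInt_le [IsProbabilityMeasure μ]
    (hm : Model μ T H0 H ρ C A B b W M) (E a : ℝ) :
    ∃ K, K < ∞ ∧ ∀ ε ∈ Ioc 0 E, ∀ η > 0, ∀ s ∈ Icc 0 T, ∀ t ∈ Icc s T,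
      ∫⁻ ω, ENNReal.ofReal (Real.exp (a * pathInt W b ε η s t (ω, ω))) ∂μ ≤ K := by
  obtain ⟨K, hK0, hK⟩ := hm.exists_norm_frozenInt_le E
  refine ⟨_, hm.exp_moment (a ^ 2 * (K * T ^ H0) ^ 2 / 2), fun ε hε η hη s hs t ht => ?_⟩
  rw [hm.lintegral_pathInt_eq hε.1 hη hs ⟨hs.1.trans ht.1, ht.2⟩
    (Φ := fun x => ENNReal.ofReal (Real.exp (a * x))) (by fun_prop)]
  refine lintegral_mono fun ω => ?_
  have hM := hm.M_nonneg ω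
  calc ∫⁻ ω', ENNReal.ofReal (Real.exp (a * pathInt W b ε η s t (ω, ω'))) ∂μ
      = ∫⁻ ω', ENNReal.ofReal (Real.exp (a * (hm.frozenInt ε η s t ω : Lp ℝ 2 μ) ω')) ∂μ := by
        refine lintegral_congr_ae ?_
        filter_upwards [hm.coeFn_frozenInt hε.1 η hs.1 ht.1 ω] with ω' h
        rw [h]
    _ ≤ ENNReal.ofReal (Real.exp (a ^ 2 * ‖hm.frozenInt ε η s t ω‖ ^ 2 / 2)) :=
        hm.field.lintegral_exp_mul_le _ a
    _ ≤ _ := by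
        refine ENNReal.ofReal_le_ofReal (Real.exp_le_exp.2 ?_)
        have h1 : ‖hm.frozenInt ε η s t ω‖ ≤ K * (1 + M ω) ^ A * T ^ H0 := by
          refine (hK ε hε.2 η hη s hs t ht ω).trans ?_
          refine mul_le_mul_of_nonneg_left ?_ (by positivity)
          exact Real.rpow_le_rpow (by linarith [ht.1]) (by linarith [hs.1, ht.2])
            (by linarith [hm.H0_mem.1])
        have h2 : (1 + M ω) ^ (2 * A) = ((1 + M ω) ^ A) ^ 2 := by
          rw [mul_comm, Real.rpow_mul (by positivity), Real.rpow_two]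
        calc a ^ 2 * ‖hm.frozenInt ε η s t ω‖ ^ 2 / 2
            ≤ a ^ 2 * (K * (1 + M ω) ^ A * T ^ H0) ^ 2 / 2 := by gcongr
          _ = _ := by rw [h2]; ring

/-- The regularised integrals form a Cauchy family in every `Lᵏ`. -/
theorem tendsto_lintegral_pathInt_sub [IsProbabilityMeasure μ]
    (hm : Model μ T H0 H ρ C A B b W M) {k : ℕ} (hk : k ≠ 0) {t : ℝ} (ht : t ∈ Icc 0 T) :
    Tendsto (fun z : (ℝ × ℝ) × (ℝ × ℝ) => ∫⁻ ω, ‖pathInt W b z.1.1 z.1.2 0 t (ω, ω)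
        - pathInt W b z.2.1 z.2.2 0 t (ω, ω)‖ₑ ^ k ∂μ)
      ((𝓝[>] 0 ×ˢ 𝓝[>] 0) ×ˢ (𝓝[>] 0 ×ˢ 𝓝[>] 0)) (𝓝 0) := by
  obtain ⟨K, hK0, hK⟩ := hm.exists_norm_frozenInt_le 1
  set c : ℝ := 2 * Real.exp (1 / 2) * k.factorial with hc
  set G : (ℝ × ℝ) × (ℝ × ℝ) → Ω → ℝ≥0∞ := fun z ω => ∫⁻ ω', ‖pathInt W b z.1.1 z.1.2 0 t (ω, ω')
    - pathInt W b z.2.1 z.2.2 0 t (ω, ω')‖ₑ ^ k ∂μ with hG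
  have h0T : (0 : ℝ) ∈ Icc 0 T := ⟨le_rfl, hm.T_pos.le⟩
  have hle : MeasurableSpace.prod (brownianSigma B T) (fieldSigma W)
      ≤ (inferInstance : MeasurableSpace (Ω × Ω)) :=
    sup_le_sup (MeasurableSpace.comap_mono (hm.brownianSigma_le le_rfl))
      (MeasurableSpace.comap_mono hm.fieldSigma_le)
  set P : (ℝ × ℝ) × (ℝ × ℝ) → Prop := fun z =>
    ((0 < z.1.1 ∧ 0 < z.1.2) ∧ (0 < z.2.1 ∧ 0 < z.2.2)) ∧ (z.1.1 ≤ 1 ∧ z.2.1 ≤ 1) with hP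
  have hpos : ∀ᶠ z : ℝ × ℝ in 𝓝[>] 0 ×ˢ 𝓝[>] 0, (0 < z.1 ∧ 0 < z.2) ∧ z.1 ≤ 1 := by
    have h1 : ∀ᶠ x : ℝ in 𝓝[>] 0, 0 < x := self_mem_nhdsWithin
    have h2 : ∀ᶠ x : ℝ in 𝓝[>] 0, x ≤ 1 :=
      nhdsWithin_le_nhds (Iic_mem_nhds one_pos)
    filter_upwards [(h1.and h2).prod_mk h1] with z hz
    exact ⟨⟨hz.1.1, hz.2⟩, hz.1.2⟩
  have hPev : ∀ᶠ z in ((𝓝[>] (0 : ℝ) ×ˢ 𝓝[>] (0 : ℝ)) ×ˢ (𝓝[>] (0 : ℝ) ×ˢ 𝓝[>] (0 : ℝ))), P z := by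
    filter_upwards [hpos.prod_mk hpos] with z hz
    exact ⟨⟨hz.1.1, hz.2.1⟩, hz.1.2, hz.2.2⟩
  have hmeasP : ∀ z, P z → AEStronglyMeasurable[MeasurableSpace.prod (brownianSigma B T)
      (fieldSigma W)] (fun w => pathInt W b z.1.1 z.1.2 0 t w - pathInt W b z.2.1 z.2.2 0 t w)
      (diagSum μ) := fun z hz =>
    (hm.aestronglyMeasurable_pathInt hz.1.1.1 hz.1.1.2 h0T ht).sub
      (hm.aestronglyMeasurable_pathInt hz.1.2.1 hz.1.2.2 h0T ht)
  have hmeas2 : ∀ z, P z → AEMeasurable (fun w : Ω × Ω => ‖pathInt W b z.1.1 z.1.2 0 t w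
      - pathInt W b z.2.1 z.2.2 0 t w‖ₑ ^ k) (μ.prod μ) := fun z hz =>
    ((((hmeasP z hz).mono hle).mono_measure (Measure.le_add_right le_rfl)).enorm).pow_const k
  have heq : ∀ z, P z → ∫⁻ ω, ‖pathInt W b z.1.1 z.1.2 0 t (ω, ω)
      - pathInt W b z.2.1 z.2.2 0 t (ω, ω)‖ₑ ^ k ∂μ = ∫⁻ ω, G z ω ∂μ := by
    intro z hz
    have h1 := lintegral_diag_eq (hm.brownianSigma_le le_rfl) hm.fieldSigma_le hm.indep
      (hmeasP z hz) (Φ := fun x => ‖x‖ₑ ^ k) (by fun_prop)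
    rw [h1, lintegral_prod _ (hmeas2 z hz)]
  have hGle : ∀ z, P z → ∀ ω, G z ω ≤ ENNReal.ofReal (c *
      ‖hm.frozenInt z.1.1 z.1.2 0 t ω - hm.frozenInt z.2.1 z.2.2 0 t ω‖ ^ k) := by
    intro z hz ω
    refine le_trans (le_of_eq (lintegral_congr_ae ?_)) (hm.field.lintegral_pow_le
      (hm.frozenInt z.1.1 z.1.2 0 t ω - hm.frozenInt z.2.1 z.2.2 0 t ω) hk)
    filter_upwards [hm.coeFn_frozenInt hz.1.1.1 z.1.2 le_rfl ht.1 ω,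
      hm.coeFn_frozenInt hz.1.2.1 z.2.2 le_rfl ht.1 ω,
      Lp.coeFn_sub (hm.frozenInt z.1.1 z.1.2 0 t ω : Lp ℝ 2 μ)
        (hm.frozenInt z.2.1 z.2.2 0 t ω : Lp ℝ 2 μ)] with ω' h1 h2 h3
    rw [Submodule.coe_sub, h3, Pi.sub_apply, h1, h2]
  have hlim : ∀ ω, Tendsto (fun z => G z ω)
      ((𝓝[>] (0 : ℝ) ×ˢ 𝓝[>] (0 : ℝ)) ×ˢ (𝓝[>] (0 : ℝ) ×ˢ 𝓝[>] (0 : ℝ))) (𝓝 0) := by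
    intro ω
    obtain ⟨J, hJ⟩ := hm.exists_tendsto_frozenInt ht.1 ω
    have h1 : Tendsto (fun z : (ℝ × ℝ) × (ℝ × ℝ) => ENNReal.ofReal (c *
        ‖hm.frozenInt z.1.1 z.1.2 0 t ω - hm.frozenInt z.2.1 z.2.2 0 t ω‖ ^ k))
        ((𝓝[>] (0 : ℝ) ×ˢ 𝓝[>] (0 : ℝ)) ×ˢ (𝓝[>] (0 : ℝ) ×ˢ 𝓝[>] (0 : ℝ))) (𝓝 0) := by
      have h2 := ENNReal.tendsto_ofReal
        ((((hJ.comp tendsto_fst).sub (hJ.comp tendsto_snd)).norm.pow k).const_mul c)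
      simpa [hk] using h2
    exact tendsto_of_tendsto_of_tendsto_of_le_of_le' tendsto_const_nhds h1
      (Eventually.of_forall fun _ => zero_le) (hPev.mono fun z hz => hGle z hz ω)
  have hbound : ∀ z, P z → ∀ ω, G z ω
      ≤ ENNReal.ofReal (c * (2 * K * T ^ H0) ^ k * ((1 + M ω) ^ A) ^ k) := by
    intro z hz ω
    refine (hGle z hz ω).trans (ENNReal.ofReal_le_ofReal ?_)
    have hM := hm.M_nonneg ω
    have h1 : ∀ ε ≤ 1, ∀ η > 0, ‖hm.frozenInt ε η 0 t ω‖ ≤ K * (1 + M ω) ^ A * T ^ H0 := by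
      intro ε hε η hη
      refine (hK ε hε η hη 0 h0T t ht ω).trans ?_
      refine mul_le_mul_of_nonneg_left ?_ (by positivity)
      exact Real.rpow_le_rpow (by linarith [ht.1]) (by linarith [ht.2])
        (by linarith [hm.H0_mem.1])
    have h2 : ‖hm.frozenInt z.1.1 z.1.2 0 t ω - hm.frozenInt z.2.1 z.2.2 0 t ω‖
        ≤ 2 * K * T ^ H0 * (1 + M ω) ^ A := by
      refine (norm_sub_le _ _).trans ?_
      linarith [h1 _ hz.2.1 _ hz.1.1.2, h1 _ hz.2.2 _ hz.1.2.2]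
    calc c * ‖hm.frozenInt z.1.1 z.1.2 0 t ω - hm.frozenInt z.2.1 z.2.2 0 t ω‖ ^ k
        ≤ c * (2 * K * T ^ H0 * (1 + M ω) ^ A) ^ k := by gcongr
      _ = _ := by ring
  have hTpos := hm.T_pos
  have hfin := hm.lintegral_M_pow_lt_top (K := c * (2 * K * T ^ H0) ^ k) (by positivity) k
  refine Tendsto.congr' (hPev.mono fun z hz => (heq z hz).symm) ?_
  have h := tendsto_lintegral_filter_of_dominated_convergence' (μ := μ) (F := G) (f := fun _ => 0)
    (fun ω => ENNReal.ofReal (c * (2 * K * T ^ H0) ^ k * ((1 + M ω) ^ A) ^ k))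
    (hPev.mono fun z hz => (hmeas2 z hz).lintegral_prod_right')
    (hPev.mono fun z hz => ae_of_all _ fun ω => hbound z hz ω) hfin.ne (ae_of_all _ hlim)
  simpa using h

end Model

end FracBSDE

/-! ### Suprema over dyadic grids and the maximal inequality -/

namespace FracBSDE

/-- The `k`-th point of the dyadic grid of level `n` in `[0, T]`. -/
noncomputable def gridPt (T : ℝ) (n k : ℕ) : ℝ := k * T / 2 ^ n

theorem gridPt_mem {T : ℝ} (hT : 0 ≤ T) {n k : ℕ} (hk : k ≤ 2 ^ n) : gridPt T n k ∈ Icc 0 T := by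
  refine ⟨by unfold gridPt; positivity, ?_⟩
  rw [gridPt, div_le_iff₀ (by positivity), mul_comm]
  exact mul_le_mul_of_nonneg_left (by exact_mod_cast hk) hT

theorem gridPt_mono {T : ℝ} (hT : 0 ≤ T) (n : ℕ) : Monotone (gridPt T n) := by
  intro i j hij
  unfold gridPt
  gcongr

theorem gridPt_succ_two_mul (T : ℝ) (n k : ℕ) : gridPt T (n + 1) (2 * k) = gridPt T n k := by
  simp only [gridPt]
  push_cast
  field_simp
  ring

/-- The largest value of `g` on the dyadic grid of level `n`. -/
noncomputable def gridSup (T : ℝ) (n : ℕ) (g : ℝ → ℝ≥0∞) : ℝ≥0∞ :=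
  ⨆ k ∈ Finset.range (2 ^ n + 1), g (gridPt T n k)

theorem gridSup_mono (T : ℝ) (g : ℝ → ℝ≥0∞) : Monotone fun n => gridSup T n g := by
  refine monotone_nat_of_le_succ fun n => iSup₂_le fun k hk => ?_
  rw [← gridPt_succ_two_mul]
  refine le_iSup₂_of_le (f := fun k _ => g (gridPt T (n + 1) k)) (2 * k) ?_ le_rfl
  simp only [Finset.mem_range] at hk ⊢
  rw [pow_succ]
  omega

theorem le_gridSup (T : ℝ) (g : ℝ → ℝ≥0∞) {n k : ℕ} (hk : k ≤ 2 ^ n) :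
    g (gridPt T n k) ≤ gridSup T n g :=
  le_iSup₂_of_le (f := fun k _ => g (gridPt T n k)) k (by simp; omega) le_rfl

/-- The index of the last point of the dyadic grid of level `n` before time `t`. -/
noncomputable def gridFloor (T t : ℝ) (n : ℕ) : ℕ := ⌊t * 2 ^ n / T⌋₊

theorem gridFloor_le {T t : ℝ} (hT : 0 < T) (ht : t ∈ Icc 0 T) (n : ℕ) :
    gridFloor T t n ≤ 2 ^ n := by
  refine Nat.floor_le_of_le ?_
  rw [div_le_iff₀ hT, mul_comm]
  push_cast
  exact mul_le_mul_of_nonneg_left ht.2 (by positivity)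

theorem gridPt_gridFloor_le {T t : ℝ} (hT : 0 < T) (ht : t ∈ Icc 0 T) (n : ℕ) :
    gridPt T n (gridFloor T t n) ≤ t := by
  have h2 := Nat.floor_le (show 0 ≤ t * 2 ^ n / T from
    div_nonneg (mul_nonneg ht.1 (by positivity)) hT.le)
  rw [le_div_iff₀ hT] at h2
  rw [gridPt, gridFloor, div_le_iff₀ (by positivity)]
  exact h2

theorem tendsto_gridPt_gridFloor {T t : ℝ} (hT : 0 < T) (ht : t ∈ Icc 0 T) :
    Tendsto (fun n => gridPt T n (gridFloor T t n)) atTop (𝓝[Icc 0 T] t) := by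
  refine tendsto_nhdsWithin_iff.2 ⟨?_, Eventually.of_forall fun n =>
    gridPt_mem hT.le (gridFloor_le hT ht n)⟩
  have h1 : Tendsto (fun n : ℕ => t - T * (1 / 2) ^ n) atTop (𝓝 (t - T * 0)) :=
    tendsto_const_nhds.sub ((tendsto_pow_atTop_nhds_zero_of_lt_one (by norm_num)
      (by norm_num)).const_mul T)
  rw [mul_zero, sub_zero] at h1
  refine tendsto_of_tendsto_of_tendsto_of_le_of_le h1 tendsto_const_nhds (fun n => ?_)
    (gridPt_gridFloor_le hT ht)
  have h2 := Nat.lt_floor_add_one (t * 2 ^ n / T)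
  rw [div_lt_iff₀ hT] at h2
  simp only [gridPt, gridFloor]
  rw [le_div_iff₀ (by positivity), one_div, inv_pow]
  have h3 : (2 : ℝ) ^ n ≠ 0 := by positivity
  field_simp
  nlinarith

theorem iSup_gridSup_eq {T : ℝ} (hT : 0 < T) {g : ℝ → ℝ≥0∞} (hg : ContinuousOn g (Icc 0 T)) :
    ⨆ n, gridSup T n g = ⨆ t ∈ Icc 0 T, g t := by
  refine le_antisymm (iSup_le fun n => iSup₂_le fun k hk => ?_) (iSup₂_le fun t ht => ?_)
  · exact le_iSup₂_of_le (f := fun t _ => g t) (gridPt T n k)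
      (gridPt_mem hT.le (by simpa [Nat.lt_succ_iff] using hk)) le_rfl
  · refine le_of_tendsto ((hg t ht).tendsto.comp (tendsto_gridPt_gridFloor hT ht))
      (Eventually.of_forall fun n => ?_)
    exact (le_gridSup T g (gridFloor_le hT ht n)).trans (le_iSup (fun n => gridSup T n g) n)

theorem measurable_gridSup {Ω : Type*} (m : MeasurableSpace Ω) {T : ℝ} {n : ℕ} {g : ℝ → Ω → ℝ≥0∞}
    (hg : ∀ k ∈ Finset.range (2 ^ n + 1), Measurable[m] (g (gridPt T n k))) :
    Measurable[m] fun ω => gridSup T n fun t => g t ω :=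
  Measurable.biSup _ (Finset.countable_toSet _) hg

variable {Ω : Type*} [MeasurableSpace Ω] {μ : Measure Ω}

theorem aemeasurable_gridSup {T : ℝ} (hT : 0 ≤ T) (n : ℕ) {g : ℝ → Ω → ℝ≥0∞}
    (hg : ∀ t ∈ Icc 0 T, AEMeasurable (g t) μ) :
    AEMeasurable (fun ω => gridSup T n fun t => g t ω) μ := by
  refine AEMeasurable.biSup _ (Finset.countable_toSet _) fun k hk => hg _ ?_
  exact gridPt_mem hT (by simpa [Nat.lt_succ_iff] using hk)

theorem iSup_enorm_rpow_ae_eq {T : ℝ} (hT : 0 < T) {p : ℝ} {ψ : ℝ → Ω → ℝ}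
    (hc : ∀ᵐ ω ∂μ, ContinuousOn (fun t => ψ t ω) (Icc 0 T)) :
    (fun ω => ⨆ t ∈ Icc 0 T, ‖ψ t ω‖ₑ ^ p) =ᵐ[μ]
      fun ω => ⨆ n, gridSup T n fun t => ‖ψ t ω‖ₑ ^ p := by
  filter_upwards [hc] with ω hω
  refine (iSup_gridSup_eq hT ?_).symm
  exact (ENNReal.continuous_rpow_const (y := p)).comp_continuousOn
    (continuous_enorm.comp_continuousOn hω)

theorem aemeasurable_iSup_enorm_rpow {T : ℝ} (hT : 0 < T) {p : ℝ} {ψ : ℝ → Ω → ℝ}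
    (hc : ∀ᵐ ω ∂μ, ContinuousOn (fun t => ψ t ω) (Icc 0 T))
    (hm : ∀ t ∈ Icc 0 T, AEMeasurable (ψ t) μ) :
    AEMeasurable (fun ω => ⨆ t ∈ Icc 0 T, ‖ψ t ω‖ₑ ^ p) μ :=
  (AEMeasurable.iSup fun n => aemeasurable_gridSup hT.le n fun t ht =>
    (hm t ht).enorm.pow_const p).congr (iSup_enorm_rpow_ae_eq hT hc).symm

/-- For a continuous process, bounds over all dyadic grids give a bound on `[0, T]`. -/
theorem supMoment_le_of_gridSup {T : ℝ} (hT : 0 < T) {p : ℝ} {ψ : ℝ → Ω → ℝ}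
    (hc : ∀ᵐ ω ∂μ, ContinuousOn (fun t => ψ t ω) (Icc 0 T))
    (hm : ∀ t ∈ Icc 0 T, AEMeasurable (ψ t) μ) {c : ℝ≥0∞}
    (h : ∀ n, ∫⁻ ω, gridSup T n (fun t => ‖ψ t ω‖ₑ ^ p) ∂μ ≤ c) :
    supMoment μ T p ψ ≤ c := by
  rw [supMoment, lintegral_congr_ae (iSup_enorm_rpow_ae_eq hT hc), lintegral_iSup'
    (fun n => aemeasurable_gridSup hT.le n fun t ht => (hm t ht).enorm.pow_const p)
    (ae_of_all _ fun ω => gridSup_mono T _)]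
  exact iSup_le h

/-- A weak-type bound with exponent `r` gives strong bounds for all smaller exponents. -/
theorem lintegral_rpow_le_of_weak [IsProbabilityMeasure μ] {f : Ω → ℝ} (hf0 : 0 ≤ f)
    (hf : AEMeasurable f μ) {p r x : ℝ} (hp : 0 < p) (hpr : p < r) (hx : 0 < x)
    (h : ∀ t > 0, μ {ω | t ≤ f ω} ≤ ENNReal.ofReal (x ^ r * t ^ (-r))) :
    ∫⁻ ω, ENNReal.ofReal (f ω ^ p) ∂μ ≤ ENNReal.ofReal (r / (r - p) * x ^ p) := by
  have hrp : 0 < r - p := by linarith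
  rw [lintegral_rpow_eq_lintegral_meas_le_mul μ (ae_of_all _ hf0) hf hp,
    ← Ioc_union_Ioi_eq_Ioi hx.le, lintegral_union measurableSet_Ioi (Ioc_disjoint_Ioi le_rfl)]
  have e1 : ∫⁻ t in Ioc 0 x, μ {ω | t ≤ f ω} * ENNReal.ofReal (t ^ (p - 1))
      ≤ ENNReal.ofReal (x ^ p / p) := by
    calc ∫⁻ t in Ioc 0 x, μ {ω | t ≤ f ω} * ENNReal.ofReal (t ^ (p - 1))
        ≤ ∫⁻ t in Ioc 0 x, ENNReal.ofReal (t ^ (p - 1)) :=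
          lintegral_mono fun t => mul_le_of_le_one_left zero_le prob_le_one
      _ = ENNReal.ofReal (∫ t in Ioc 0 x, t ^ (p - 1)) := by
          refine (ofReal_integral_eq_lintegral_ofReal ?_ ?_).symm
          · exact (intervalIntegrable_iff_integrableOn_Ioc_of_le hx.le).1
              (intervalIntegral.intervalIntegrable_rpow' (by linarith))
          · filter_upwards [ae_restrict_mem measurableSet_Ioc] with t ht
            exact Real.rpow_nonneg ht.1.le _
      _ = _ := by
          rw [← intervalIntegral.integral_of_le hx.le, integral_rpow (Or.inl (by linarith)),
            sub_add_cancel, Real.zero_rpow hp.ne', sub_zero]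
  have e2 : ∫⁻ t in Ioi x, μ {ω | t ≤ f ω} * ENNReal.ofReal (t ^ (p - 1))
      ≤ ENNReal.ofReal (x ^ p / (r - p)) := by
    calc ∫⁻ t in Ioi x, μ {ω | t ≤ f ω} * ENNReal.ofReal (t ^ (p - 1))
        ≤ ∫⁻ t in Ioi x, ENNReal.ofReal (x ^ r * t ^ (p - 1 - r)) := by
          refine setLIntegral_mono' measurableSet_Ioi fun t ht => ?_
          have ht0 : 0 < t := hx.trans ht
          refine (mul_le_mul_left (h t ht0) _).trans (le_of_eq ?_)
          rw [← ENNReal.ofReal_mul (by positivity), mul_assoc, ← Real.rpow_add ht0]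
          ring_nf
      _ = ENNReal.ofReal (∫ t in Ioi x, x ^ r * t ^ (p - 1 - r)) := by
          refine (ofReal_integral_eq_lintegral_ofReal ?_ ?_).symm
          · exact (integrableOn_Ioi_rpow_of_lt (by linarith) hx).const_mul _
          · filter_upwards [ae_restrict_mem measurableSet_Ioi] with t ht
            have ht0 : 0 < t := hx.trans ht
            positivity
      _ = _ := by
          rw [integral_const_mul, integral_Ioi_rpow_of_lt (by linarith) hx]
          congr 1
          have h3 : p - 1 - r + 1 = p - r := by ring
          have h4 : x ^ r * x ^ (p - r) = x ^ p := by rw [← Real.rpow_add hx]; ring_nf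
          rw [h3, ← h4]
          have h5 : p - r ≠ 0 := by linarith
          field_simp
          ring
  refine (mul_le_mul_right (add_le_add e1 e2) _).trans (le_of_eq ?_)
  rw [← ENNReal.ofReal_add (by positivity) (by positivity), ← ENNReal.ofReal_mul hp.le]
  congr 1
  field_simp
  ring

section Doob

variable {F : ℝ → MeasurableSpace Ω} {T : ℝ}

/-- Doob's maximal inequality on a dyadic grid, localised on the event. -/
theorem mul_meas_gridSup_le [IsProbabilityMeasure μ] (hT : 0 ≤ T)
    (hF : ∀ s ∈ Icc 0 T, ∀ t ∈ Icc s T, F s ≤ F t)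
    (hFm : ∀ t ∈ Icc 0 T, F t ≤ (inferInstance : MeasurableSpace Ω)) {X : Ω → ℝ}
    (hX : Integrable X μ) (n : ℕ) {l : ℝ} (hl : 0 < l) :
    ∃ S : Set Ω, S = {ω | ENNReal.ofReal l ≤ gridSup T n fun t => ‖(μ[X|F t]) ω‖ₑ} ∧
      MeasurableSet S ∧ ENNReal.ofReal l * μ S ≤ ∫⁻ ω in S, ‖X ω‖ₑ ∂μ := by
  classical
  set τ : ℕ → ℝ := fun k => gridPt T n (min k (2 ^ n)) with hτ
  have hτm : ∀ k, τ k ∈ Icc 0 T := fun k => gridPt_mem hT (min_le_right _ _)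
  have hτmono : Monotone τ := fun i j hij => gridPt_mono hT n (min_le_min_right _ hij)
  let 𝒢 : Filtration ℕ (inferInstance : MeasurableSpace Ω) :=
    { seq := fun k => F (τ k)
      mono' := fun i j hij => hF _ (hτm i) _ ⟨hτmono hij, (hτm j).2⟩
      le' := fun k => hFm _ (hτm k) }
  have hmart : Martingale (fun k => μ[X|𝒢 k]) 𝒢 μ := martingale_condExp X 𝒢 μ
  have hsub : Submartingale (fun k => μ[X|𝒢 k] ⊔ -μ[X|𝒢 k]) 𝒢 μ :=
    hmart.submartingale.sup hmart.neg.submartingale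
  have hnonneg : 0 ≤ fun k => μ[X|𝒢 k] ⊔ -μ[X|𝒢 k] := fun k ω => by
    simp only [Pi.zero_apply, Pi.sup_apply, Pi.neg_apply]
    exact abs_nonneg _
  have hmax := maximal_ineq hsub hnonneg (ε := l.toNNReal) (2 ^ n)
  set S : Set Ω := {ω | ENNReal.ofReal l ≤ gridSup T n fun t => ‖(μ[X|F t]) ω‖ₑ} with hS
  have hSeq : {ω | ((l.toNNReal : ℝ≥0) : ℝ) ≤ (Finset.range (2 ^ n + 1)).sup'
      Finset.nonempty_range_add_one fun k => (μ[X|𝒢 k] ⊔ -μ[X|𝒢 k]) ω} = S := by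
    ext ω
    rw [hS, mem_ofPred_eq, mem_ofPred_eq, Real.coe_toNNReal _ hl.le, Finset.le_sup'_iff]
    have h1 : ∀ k ≤ 2 ^ n, (l ≤ (μ[X|𝒢 k] ⊔ -μ[X|𝒢 k]) ω ↔
        ENNReal.ofReal l ≤ ‖(μ[X|F (gridPt T n k)]) ω‖ₑ) := by
      intro k hk
      have h2 : (μ[X|𝒢 k] ⊔ -μ[X|𝒢 k]) ω = |(μ[X|F (gridPt T n k)]) ω| := by
        have h3 : τ k = gridPt T n k := by simp only [hτ, min_eq_left hk]
        have h4 : 𝒢 k = F (gridPt T n k) := by rw [← h3]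
        rw [h4]
        rfl
      rw [h2, Real.enorm_eq_ofReal_abs, ENNReal.ofReal_le_ofReal_iff (abs_nonneg _)]
    constructor
    · rintro ⟨k, hk, hle⟩
      have hk' : k ≤ 2 ^ n := by simpa [Nat.lt_succ_iff] using hk
      exact ((h1 k hk').1 hle).trans (le_gridSup T (fun t => ‖(μ[X|F t]) ω‖ₑ) hk')
    · intro hle
      by_contra hcon
      push Not at hcon
      have h5 : gridSup T n (fun t => ‖(μ[X|F t]) ω‖ₑ) < ENNReal.ofReal l := by
        rw [gridSup, ← Finset.sup_eq_iSup, Finset.sup_lt_iff (by simpa using hl)]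
        intro k hk
        have hk' : k ≤ 2 ^ n := by simpa [Nat.lt_succ_iff] using hk
        exact not_le.1 fun h6 => absurd ((h1 k hk').2 h6) (not_le.2 (hcon k hk))
      exact absurd hle (not_le.2 h5)
  rw [hSeq] at hmax
  have hSm' : MeasurableSet[𝒢 (2 ^ n)] S := by
    have h1 : Measurable[𝒢 (2 ^ n)] fun ω => gridSup T n fun t => ‖(μ[X|F t]) ω‖ₑ := by
      refine measurable_gridSup _ fun k hk => ?_
      have hk' : k ≤ 2 ^ n := by simpa [Nat.lt_succ_iff] using hk
      have h3 : F (gridPt T n k) ≤ 𝒢 (2 ^ n) := by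
        have h4 : τ k = gridPt T n k := by simp only [hτ, min_eq_left hk']
        rw [← h4]
        exact 𝒢.mono hk'
      exact measurable_enorm.comp (stronglyMeasurable_condExp.mono h3).measurable
    exact h1 measurableSet_Ici
  have hSm : MeasurableSet S := 𝒢.le _ S hSm'
  refine ⟨S, rfl, hSm, hmax.trans ?_⟩
  rw [← ofReal_integral_norm_eq_lintegral_enorm hX.integrableOn]
  exact ENNReal.ofReal_le_ofReal (setIntegral_abs_condExp_le hSm' X)

theorem meas_gridSup_le [IsProbabilityMeasure μ] (hT : 0 ≤ T)
    (hF : ∀ s ∈ Icc 0 T, ∀ t ∈ Icc s T, F s ≤ F t)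
    (hFm : ∀ t ∈ Icc 0 T, F t ≤ (inferInstance : MeasurableSpace Ω)) {X : Ω → ℝ}
    {r x : ℝ} (hr : 1 ≤ r) (hX : MemLp X (ENNReal.ofReal r) μ) (hx : 0 < x)
    (hXx : eLpNorm X (ENNReal.ofReal r) μ ≤ ENNReal.ofReal x) (n : ℕ) {l : ℝ} (hl : 0 < l) :
    μ {ω | ENNReal.ofReal l ≤ gridSup T n fun t => ‖(μ[X|F t]) ω‖ₑ}
      ≤ ENNReal.ofReal (x ^ r * l ^ (-r)) := by
  have hr1 : (1 : ℝ≥0∞) ≤ ENNReal.ofReal r := by simpa using hr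
  obtain ⟨S, hS, hSm, hSl⟩ := mul_meas_gridSup_le hT hF hFm (hX.integrable hr1) n hl
  rw [← hS]
  have h1 : ∫⁻ ω in S, ‖X ω‖ₑ ∂μ ≤ ENNReal.ofReal x * μ S ^ (1 - 1 / r) := by
    have h2 := eLpNorm_le_eLpNorm_mul_rpow_measure_univ hr1
      (hX.aestronglyMeasurable.restrict (s := S))
    rw [eLpNorm_one_eq_lintegral_enorm, Measure.restrict_apply_univ, ENNReal.toReal_one,
      ENNReal.toReal_ofReal (by linarith), div_one] at h2
    refine h2.trans (mul_le_mul_left ?_ _)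
    exact (eLpNorm_mono_measure _ Measure.restrict_le_self).trans hXx
  have h2 := hSl.trans h1
  rcases eq_or_ne (μ S) 0 with h0 | h0
  · rw [h0]; exact zero_le
  have hfin : μ S ≠ ∞ := measure_ne_top _ _
  have h3 : ENNReal.ofReal l * μ S ^ (1 / r) ≤ ENNReal.ofReal x := by
    have h4 : μ S = μ S ^ (1 / r) * μ S ^ (1 - 1 / r) := by
      rw [← ENNReal.rpow_add _ _ h0 hfin]; simp
    rw [h4, ← mul_assoc, ← h4] at h2
    refine (ENNReal.mul_le_mul_iff_left (c := μ S ^ (1 - 1 / r)) ?_ ?_).1 h2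
    · exact (ENNReal.rpow_pos (pos_iff_ne_zero.2 h0) hfin).ne'
    · exact ENNReal.rpow_ne_top_of_nonneg (by
        have : 1 / r ≤ 1 := by rw [div_le_one (by linarith)]; exact hr
        linarith) hfin
  have h5 : μ S ^ (1 / r) ≤ ENNReal.ofReal (x / l) := by
    rw [ENNReal.ofReal_div_of_pos hl, ENNReal.le_div_iff_mul_le (by simp [hl]) (by simp), mul_comm]
    exact h3
  have h6 : (μ S ^ (1 / r)) ^ r ≤ ENNReal.ofReal (x / l) ^ r :=
    ENNReal.rpow_le_rpow h5 (by linarith)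
  rw [← ENNReal.rpow_mul, one_div_mul_cancel (by linarith), ENNReal.rpow_one,
    ENNReal.ofReal_rpow_of_pos (by positivity), Real.div_rpow hx.le hl.le] at h6
  rwa [Real.rpow_neg hl.le, ← div_eq_mul_inv]

/-- The maximal function of a closed martingale is controlled in `Lᵖ`, on grids, by the `Lʳ` norm
of the terminal value, for `p < r`. -/
theorem lintegral_gridSup_condExp_le [IsProbabilityMeasure μ] (hT : 0 ≤ T)
    (hF : ∀ s ∈ Icc 0 T, ∀ t ∈ Icc s T, F s ≤ F t)
    (hFm : ∀ t ∈ Icc 0 T, F t ≤ (inferInstance : MeasurableSpace Ω)) {X : Ω → ℝ}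
    {p r x : ℝ} (hp : 0 < p) (hpr : p < r) (hr : 1 ≤ r) (hX : MemLp X (ENNReal.ofReal r) μ)
    (hx : 0 < x) (hXx : eLpNorm X (ENNReal.ofReal r) μ ≤ ENNReal.ofReal x) (n : ℕ) :
    ∫⁻ ω, gridSup T n (fun t => ‖(μ[X|F t]) ω‖ₑ ^ p) ∂μ
      ≤ ENNReal.ofReal (r / (r - p) * x ^ p) := by
  set f : Ω → ℝ≥0∞ := fun ω => gridSup T n fun t => ‖(μ[X|F t]) ω‖ₑ with hf
  have hftop : ∀ ω, f ω ≠ ∞ := by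
    intro ω
    simp only [hf, gridSup, ← Finset.sup_eq_iSup]
    refine (Finset.sup_lt_iff (by simp)).2 (fun k _ => ?_) |>.ne
    exact enorm_lt_top
  have hfm : AEMeasurable f μ := aemeasurable_gridSup hT n fun t ht =>
    (stronglyMeasurable_condExp.mono (hFm t ht)).measurable.enorm.aemeasurable
  have e1 : ∀ ω, gridSup T n (fun t => ‖(μ[X|F t]) ω‖ₑ ^ p)
      = ENNReal.ofReal ((f ω).toReal ^ p) := by
    intro ω
    rw [← ENNReal.ofReal_rpow_of_nonneg ENNReal.toReal_nonneg hp.le,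
      ENNReal.ofReal_toReal (hftop ω)]
    simp only [hf, gridSup, ← Finset.sup_eq_iSup]
    exact (Finset.apply_sup_eq_sup_comp_of_linearOrder (fun y : ℝ≥0∞ => y ^ p)
      (ENNReal.monotone_rpow_of_nonneg hp.le) (by simp [hp])).symm
  simp only [e1]
  refine lintegral_rpow_le_of_weak (fun ω => ENNReal.toReal_nonneg) hfm.ennreal_toReal hp hpr hx
    fun t ht => ?_
  refine le_trans (measure_mono fun ω hω => ?_) (meas_gridSup_le hT hF hFm hr hX hx hXx n ht)
  exact (ENNReal.ofReal_le_iff_le_toReal (hftop ω)).2 hω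

end Doob

end FracBSDE

/-! ### Chaining -/

namespace FracBSDE

variable {Ω : Type*} [MeasurableSpace Ω] {μ : Measure Ω}

theorem eLpNorm_ofReal_rpow {E : Type*} [ENorm E] (f : Ω → E) {p : ℝ} (hp : 0 < p) :
    eLpNorm f (ENNReal.ofReal p) μ ^ p = ∫⁻ ω, ‖f ω‖ₑ ^ p ∂μ := by
  rw [eLpNorm_eq_lintegral_rpow_enorm_toReal (by simpa using hp) ENNReal.ofReal_ne_top,
    ENNReal.toReal_ofReal hp.le, ← ENNReal.rpow_mul, one_div_mul_cancel hp.ne', ENNReal.rpow_one]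

theorem eLpNorm_le_iff_lintegral {E : Type*} [ENorm E] (f : Ω → E) {p : ℝ} (hp : 0 < p)
    (c : ℝ≥0∞) : eLpNorm f (ENNReal.ofReal p) μ ≤ c ↔ ∫⁻ ω, ‖f ω‖ₑ ^ p ∂μ ≤ c ^ p := by
  rw [← eLpNorm_ofReal_rpow f hp, ENNReal.rpow_le_rpow_iff hp]

/-- The largest increment over an interval of the dyadic grid of level `n`. -/
noncomputable def gridInc (T : ℝ) (n : ℕ) (u : ℝ → ℝ) : ℝ≥0∞ :=
  ⨆ i ∈ Finset.range (2 ^ n), ‖u (gridPt T n (i + 1)) - u (gridPt T n i)‖ₑ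

theorem gridSup_succ_le (T : ℝ) (n : ℕ) (u : ℝ → ℝ) :
    gridSup T (n + 1) (fun t => ‖u t‖ₑ) ≤ gridSup T n (fun t => ‖u t‖ₑ) + gridInc T (n + 1) u := by
  refine iSup₂_le fun k hk => ?_
  have hk' : k ≤ 2 ^ n * 2 := by
    rw [← pow_succ]; simpa [Nat.lt_succ_iff] using hk
  rcases Nat.even_or_odd' k with ⟨j, rfl | rfl⟩
  · rw [gridPt_succ_two_mul]
    exact (le_gridSup T (fun t => ‖u t‖ₑ) (by omega)).trans le_self_add
  · have h1 : ‖u (gridPt T (n + 1) (2 * j))‖ₑ ≤ gridSup T n fun t => ‖u t‖ₑ := by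
      rw [gridPt_succ_two_mul]
      exact le_gridSup T (fun t => ‖u t‖ₑ) (by omega)
    have h2 : ‖u (gridPt T (n + 1) (2 * j + 1)) - u (gridPt T (n + 1) (2 * j))‖ₑ
        ≤ gridInc T (n + 1) u :=
      le_iSup₂_of_le (f := fun i _ => ‖u (gridPt T (n + 1) (i + 1)) - u (gridPt T (n + 1) i)‖ₑ)
        (2 * j) (by rw [Finset.mem_range, pow_succ]; omega) le_rfl
    calc ‖u (gridPt T (n + 1) (2 * j + 1))‖ₑ
        = ‖u (gridPt T (n + 1) (2 * j))
            + (u (gridPt T (n + 1) (2 * j + 1)) - u (gridPt T (n + 1) (2 * j)))‖ₑ := by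
          rw [add_sub_cancel]
      _ ≤ _ := (enorm_add_le _ _).trans (add_le_add h1 h2)

theorem gridSup_le_add_sum (T : ℝ) (m j : ℕ) (u : ℝ → ℝ) :
    gridSup T (m + j) (fun t => ‖u t‖ₑ) ≤ gridSup T m (fun t => ‖u t‖ₑ)
      + ∑ i ∈ Finset.range j, gridInc T (m + i + 1) u := by
  induction j with
  | zero => simp
  | succ j ih =>
    rw [Finset.sum_range_succ, ← add_assoc (gridSup T m _)]
    exact (gridSup_succ_le T (m + j) u).trans (add_le_add_left ih _)

theorem eLpNorm_biSup_le {ι : Type*} (s : Finset ι) {p : ℝ} (hp : 0 < p) {f : ι → Ω → ℝ≥0∞}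
    (hf : ∀ i ∈ s, AEMeasurable (f i) μ) {c : ℝ≥0∞}
    (hc : ∀ i ∈ s, eLpNorm (f i) (ENNReal.ofReal p) μ ≤ c) :
    eLpNorm (fun ω => ⨆ i ∈ s, f i ω) (ENNReal.ofReal p) μ ≤ (s.card : ℝ≥0∞) ^ (1 / p) * c := by
  rw [eLpNorm_le_iff_lintegral _ hp, ENNReal.mul_rpow_of_nonneg _ _ hp.le, ← ENNReal.rpow_mul,
    one_div_mul_cancel hp.ne', ENNReal.rpow_one]
  calc ∫⁻ ω, ‖⨆ i ∈ s, f i ω‖ₑ ^ p ∂μ ≤ ∫⁻ ω, ∑ i ∈ s, ‖f i ω‖ₑ ^ p ∂μ := by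
        refine lintegral_mono fun ω => ?_
        simp only [enorm_eq_self]
        rw [← Finset.sup_eq_iSup, Finset.apply_sup_eq_sup_comp_of_linearOrder
          (fun y : ℝ≥0∞ => y ^ p) (ENNReal.monotone_rpow_of_nonneg hp.le) (by simp [hp])]
        refine Finset.sup_le fun i hi => ?_
        exact Finset.single_le_sum (f := fun i => f i ω ^ p) (fun _ _ => zero_le) hi
    _ = ∑ i ∈ s, ∫⁻ ω, ‖f i ω‖ₑ ^ p ∂μ :=
        lintegral_finsetSum' _ fun i hi => (hf i hi).enorm.pow_const p
    _ ≤ ∑ _i ∈ s, c ^ p :=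
        Finset.sum_le_sum fun i hi => (eLpNorm_le_iff_lintegral _ hp c).1 (hc i hi)
    _ = _ := by rw [Finset.sum_const, nsmul_eq_mul]

theorem eLpNorm_gridInc_le {T : ℝ} (hT : 0 < T) {C p H : ℝ} (hp : 0 < p)
    {U : ℝ → Ω → ℝ}
    (hU : ∀ t ∈ Icc 0 T, AEStronglyMeasurable (U t) μ)
    (hinc : ∀ s ∈ Icc 0 T, ∀ t ∈ Icc s T,
      eLpNorm (U t - U s) (ENNReal.ofReal p) μ ≤ ENNReal.ofReal (C * (t - s) ^ H)) (n : ℕ) :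
    AEMeasurable (fun ω => gridInc T n fun t => U t ω) μ ∧
    eLpNorm (fun ω => gridInc T n fun t => U t ω) (ENNReal.ofReal p) μ
      ≤ ENNReal.ofReal (C * T ^ H * (2 ^ (1 / p - H) : ℝ) ^ n) := by
  have hmem : ∀ i ∈ Finset.range (2 ^ n), i ≤ 2 ^ n ∧ i + 1 ≤ 2 ^ n := fun i hi => by
    rw [Finset.mem_range] at hi; omega
  have hmeas : ∀ i ∈ Finset.range (2 ^ n),
      AEMeasurable (fun ω => ‖U (gridPt T n (i + 1)) ω - U (gridPt T n i) ω‖ₑ) μ := fun i hi =>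
    ((hU _ (gridPt_mem hT.le (hmem i hi).2)).sub
      (hU _ (gridPt_mem hT.le (hmem i hi).1))).enorm
  refine ⟨AEMeasurable.biSup _ (Finset.countable_toSet _) hmeas, ?_⟩
  refine (eLpNorm_biSup_le _ hp hmeas (c := ENNReal.ofReal (C * (T / 2 ^ n) ^ H))
    fun i hi => ?_).trans (le_of_eq ?_)
  · have h1 := hinc _ (gridPt_mem hT.le (hmem i hi).1) (gridPt T n (i + 1))
      ⟨gridPt_mono hT.le n (Nat.le_succ i), (gridPt_mem hT.le (hmem i hi).2).2⟩
    have h2 : gridPt T n (i + 1) - gridPt T n i = T / 2 ^ n := by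
      simp only [gridPt]; push_cast; ring
    rw [h2] at h1
    rw [eLpNorm_enorm (fun ω => U (gridPt T n (i + 1)) ω - U (gridPt T n i) ω)]
    exact h1
  · rw [Finset.card_range, Nat.cast_pow, Nat.cast_ofNat,
      show ((2 : ℝ≥0∞) ^ n) = ENNReal.ofReal (2 ^ n) by
        rw [ENNReal.ofReal_pow (by norm_num)]; simp,
      ENNReal.ofReal_rpow_of_pos (by positivity), ← ENNReal.ofReal_mul (by positivity)]
    congr 1
    rw [Real.div_rpow hT.le (by positivity), ← Real.rpow_natCast, ← Real.rpow_natCast,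
      ← Real.rpow_mul (by norm_num), ← Real.rpow_mul (by norm_num), ← Real.rpow_mul (by norm_num),
      sub_mul, Real.rpow_sub (by norm_num), mul_comm (1 / p), mul_comm H (n : ℝ)]
    ring

/-- Kolmogorov's criterion in quantitative form: the moment of the supremum of a continuous process
is controlled by its values at finitely many times, up to an error that depends only on the moduli
of the increments. -/
theorem exists_supMoment_le {T : ℝ} (hT : 0 < T) {C p H : ℝ} (hC : 0 ≤ C) (hp : 2 ≤ p)
    (hH : 1 / 2 < H) {δ : ℝ} (hδ : 0 < δ) :
    ∃ m : ℕ, ∀ U : ℝ → Ω → ℝ, (∀ t ∈ Icc 0 T, AEStronglyMeasurable (U t) μ) →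
      (∀ᵐ ω ∂μ, ContinuousOn (fun t => U t ω) (Icc 0 T)) →
      (∀ s ∈ Icc 0 T, ∀ t ∈ Icc s T,
        eLpNorm (U t - U s) (ENNReal.ofReal p) μ ≤ ENNReal.ofReal (C * (t - s) ^ H)) →
      supMoment μ T p U ≤ (∑ i ∈ Finset.range (2 ^ m + 1),
        eLpNorm (U (gridPt T m i)) (ENNReal.ofReal p) μ + ENNReal.ofReal δ) ^ p := by
  have hp0 : 0 < p := by linarith
  have hp1 : (1 : ℝ≥0∞) ≤ ENNReal.ofReal p := by rw [ENNReal.one_le_ofReal]; linarith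
  set r : ℝ := 2 ^ (1 / p - H) with hr
  have hr0 : 0 < r := by positivity
  have hr1 : r < 1 := by
    refine Real.rpow_lt_one_of_one_lt_of_neg (by norm_num) ?_
    have : 1 / p ≤ 1 / 2 := one_div_le_one_div_of_le (by norm_num) hp
    linarith
  obtain ⟨m, hmδ⟩ : ∃ m : ℕ, C * T ^ H * (r ^ m * (1 - r)⁻¹) ≤ δ := by
    have h1 : Tendsto (fun m : ℕ => C * T ^ H * (r ^ m * (1 - r)⁻¹)) atTop
        (𝓝 (C * T ^ H * (0 * (1 - r)⁻¹))) :=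
      ((tendsto_pow_atTop_nhds_zero_of_lt_one hr0.le hr1).mul_const _).const_mul _
    rw [zero_mul, mul_zero] at h1
    exact ((h1.eventually_lt_const hδ).exists).imp fun m hm => hm.le
  refine ⟨m, fun U hU hUc hinc => ?_⟩
  have hg := fun n => eLpNorm_gridInc_le hT hp0 hU hinc n
  refine supMoment_le_of_gridSup hT hUc (fun t ht => (hU t ht).aemeasurable) fun N => ?_
  have hpow : ∀ ω, gridSup T N (fun t => ‖U t ω‖ₑ ^ p)
      = ‖gridSup T N (fun t => ‖U t ω‖ₑ)‖ₑ ^ p := by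
    intro ω
    simp only [enorm_eq_self, gridSup, ← Finset.sup_eq_iSup]
    exact (Finset.apply_sup_eq_sup_comp_of_linearOrder (fun y : ℝ≥0∞ => y ^ p)
      (ENNReal.monotone_rpow_of_nonneg hp0.le) (by simp [hp0])).symm
  simp only [hpow]
  rw [← eLpNorm_le_iff_lintegral _ hp0]
  have hm1 : AEMeasurable (fun ω => ∑ i ∈ Finset.range (2 ^ m + 1), ‖U (gridPt T m i) ω‖ₑ) μ :=
    Finset.aemeasurable_fun_sum _ fun i hi =>
      (hU _ (gridPt_mem hT.le (by simpa [Nat.lt_succ_iff] using hi))).enorm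
  have hm2 : AEMeasurable (fun ω => ∑ i ∈ Finset.range N, gridInc T (m + i + 1)
      fun t => U t ω) μ := Finset.aemeasurable_fun_sum _ fun i _ => (hg _).1
  calc eLpNorm (fun ω => gridSup T N fun t => ‖U t ω‖ₑ) (ENNReal.ofReal p) μ
      ≤ eLpNorm ((fun ω => ∑ i ∈ Finset.range (2 ^ m + 1), ‖U (gridPt T m i) ω‖ₑ)
          + fun ω => ∑ i ∈ Finset.range N, gridInc T (m + i + 1) fun t => U t ω)
          (ENNReal.ofReal p) μ := by
        refine eLpNorm_mono_enorm fun ω => ?_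
        simp only [enorm_eq_self, Pi.add_apply]
        refine (gridSup_mono T _ (Nat.le_add_left N m)).trans
          ((gridSup_le_add_sum T m N fun t => U t ω).trans (add_le_add_left ?_ _))
        exact iSup₂_le fun i hi => Finset.single_le_sum
          (f := fun i => ‖U (gridPt T m i) ω‖ₑ) (fun _ _ => zero_le) hi
    _ ≤ _ := eLpNorm_add_le hm1.aestronglyMeasurable hm2.aestronglyMeasurable hp1
    _ ≤ _ := by
        refine add_le_add ?_ ?_
        · have h3 := eLpNorm_sum_le (μ := μ) (s := Finset.range (2 ^ m + 1)) (p := ENNReal.ofReal p)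
            (f := fun i ω => ‖U (gridPt T m i) ω‖ₑ) (fun i hi =>
              (hU _ (gridPt_mem hT.le (by simpa [Nat.lt_succ_iff] using hi))).enorm.aestronglyMeasurable) hp1
          simp only [eLpNorm_enorm] at h3
          have h4 : (∑ i ∈ Finset.range (2 ^ m + 1), fun ω => ‖U (gridPt T m i) ω‖ₑ)
              = fun ω => ∑ i ∈ Finset.range (2 ^ m + 1), ‖U (gridPt T m i) ω‖ₑ := by
            ext ω; simp
          rwa [h4] at h3
        · have h3 := eLpNorm_sum_le (μ := μ) (s := Finset.range N) (p := ENNReal.ofReal p)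
            (f := fun i ω => gridInc T (m + i + 1) fun t => U t ω)
              (fun i _ => (hg _).1.aestronglyMeasurable) hp1
          have h4 : (∑ i ∈ Finset.range N, fun ω => gridInc T (m + i + 1) fun t => U t ω)
              = fun ω => ∑ i ∈ Finset.range N, gridInc T (m + i + 1) fun t => U t ω := by
            ext ω; simp
          rw [h4] at h3
          refine h3.trans ((Finset.sum_le_sum fun i _ => (hg _).2).trans ?_)
          rw [← ENNReal.ofReal_sum_of_nonneg fun i _ => by positivity]
          refine ENNReal.ofReal_le_ofReal (le_trans ?_ hmδ)
          rw [← Finset.mul_sum]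
          have hTH : 0 ≤ C * T ^ H := by positivity
          refine mul_le_mul_of_nonneg_left ?_ hTH
          calc ∑ i ∈ Finset.range N, r ^ (m + i + 1)
              ≤ ∑ i ∈ Finset.range N, r ^ m * r ^ i := by
                refine Finset.sum_le_sum fun i _ => ?_
                rw [← pow_add]
                exact pow_le_pow_of_le_one hr0.le hr1.le (Nat.le_succ _)
            _ = r ^ m * ∑ i ∈ Finset.range N, r ^ i := (Finset.mul_sum _ _ _).symm
            _ ≤ r ^ m * (1 - r)⁻¹ := by
                refine mul_le_mul_of_nonneg_left ?_ (by positivity)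
                rw [← tsum_geometric_of_lt_one hr0.le hr1]
                exact (summable_geometric_of_lt_one hr0.le hr1).sum_le_tsum _
                  fun i _ => by positivity

end FracBSDE

/-! ### Uniform limits of continuous processes -/

namespace FracBSDE

variable {Ω : Type*} [MeasurableSpace Ω] {μ : Measure Ω} {T : ℝ}

/-- If successive differences of continuous processes are small in `Lᵖ`, uniformly in time, the
processes converge uniformly on `[0, T]`, almost surely. -/
theorem ae_tendstoUniformlyOn (hT : 0 < T) {p : ℝ} (hp : 0 < p) {Z : ℕ → ℝ → Ω → ℝ}
    (hc : ∀ n, ∀ᵐ ω ∂μ, ContinuousOn (fun t => Z n t ω) (Icc 0 T))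
    (hm : ∀ n, ∀ t ∈ Icc 0 T, AEMeasurable (Z n t) μ)
    (h : ∀ n, supMoment μ T p (fun t ω => Z (n + 1) t ω - Z n t ω)
      ≤ ENNReal.ofReal ((1 / 4) ^ n) ^ p) :
    ∀ᵐ ω ∂μ, ∃ z : ℝ → ℝ, TendstoUniformlyOn (fun n t => Z n t ω) z atTop (Icc 0 T) := by
  set D : ℕ → Ω → ℝ≥0∞ := fun n ω => ⨆ t ∈ Icc 0 T, ‖Z (n + 1) t ω - Z n t ω‖ₑ ^ p with hD
  have hDm : ∀ n, AEMeasurable (D n) μ := fun n =>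
    aemeasurable_iSup_enorm_rpow (ψ := fun t ω => Z (n + 1) t ω - Z n t ω) hT
      (by filter_upwards [hc n, hc (n + 1)] with ω h1 h2 using h2.sub h1)
      fun t ht => (hm (n + 1) t ht).sub (hm n t ht)
  have hint : ∫⁻ ω, ∑' n, ENNReal.ofReal (2 ^ n) ^ p * D n ω ∂μ ≠ ∞ := by
    rw [lintegral_tsum fun n => (hDm n).const_mul _]
    have h1 : ∀ n, ∫⁻ ω, ENNReal.ofReal (2 ^ n) ^ p * D n ω ∂μ
        ≤ (ENNReal.ofReal ((1 / 2) ^ p)) ^ n := by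
      intro n
      rw [lintegral_const_mul'' _ (hDm n)]
      refine (mul_le_mul_right (h n) _).trans (le_of_eq ?_)
      rw [← ENNReal.mul_rpow_of_nonneg _ _ hp.le, ← ENNReal.ofReal_mul (by positivity),
        ← mul_pow, ← ENNReal.ofReal_pow (by positivity),
        ENNReal.ofReal_rpow_of_nonneg (by positivity) hp.le, ← Real.rpow_natCast,
        ← Real.rpow_natCast, ← Real.rpow_mul (by positivity), ← Real.rpow_mul (by positivity),
        mul_comm p]
      norm_num
    refine ne_top_of_le_ne_top ?_ (ENNReal.tsum_le_tsum h1)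
    rw [ENNReal.tsum_geometric]
    simp only [ne_eq, ENNReal.inv_eq_top, tsub_eq_zero_iff_le, not_le, ENNReal.ofReal_lt_one]
    exact Real.rpow_lt_one (by norm_num) (by norm_num) hp
  filter_upwards [ae_lt_top' (AEMeasurable.tsum fun n => (hDm n).const_mul _) hint]
    with ω hω
  have hev : ∀ᶠ n in atTop, ∀ t ∈ Icc 0 T, ‖Z (n + 1) t ω - Z n t ω‖ ≤ (1 / 2) ^ n := by
    have h1 := ENNReal.tendsto_atTop_zero_of_tsum_ne_top hω.ne
    filter_upwards [h1.eventually_le_const zero_lt_one] with n hn t ht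
    have h2 : (ENNReal.ofReal (2 ^ n) * ‖Z (n + 1) t ω - Z n t ω‖ₑ) ^ p ≤ 1 := by
      rw [ENNReal.mul_rpow_of_nonneg _ _ hp.le]
      exact (mul_le_mul_right (le_iSup₂_of_le
        (f := fun t _ => ‖Z (n + 1) t ω - Z n t ω‖ₑ ^ p) t ht le_rfl) _).trans hn
    have h3 : ENNReal.ofReal (2 ^ n) * ‖Z (n + 1) t ω - Z n t ω‖ₑ ≤ 1 := by
      by_contra hcon
      exact absurd h2 (not_le.2 (ENNReal.one_lt_rpow (not_le.1 hcon) hp))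
    rw [← ofReal_norm, ← ENNReal.ofReal_mul (by positivity), ENNReal.ofReal_le_one] at h3
    rw [one_div, inv_pow, inv_eq_one_div, le_div_iff₀ (by positivity), mul_comm]
    exact h3
  have h4 := tendstoUniformlyOn_tsum_nat_eventually
    (summable_geometric_of_lt_one (by norm_num : (0 : ℝ) ≤ 1 / 2) (by norm_num)) hev
  refine ⟨fun t => Z 0 t ω + ∑' n, (Z (n + 1) t ω - Z n t ω), ?_⟩
  have h5 : (fun n t => Z n t ω)
      = fun N t => Z 0 t ω + ∑ n ∈ Finset.range N, (Z (n + 1) t ω - Z n t ω) := by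
    ext N t
    rw [Finset.sum_range_sub (fun n => Z n t ω)]
    ring
  rw [h5, Metric.tendstoUniformlyOn_iff] at *
  intro δ hδ
  filter_upwards [h4 δ hδ] with N hN t ht
  rw [dist_add_left]
  exact hN t ht

section CondExp

variable {F : ℝ → MeasurableSpace Ω}

/-- Maximal inequality for a continuous version of a closed martingale. -/
theorem supMoment_le_of_condExp [IsProbabilityMeasure μ] (hT : 0 < T)
    (hF : ∀ s ∈ Icc 0 T, ∀ t ∈ Icc s T, F s ≤ F t)
    (hFm : ∀ t ∈ Icc 0 T, F t ≤ (inferInstance : MeasurableSpace Ω)) {X : Ω → ℝ}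
    {p r x : ℝ} (hp : 0 < p) (hpr : p < r) (hr : 1 ≤ r) (hX : MemLp X (ENNReal.ofReal r) μ)
    (hx : 0 < x) (hXx : eLpNorm X (ENNReal.ofReal r) μ ≤ ENNReal.ofReal x)
    {Z : ℝ → Ω → ℝ} (hc : ∀ᵐ ω ∂μ, ContinuousOn (fun t => Z t ω) (Icc 0 T))
    (hZ : ∀ t ∈ Icc 0 T, Z t =ᵐ[μ] μ[X|F t]) :
    supMoment μ T p Z ≤ ENNReal.ofReal (r / (r - p) * x ^ p) := by
  refine supMoment_le_of_gridSup hT hc (fun t ht =>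
    (stronglyMeasurable_condExp.mono (hFm t ht)).measurable.aemeasurable.congr (hZ t ht).symm)
    fun n => ?_
  refine le_trans (le_of_eq (lintegral_congr_ae ?_))
    (lintegral_gridSup_condExp_le hT.le hF hFm hp hpr hr hX hx hXx n)
  have h1 : ∀ᵐ ω ∂μ, ∀ k ∈ Finset.range (2 ^ n + 1),
      Z (gridPt T n k) ω = (μ[X|F (gridPt T n k)]) ω :=
    (ae_ball_iff (Finset.countable_toSet _)).2 fun k hk =>
      hZ _ (gridPt_mem hT.le (by simpa [Nat.lt_succ_iff] using hk))
  filter_upwards [h1] with ω hω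
  exact iSup_congr fun k => iSup_congr fun hk => by simp only [hω k hk]

/-- The martingale `t ↦ E[X | F t]` has a version with continuous paths on `[0, T]`. -/
def HasContCondExp (F : ℝ → MeasurableSpace Ω) (μ : Measure Ω) (T : ℝ) (X : Ω → ℝ) : Prop :=
  ∃ Z : ℝ → Ω → ℝ, (∀ᵐ ω ∂μ, ContinuousOn (fun t => Z t ω) (Icc 0 T)) ∧
    ∀ t ∈ Icc 0 T, Z t =ᵐ[μ] μ[X|F t]

namespace HasContCondExp

theorem congr {X Y : Ω → ℝ} (h : HasContCondExp F μ T X) (hXY : X =ᵐ[μ] Y) :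
    HasContCondExp F μ T Y := by
  obtain ⟨Z, hZ, hZX⟩ := h
  exact ⟨Z, hZ, fun t ht => (hZX t ht).trans (condExp_congr_ae hXY)⟩

theorem add {X Y : Ω → ℝ} (hX : HasContCondExp F μ T X) (hY : HasContCondExp F μ T Y)
    (hXi : Integrable X μ) (hYi : Integrable Y μ) : HasContCondExp F μ T (X + Y) := by
  obtain ⟨Z, hZ, hZX⟩ := hX
  obtain ⟨Z', hZ', hZY⟩ := hY
  refine ⟨fun t ω => Z t ω + Z' t ω, ?_, fun t ht => ?_⟩
  · filter_upwards [hZ, hZ'] with ω h1 h2 using h1.add h2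
  · filter_upwards [hZX t ht, hZY t ht, condExp_add hXi hYi (F t)] with ω h1 h2 h3
    rw [h1, h2, h3, Pi.add_apply]

theorem smul {X : Ω → ℝ} (hX : HasContCondExp F μ T X) (c : ℝ) :
    HasContCondExp F μ T (c • X) := by
  obtain ⟨Z, hZ, hZX⟩ := hX
  refine ⟨fun t ω => c * Z t ω, ?_, fun t ht => ?_⟩
  · filter_upwards [hZ] with ω h1 using h1.const_mul c
  · filter_upwards [hZX t ht, condExp_smul c X (F t)] with ω h1 h3
    rw [h1, h3, Pi.smul_apply, smul_eq_mul]

theorem sub {X Y : Ω → ℝ} (hX : HasContCondExp F μ T X) (hY : HasContCondExp F μ T Y)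
    (hXi : Integrable X μ) (hYi : Integrable Y μ) : HasContCondExp F μ T (X - Y) := by
  have h := hX.add (hY.smul (-1)) hXi (hYi.smul (-1))
  rwa [neg_one_smul, ← sub_eq_add_neg] at h

/-- By the maximal inequality, having a continuous version is preserved under limits in `L¹`. -/
theorem of_forall_exists [IsProbabilityMeasure μ] (hT : 0 < T)
    (hF : ∀ s ∈ Icc 0 T, ∀ t ∈ Icc s T, F s ≤ F t)
    (hFm : ∀ t ∈ Icc 0 T, F t ≤ (inferInstance : MeasurableSpace Ω)) {X : Ω → ℝ}
    (hX : Integrable X μ)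
    (h : ∀ δ : ℝ, 0 < δ → ∃ X', Integrable X' μ ∧ HasContCondExp F μ T X' ∧
      eLpNorm (X - X') 1 μ ≤ ENNReal.ofReal δ) : HasContCondExp F μ T X := by
  have hδ : ∀ n : ℕ, 0 < ((1 : ℝ) / 4) ^ n / 8 := fun n => by positivity
  choose X' hX'i hX' hXX' using fun n : ℕ => h _ (hδ n)
  choose Z hZc hZ using hX'
  have hZm : ∀ n, ∀ t ∈ Icc 0 T, AEMeasurable (Z n t) μ := fun n t ht =>
    (stronglyMeasurable_condExp.mono (hFm t ht)).measurable.aemeasurable.congr (hZ n t ht).symm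
  have hsup : ∀ n, supMoment μ T (1 / 2) (fun t ω => Z (n + 1) t ω - Z n t ω)
      ≤ ENNReal.ofReal ((1 / 4) ^ n) ^ ((1 : ℝ) / 2) := by
    intro n
    have hd : eLpNorm (X' (n + 1) - X' n) (ENNReal.ofReal 1) μ
        ≤ ENNReal.ofReal ((1 / 4) ^ n / 4) := by
      have e1 : X' (n + 1) - X' n = (X - X' n) - (X - X' (n + 1)) := by ring
      rw [e1, ENNReal.ofReal_one]
      refine (eLpNorm_sub_le (hX.sub (hX'i n)).aestronglyMeasurable
        (hX.sub (hX'i (n + 1))).aestronglyMeasurable le_rfl).trans ?_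
      refine (add_le_add (hXX' n) (hXX' (n + 1))).trans ?_
      rw [← ENNReal.ofReal_add (hδ n).le (hδ _).le]
      refine ENNReal.ofReal_le_ofReal ?_
      have : (0 : ℝ) ≤ (1 / 4) ^ n := by positivity
      rw [pow_succ]
      linarith
    have h1 := supMoment_le_of_condExp (p := 1 / 2) (r := 1) hT hF hFm (by norm_num) (by norm_num)
      le_rfl (by
        rw [ENNReal.ofReal_one]
        exact memLp_one_iff_integrable.2 ((hX'i (n + 1)).sub (hX'i n)))
      (by positivity : (0 : ℝ) < (1 / 4) ^ n / 4) hd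
      (Z := fun t ω => Z (n + 1) t ω - Z n t ω)
      (by filter_upwards [hZc n, hZc (n + 1)] with ω h1 h2 using h2.sub h1) (fun t ht => by
        filter_upwards [hZ n t ht, hZ (n + 1) t ht, condExp_sub (hX'i (n + 1)) (hX'i n) (F t)]
          with ω h1 h2 h3
        rw [h1, h2, h3, Pi.sub_apply])
    refine h1.trans (le_of_eq ?_)
    rw [ENNReal.ofReal_rpow_of_nonneg (by positivity) (by norm_num), ← Real.sqrt_eq_rpow,
      ← Real.sqrt_eq_rpow, Real.sqrt_div (by positivity),
      show (4 : ℝ) = 2 ^ 2 by norm_num, Real.sqrt_sq (by norm_num)]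
    congr 1
    ring
  have hun := ae_tendstoUniformlyOn hT (by norm_num) hZc hZm hsup
  have hZt : ∀ᵐ ω ∂μ, TendstoUniformlyOn (fun n t => Z n t ω)
      (fun t => limUnder atTop fun n => Z n t ω) atTop (Icc 0 T) := by
    filter_upwards [hun] with ω ⟨z, hz⟩
    exact hz.congr_right fun t ht => (hz.tendsto_at ht).limUnder_eq.symm
  refine ⟨fun t ω => limUnder atTop fun n => Z n t ω, ?_, fun t ht => ?_⟩
  · filter_upwards [hZt, ae_all_iff.2 hZc] with ω h1 h2
    exact h1.continuousOn (Frequently.of_forall h2)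
  · have h1 : TendstoInMeasure μ (fun n => Z n t) atTop fun ω => limUnder atTop fun n => Z n t ω := by
      refine tendstoInMeasure_of_tendsto_ae (fun n => (hZm n t ht).aestronglyMeasurable) ?_
      filter_upwards [hZt] with ω hω using hω.tendsto_at ht
    have h2 : TendstoInMeasure μ (fun n => Z n t) atTop (μ[X|F t]) := by
      refine tendstoInMeasure_of_tendsto_eLpNorm one_ne_zero
        (fun n => (hZm n t ht).aestronglyMeasurable) integrable_condExp.aestronglyMeasurable ?_
      have h3 : ∀ n, eLpNorm (Z n t - μ[X|F t]) 1 μ ≤ ENNReal.ofReal ((1 / 4) ^ n / 8) := by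
        intro n
        have h4 : Z n t - μ[X|F t] =ᵐ[μ] -μ[X - X' n|F t] := by
          filter_upwards [hZ n t ht, condExp_sub hX (hX'i n) (F t)] with ω h5 h6
          rw [Pi.sub_apply, h5, Pi.neg_apply, h6, Pi.sub_apply, neg_sub]
        rw [eLpNorm_congr_ae h4, eLpNorm_neg]
        exact (eLpNorm_condExp_le_eLpNorm _ le_rfl).trans (hXX' n)
      refine tendsto_of_tendsto_of_tendsto_of_le_of_le tendsto_const_nhds ?_ (fun _ => zero_le) h3
      have h5 : Tendsto (fun n : ℕ => ((1 : ℝ) / 4) ^ n / 8) atTop (𝓝 (0 / 8)) :=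
        (tendsto_pow_atTop_nhds_zero_of_lt_one (by norm_num) (by norm_num)).div_const _
      have h6 := (ENNReal.continuous_ofReal.tendsto _).comp h5
      rw [zero_div, ENNReal.ofReal_zero] at h6
      exact h6
    exact tendstoInMeasure_ae_unique h1 h2

end HasContCondExp

end CondExp

end FracBSDE

/-! ### Continuity of the Brownian filtration -/

namespace FracBSDE

open scoped BoundedContinuousFunction

theorem comap_increment_le {Ω : Type*} {d : ℕ} (B : ℝ → Ω → (Fin d → ℝ)) {s t u : ℝ}
    (hs : s ∈ Icc 0 u) (ht : t ∈ Icc 0 u) :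
    MeasurableSpace.comap (fun ω => B t ω - B s ω) inferInstance ≤ brownianSigma B u :=
  ((measurable_brownianSigma B ht).sub (measurable_brownianSigma B hs)).comap_le

/-- The σ-algebra generated by the increments from time `s` to the times in `S`. -/
@[reducible] def incrementSigma {Ω : Type*} {d : ℕ} (B : ℝ → Ω → (Fin d → ℝ)) (s : ℝ)
    (S : Finset ℝ) : MeasurableSpace Ω :=
  ⨆ u ∈ S, MeasurableSpace.comap (fun ω => B u ω - B s ω) inferInstance

theorem measurable_incrementSigma {Ω : Type*} {d : ℕ} (B : ℝ → Ω → (Fin d → ℝ)) (s : ℝ)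
    {S : Finset ℝ} {u : ℝ} (hu : u ∈ S) :
    Measurable[incrementSigma B s S] fun ω => B u ω - B s ω :=
  (comap_measurable (fun ω => B u ω - B s ω)).mono
    (le_iSup₂_of_le (f := fun u (_ : u ∈ S) => MeasurableSpace.comap
      (fun ω => B u ω - B s ω) inferInstance) u hu le_rfl) le_rfl

theorem incrementSigma_le {Ω : Type*} {d : ℕ} (B : ℝ → Ω → (Fin d → ℝ)) {s t : ℝ} {S : Finset ℝ}
    (hs : s ∈ Icc 0 t) (hS : ∀ u ∈ S, u ∈ Icc 0 t) : incrementSigma B s S ≤ brownianSigma B t :=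
  iSup₂_le fun u hu => comap_increment_le B hs (hS u hu)

theorem measurable_pi_mk {Ω ι E : Type*} {m : MeasurableSpace Ω} [MeasurableSpace E]
    {u : Ω → ι → E} (hu : ∀ j, Measurable fun ω => u ω j) : Measurable u :=
  measurable_pi_lambda _ hu

variable {Ω : Type*} [mΩ : MeasurableSpace Ω] {μ : Measure Ω} {T : ℝ} {d : ℕ}
  {B b : ℝ → Ω → (Fin d → ℝ)} {W : ℝ → (Fin d → ℝ) → Ω → ℝ}

/-- A Brownian motion has a version all of whose paths are continuous. -/
theorem IsBrownianOn.exists_continuous_version (hT : 0 ≤ T) (hB : IsBrownianOn T B μ) :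
    ∃ b : ℝ → Ω → (Fin d → ℝ), (∀ ω, Continuous fun t => b t ω) ∧ (∀ t, Measurable (b t)) ∧
      ∀ᵐ ω ∂μ, ∀ t ∈ Icc 0 T, b t ω = B t ω := by
  classical
  set N : Set Ω := toMeasurable μ {ω | ¬ ContinuousOn (fun t => B t ω) (Icc 0 T)} with hN
  have hN0 : μ N = 0 := by rw [hN, measure_toMeasurable]; exact hB.continuous
  refine ⟨fun t => N.piecewise (fun _ => 0) (B (projIcc 0 T hT t)), fun ω => ?_, fun t => ?_, ?_⟩
  · by_cases hω : ω ∈ N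
    · simpa [piecewise, hω] using continuous_const
    · have h1 : ContinuousOn (fun t => B t ω) (Icc 0 T) := by
        by_contra hcon
        exact hω (subset_toMeasurable _ _ hcon)
      simp only [piecewise, hω, if_false]
      exact h1.domRestrict.comp (continuous_projIcc (h := hT))
  · exact Measurable.piecewise (measurableSet_toMeasurable _ _) measurable_const
      (hB.measurable _ (projIcc 0 T hT t).2)
  · filter_upwards [compl_mem_ae_iff.2 hN0] with ω hω t ht
    have h2 : ω ∉ N := hω
    simp [piecewise, h2, projIcc_of_mem hT ht]

theorem IsBrownianOn.brownianSigma_le (hB : IsBrownianOn T B μ) {t : ℝ} (ht : t ≤ T) :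
    brownianSigma B t ≤ mΩ :=
  iSup₂_le fun s hs => (hB.measurable s ⟨hs.1, hs.2.trans ht⟩).comap_le

/-- The increments after time `s` are jointly independent of the past. -/
theorem IsBrownianOn.indep_increments [IsProbabilityMeasure μ] (hB : IsBrownianOn T B μ) {s : ℝ}
    (hs : 0 ≤ s) (hsT : s ≤ T) (S : Finset ℝ) (hS : ∀ u ∈ S, u ∈ Icc s T) :
    Indep (brownianSigma B s)
      (incrementSigma B s S) μ := by
  induction S using Finset.induction_on_max with
  | empty => simpa [incrementSigma] using indep_bot_right (brownianSigma B s)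
  | insert a S ha ih =>
    have hS' : ∀ u ∈ S, u ∈ Icc s T := fun u hu => hS u (Finset.mem_insert_of_mem hu)
    have haT := hS a (Finset.mem_insert_self _ _)
    obtain ⟨t0, ht0, ht0a, hSt0, ht0S⟩ : ∃ t0 ∈ Icc s T, t0 ≤ a ∧ (∀ u ∈ S, u ≤ t0) ∧
        (t0 ∈ S ∨ t0 = s) := by
      rcases S.eq_empty_or_nonempty with rfl | hne
      · exact ⟨s, ⟨le_rfl, hsT⟩, haT.1, by simp, Or.inr rfl⟩
      · exact ⟨S.max' hne, hS' _ (S.max'_mem hne), (ha _ (S.max'_mem hne)).le,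
          fun u hu => S.le_max' u hu, Or.inl (S.max'_mem hne)⟩
    have hle : incrementSigma B s S ≤ brownianSigma B t0 :=
      incrementSigma_le B ⟨hs, ht0.1⟩ fun u hu => ⟨hs.trans (hS' u hu).1, hSt0 u hu⟩
    have h1 := hB.indep_increment t0 a (hs.trans ht0.1) ht0a haT.2
    have h2 : Indep (brownianSigma B s ⊔ incrementSigma B s S)
        (MeasurableSpace.comap (fun ω => B a ω - B t0 ω) inferInstance) μ :=
      indep_of_indep_of_le_left h1 (sup_le (brownianSigma_mono B ht0.1) hle)
    have h3 := indep_sup_right_of_indep_sup (hB.brownianSigma_le hsT)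
      (hle.trans (hB.brownianSigma_le ht0.2))
      ((comap_increment_le B ⟨hs.trans ht0.1, ht0.2⟩ ⟨hs.trans haT.1, haT.2⟩).trans
        (hB.brownianSigma_le le_rfl)) (ih hS') h2
    refine indep_of_indep_of_le_right h3 (iSup₂_le fun u hu => ?_)
    rcases Finset.mem_insert.1 hu with rfl | hu
    · have h4 : Measurable[incrementSigma B s S ⊔
          MeasurableSpace.comap (fun ω => B u ω - B t0 ω) inferInstance]
          fun ω => B u ω - B t0 ω :=
        (comap_measurable (fun ω => B u ω - B t0 ω)).mono le_sup_right le_rfl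
      have h5 : Measurable[incrementSigma B s S ⊔
          MeasurableSpace.comap (fun ω => B u ω - B t0 ω) inferInstance]
          fun ω => B t0 ω - B s ω := by
        rcases ht0S with h | h
        · exact (measurable_incrementSigma B s h).mono le_sup_left le_rfl
        · simp only [h, sub_self]
          exact measurable_const
      have h6 : (fun ω => B u ω - B s ω) = fun ω => (B u ω - B t0 ω) + (B t0 ω - B s ω) := by
        ext ω i; simp
      rw [h6]
      exact (h4.add h5).comap_le
    · exact ((measurable_incrementSigma B s hu).mono le_sup_left le_rfl).comap_le

/-- The increments after time `s` are jointly independent of `F_s`. -/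
theorem IsBrownianOn.indep_sigmaF_increments [IsProbabilityMeasure μ] (hB : IsBrownianOn T B μ)
    (hW : fieldSigma W ≤ mΩ) (hBW : Indep (brownianSigma B T) (fieldSigma W) μ) {s : ℝ}
    (hs : 0 ≤ s) (hsT : s ≤ T) (S : Finset ℝ) (hS : ∀ u ∈ S, u ∈ Icc s T) :
    Indep (sigmaF B W s)
      (incrementSigma B s S) μ := by
  have h1 : incrementSigma B s S ≤ brownianSigma B T :=
    incrementSigma_le B ⟨hs, hsT⟩ fun u hu => ⟨hs.trans (hS u hu).1, (hS u hu).2⟩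
  refine (indep_sup_right_of_indep_sup (h1.trans (hB.brownianSigma_le le_rfl))
    (hB.brownianSigma_le hsT) hW (hB.indep_increments hs hsT S hS).symm ?_).symm
  exact indep_of_indep_of_le_left hBW (sup_le h1 (brownianSigma_mono B hsT))

/-- Conditioning on a σ-algebra that makes `v` known and is independent of `u`. -/
theorem condExp_comp_add_of_indep {Ω E : Type*} {m mΩ : MeasurableSpace Ω} {μ : Measure Ω}
    [IsProbabilityMeasure μ] [AddCommGroup E] [TopologicalSpace E]
    [IsTopologicalAddGroup E] [SecondCountableTopology E] [MeasurableSpace E] [BorelSpace E]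
    (hm : m ≤ mΩ) {u v : Ω → E}
    (hv : Measurable[m] v) (hu : Measurable u)
    (hind : Indep m (MeasurableSpace.comap u inferInstance) μ) {φ : E → ℝ} (hφ : Continuous φ)
    {K : ℝ} (hK : ∀ x, |φ x| ≤ K) :
    μ[fun ω => φ (v ω + u ω)|m] =ᵐ[μ] fun ω => ∫ ω', φ (v ω + u ω') ∂μ := by
  have hv' : Measurable v := hv.mono hm le_rfl
  have hmeas : Measurable fun z : E × E => φ (z.1 + z.2) := hφ.measurable.comp (by fun_prop)
  have hbd : ∀ (f : Ω → ℝ), Measurable f → (∀ ω, |f ω| ≤ K) → Integrable f μ := fun f hf h =>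
    Integrable.of_bound hf.aestronglyMeasurable K (ae_of_all _ h)
  set g : E → ℝ := fun x => ∫ y, φ (x + y) ∂μ.map u with hg
  have hgeq : ∀ x, ∫ ω', φ (x + u ω') ∂μ = g x := fun x =>
    (integral_map hu.aemeasurable
      (hmeas.comp (measurable_const.prodMk measurable_id)).aestronglyMeasurable).symm
  have : IsProbabilityMeasure (μ.map u) := Measure.isProbabilityMeasure_map hu.aemeasurable
  have hgm : Measurable g :=
    (StronglyMeasurable.integral_prod_right (ν := μ.map u) hmeas.stronglyMeasurable).measurable
  have hgK : ∀ x, |g x| ≤ K := fun x => by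
    have h1 := norm_integral_le_of_norm_le_const (μ := μ.map u) (f := fun y => φ (x + y))
      (ae_of_all _ fun y => hK (x + y))
    simpa using h1
  simp only [hgeq]
  refine (ae_eq_condExp_of_forall_setIntegral_eq hm
    (hbd _ (hmeas.comp (hv'.prodMk hu)) fun ω => hK _)
    (fun s _ _ => (hbd _ (hgm.comp hv') fun ω => hgK _).integrableOn) (fun s hs _ => ?_)
    (hgm.comp hv).aestronglyMeasurable).symm
  have hind' : IndepFun (fun ω => (s.indicator (fun _ => (1 : ℝ)) ω, v ω)) u μ := by
    refine indep_of_indep_of_le_left hind (Measurable.comap_le ?_)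
    exact (measurable_const.indicator hs).prodMk hv
  have hp : Measurable fun ω => (s.indicator (fun _ => (1 : ℝ)) ω, v ω) :=
    (measurable_const.indicator (hm s hs)).prodMk hv'
  have hlaw := (indepFun_iff_map_prod_eq_prod_map_map hp.aemeasurable hu.aemeasurable).1 hind'
  set P : Measure (ℝ × E) := μ.map fun ω => (s.indicator (fun _ => (1 : ℝ)) ω, v ω) with hP
  have : IsProbabilityMeasure P := Measure.isProbabilityMeasure_map hp.aemeasurable
  have hψm : Measurable fun z : (ℝ × E) × E => z.1.1 * φ (z.1.2 + z.2) :=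
    (by fun_prop : Measurable fun z : (ℝ × E) × E => z.1.1).mul
      (hmeas.comp (by fun_prop : Measurable fun z : (ℝ × E) × E => (z.1.2, z.2)))
  have hψi : Integrable (fun z : (ℝ × E) × E => z.1.1 * φ (z.1.2 + z.2)) (P.prod (μ.map u)) := by
    rw [← hlaw, integrable_map_measure hψm.aestronglyMeasurable (hp.prodMk hu).aemeasurable]
    refine hbd _ (hψm.comp (hp.prodMk hu)) fun ω => ?_
    simp only [Function.comp, abs_mul]
    by_cases hω : ω ∈ s
    · simpa [hω] using hK (v ω + u ω)
    · simpa [hω] using (abs_nonneg _).trans (hK 0)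
  calc ∫ ω in s, g (v ω) ∂μ
      = ∫ ω, s.indicator (fun _ => (1 : ℝ)) ω * g (v ω) ∂μ := by
        rw [← integral_indicator (hm s hs)]
        refine integral_congr_ae (ae_of_all _ fun ω => ?_)
        by_cases hω : ω ∈ s <;> simp [hω]
    _ = ∫ z, z.1 * g z.2 ∂P := by
        exact (integral_map (f := fun z : ℝ × E => z.1 * g z.2) hp.aemeasurable
          (measurable_fst.mul (hgm.comp measurable_snd)).aestronglyMeasurable).symm
    _ = ∫ z, z.1.1 * φ (z.1.2 + z.2) ∂(P.prod (μ.map u)) := by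
        rw [integral_prod _ hψi]
        simp only [integral_const_mul, hg]
    _ = ∫ ω, s.indicator (fun _ => (1 : ℝ)) ω * φ (v ω + u ω) ∂μ := by
        rw [← hlaw, integral_map (hp.prodMk hu).aemeasurable hψm.aestronglyMeasurable]
    _ = ∫ ω in s, φ (v ω + u ω) ∂μ := by
        rw [← integral_indicator (hm s hs)]
        refine integral_congr_ae (ae_of_all _ fun ω => ?_)
        by_cases hω : ω ∈ s <;> simp [hω]

/-- Bounded continuous functions of finitely many values of the path, times the indicator of an
event of the field, have conditional expectations that depend continuously on time. -/
theorem IsBrownianOn.hasContCondExp_indicator_prod [IsProbabilityMeasure μ] (hT : 0 ≤ T)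
    (hB : IsBrownianOn T B μ) (hW : fieldSigma W ≤ mΩ)
    (hBW : Indep (brownianSigma B T) (fieldSigma W) μ) (S : Finset ℝ) (hS : ∀ u ∈ S, u ∈ Icc 0 T)
    (f : ℝ → (Fin d → ℝ) →ᵇ ℝ) {G : Set Ω} (hG : MeasurableSet[fieldSigma W] G) :
    HasContCondExp (sigmaF B W) μ T (G.indicator fun ω => ∏ j ∈ S, f j (B j ω)) := by
  obtain ⟨b, hbc, hbm, hbB⟩ := hB.exists_continuous_version hT
  set φ : (S → Fin d → ℝ) → ℝ := fun x => ∏ j : S, f j (x j) with hφ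
  have hφc : Continuous φ := continuous_finsetProd _ fun j _ => (f j).continuous.comp (by fun_prop)
  set K : ℝ := ∏ j : S, ‖f j‖ with hK
  have hφK : ∀ x, |φ x| ≤ K := fun x => by
    rw [hφ, Finset.abs_prod]
    exact Finset.prod_le_prod (fun _ _ => abs_nonneg _) fun j _ => (f j).norm_coe_le_norm _
  refine ⟨fun t => G.indicator fun ω =>
    ∫ ω', φ (fun j : S => b (min j t) ω + (b j ω' - b (min j t) ω')) ∂μ, ae_of_all _ fun ω => ?_,
    fun t ht => ?_⟩
  · refine Continuous.continuousOn ?_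
    by_cases hω : ω ∈ G
    · simp only [hω, indicator_of_mem]
      refine continuous_of_dominated (bound := fun _ => K) (fun t => ?_)
        (fun t => ae_of_all _ fun ω' => hφK _) (integrable_const K) (ae_of_all _ fun ω' => ?_)
      · refine (hφc.measurable.comp (measurable_pi_lambda _ fun j => ?_)).aestronglyMeasurable
        exact ((hbm _).sub (hbm _)).const_add _
      · refine hφc.comp (continuous_pi fun j => ?_)
        have h1 : ∀ ω, Continuous fun t : ℝ => b (min j t) ω := fun ω =>
          (hbc ω).comp (by fun_prop : Continuous fun t : ℝ => min (j : ℝ) t)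
        exact (h1 ω).add (continuous_const.sub (h1 ω'))
    · simp only [hω, not_false_eq_true, indicator_of_notMem]
      exact continuous_const
  · have hmin : ∀ j : S, min (j : ℝ) t ∈ Icc 0 t := fun j =>
      ⟨le_min (hS j j.2).1 ht.1, min_le_right _ _⟩
    have hminT : ∀ j : S, min (j : ℝ) t ∈ Icc 0 T := fun j =>
      ⟨(hmin j).1, (hmin j).2.trans ht.2⟩
    set v : Ω → (S → Fin d → ℝ) := fun ω j => B (min j t) ω with hv
    set u : Ω → (S → Fin d → ℝ) := fun ω j => B j ω - B (min j t) ω with hu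
    have hle : sigmaF B W t ≤ mΩ := sup_le (hB.brownianSigma_le ht.2) hW
    have hvm : Measurable[sigmaF B W t] v := measurable_pi_mk fun j =>
      (measurable_brownianSigma B (hmin j)).mono le_sup_left le_rfl
    have hum : Measurable u := measurable_pi_lambda _ fun j =>
      (hB.measurable _ (hS j j.2)).sub (hB.measurable _ (hminT j))
    have hind : Indep (sigmaF B W t) (MeasurableSpace.comap u inferInstance) μ := by
      have h1 := hB.indep_sigmaF_increments hW hBW ht.1 ht.2 (S.image fun j => max j t)
        (by
          intro r hr
          obtain ⟨j, hj, rfl⟩ := Finset.mem_image.1 hr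
          exact ⟨le_max_right _ _, max_le (hS j hj).2 ht.2⟩)
      refine indep_of_indep_of_le_right h1 (Measurable.comap_le ?_)
      refine measurable_pi_mk fun j => ?_
      have h2 : (fun ω => u ω j) = fun ω => B (max j t) ω - B t ω := by
        ext1 ω
        rcases le_total (j : ℝ) t with h | h
        · simp [hu, h]
        · simp [hu, h]
      rw [h2]
      exact measurable_incrementSigma B t (Finset.mem_image_of_mem _ j.2)
    have hsum : (fun ω => ∏ j ∈ S, f j (B j ω)) = fun ω => φ (v ω + u ω) := by
      ext ω
      simp only [hφ, hv, hu, Pi.add_apply, add_sub_cancel]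
      exact (Finset.prod_coe_sort S fun j => f j (B j ω)).symm
    have hint : Integrable (fun ω => φ (v ω + u ω)) μ :=
      Integrable.of_bound (hφc.measurable.comp ((hvm.mono hle le_rfl).add hum)).aestronglyMeasurable
        K (ae_of_all _ fun ω => hφK _)
    rw [hsum]
    refine EventuallyEq.trans ?_
      (condExp_indicator hint ((le_sup_right : fieldSigma W ≤ sigmaF B W t) G hG)).symm
    filter_upwards [hbB, condExp_comp_add_of_indep hle hvm hum hind hφc hφK] with ω h1 h2
    have h3 : ∫ ω', φ (fun j : S => b (min j t) ω + (b j ω' - b (min j t) ω')) ∂μ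
        = ∫ ω', φ (v ω + u ω') ∂μ := by
      refine integral_congr_ae ?_
      filter_upwards [hbB] with ω' h4
      congr 1
      ext1 j
      simp only [hv, hu, Pi.add_apply, h1 _ (hminT j), h4 _ (hminT j), h4 _ (hS j j.2)]
    by_cases hω : ω ∈ G
    · simp only [hω, indicator_of_mem]
      exact h3.trans h2.symm
    · simp [hω]

end FracBSDE

/-! ### Continuous versions of closed martingales -/

namespace FracBSDE

open scoped BoundedContinuousFunction

section Closure

variable {Ω : Type*} [mΩ : MeasurableSpace Ω] {μ : Measure Ω} [IsProbabilityMeasure μ] {T : ℝ}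
  {F : ℝ → MeasurableSpace Ω}

namespace HasContCondExp

/-- Bounded pointwise limits inherit continuous conditional expectations: by the maximal inequality
the continuous versions converge uniformly in time. -/
theorem of_tendsto_of_bounded (hT : 0 < T)
    (hF : ∀ s ∈ Icc 0 T, ∀ t ∈ Icc s T, F s ≤ F t)
    (hFm : ∀ t ∈ Icc 0 T, F t ≤ mΩ) {X : Ω → ℝ} {X' : ℕ → Ω → ℝ}
    (hX' : ∀ n, HasContCondExp F μ T (X' n)) (hm : ∀ n, AEStronglyMeasurable (X' n) μ)
    (hbd : ∀ n ω, |X' n ω| ≤ 1) (hlim : ∀ ω, Tendsto (fun n => X' n ω) atTop (𝓝 (X ω))) :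
    HasContCondExp F μ T X := by
  have hXm : AEStronglyMeasurable X μ :=
    aestronglyMeasurable_of_tendsto_ae atTop hm (ae_of_all _ hlim)
  have hXbd : ∀ ω, |X ω| ≤ 1 := fun ω =>
    le_of_tendsto (hlim ω).abs (Eventually.of_forall fun n => hbd n ω)
  refine of_forall_exists hT hF hFm (Integrable.of_bound hXm 1 (ae_of_all _ hXbd)) fun δ hδ => ?_
  have h1 : Tendsto (fun n => ∫⁻ ω, ‖X ω - X' n ω‖ₑ ∂μ) atTop (𝓝 (∫⁻ _, 0 ∂μ)) := by
    refine tendsto_lintegral_of_dominated_convergence' (fun _ => ENNReal.ofReal 2)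
      (fun n => (hXm.sub (hm n)).enorm) (fun n => ae_of_all _ fun ω => ?_) (by simp)
      (ae_of_all _ fun ω => ?_)
    · have h2 : |X ω - X' n ω| ≤ 2 := (abs_sub _ _).trans (by linarith [hXbd ω, hbd n ω])
      calc ‖X ω - X' n ω‖ₑ = ENNReal.ofReal |X ω - X' n ω| := Real.enorm_eq_ofReal_abs _
        _ ≤ ENNReal.ofReal 2 := ENNReal.ofReal_le_ofReal h2
    · have h2 := ((tendsto_const_nhds (x := X ω)).sub (hlim ω)).enorm
      simpa using h2
  rw [lintegral_zero] at h1
  obtain ⟨n, hn⟩ := (h1.eventually_le_const (ENNReal.ofReal_pos.2 hδ)).exists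
  refine ⟨X' n, Integrable.of_bound (hm n) 1 (ae_of_all _ (hbd n)), hX' n, ?_⟩
  rw [eLpNorm_one_eq_lintegral_enorm]
  exact hn

/-- A monotone class argument, relative to a fixed event `G`. -/
theorem indicator_inter_of_isPiSystem {Ω : Type*} {m' mΩ : MeasurableSpace Ω} {μ : Measure Ω}
    [IsProbabilityMeasure μ] {T : ℝ} {F : ℝ → MeasurableSpace Ω} (hT : 0 < T)
    (hF : ∀ s ∈ Icc 0 T, ∀ t ∈ Icc s T, F s ≤ F t)
    (hFm : ∀ t ∈ Icc 0 T, F t ≤ mΩ) (hm' : m' ≤ mΩ) {P : Set (Set Ω)}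
    (hgen : m' = MeasurableSpace.generateFrom P) (hP : IsPiSystem P) {G : Set Ω}
    (hGm : MeasurableSet[mΩ] G) (hG : HasContCondExp F μ T (G.indicator fun _ => 1))
    (h : ∀ A ∈ P, HasContCondExp F μ T ((A ∩ G).indicator fun _ => 1)) {A : Set Ω}
    (hA : MeasurableSet[m'] A) : HasContCondExp F μ T ((A ∩ G).indicator fun _ => 1) := by
  classical
  have hint : ∀ A, MeasurableSet[mΩ] A → Integrable (A.indicator fun _ => (1 : ℝ)) μ :=
    fun A hA => (integrable_const 1).indicator hA
  induction A, hA using MeasurableSpace.induction_on_inter (m := m') hgen hP with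
  | empty => exact (hG.smul 0).congr (by simp; rfl)
  | basic A hA => exact h A hA
  | compl A hA ih =>
    refine (hG.sub ih (hint _ hGm) (hint _ ((hm' _ hA).inter hGm))).congr (ae_of_all _ fun ω => ?_)
    by_cases h1 : ω ∈ A <;> by_cases h2 : ω ∈ G <;> simp [h1, h2]
  | iUnion f hdisj hfm ih =>
    have hUm : ∀ n, MeasurableSet[mΩ] ((⋃ i ∈ Finset.range n, f i) ∩ G) := fun n =>
      (Finset.measurableSet_biUnion _ fun i _ => hm' _ (hfm i)).inter hGm
    refine of_tendsto_of_bounded hT hF hFm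
      (X' := fun n => ((⋃ i ∈ Finset.range n, f i) ∩ G).indicator fun _ => 1) (fun n => ?_)
      (fun n => (hint _ (hUm n)).aestronglyMeasurable) (fun n ω => ?_) fun ω => ?_
    · induction n with
      | zero => exact (hG.smul 0).congr (by simp; rfl)
      | succ n ihn =>
        refine (ihn.add (ih n) (hint _ (hUm n)) (hint _ ((hm' _ (hfm n)).inter hGm))).congr
          (ae_of_all _ fun ω => ?_)
        have h1 : Disjoint (⋃ i ∈ Finset.range n, f i) (f n) := by
          simp only [disjoint_iUnion_left]
          intro i hi
          exact hdisj (Finset.mem_range.1 hi).ne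
        have h2 : ¬ (ω ∈ (⋃ i ∈ Finset.range n, f i) ∧ ω ∈ f n) := fun h => disjoint_left.1 h1 h.1 h.2
        rw [Finset.range_add_one, Finset.set_biUnion_insert, Pi.add_apply]
        simp only [indicator_apply, mem_inter_iff, mem_union]
        by_cases h3 : ω ∈ ⋃ i ∈ Finset.range n, f i <;> by_cases h4 : ω ∈ f n <;>
          by_cases h5 : ω ∈ G <;> simp only [h3, h4, h5] at h2 ⊢ <;> simp at h2 ⊢
    · simp only [indicator_apply]
      split_ifs <;> simp
    · simp only [indicator_apply, mem_inter_iff]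
      refine tendsto_const_nhds.congr' ?_
      by_cases h1 : ω ∈ ⋃ i, f i
      · obtain ⟨i, hi⟩ := mem_iUnion.1 h1
        filter_upwards [eventually_gt_atTop i] with n hn
        have h2 : ω ∈ ⋃ i ∈ Finset.range n, f i := mem_biUnion (by simpa using hn) hi
        simp only [h1, h2]
      · refine Eventually.of_forall fun n => ?_
        have h2 : ω ∉ ⋃ i ∈ Finset.range n, f i := fun h2 => h1 (iUnion₂_subset_iUnion _ _ h2)
        simp only [h1, h2]

theorem of_simpleFunc {Ω : Type*} {m mΩ : MeasurableSpace Ω} {μ : Measure Ω}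
    [IsProbabilityMeasure μ] {T : ℝ} {F : ℝ → MeasurableSpace Ω} (hm : m ≤ mΩ)
    (h : ∀ A, MeasurableSet[m] A → HasContCondExp F μ T (A.indicator fun _ => 1))
    (g : @SimpleFunc Ω m ℝ) : HasContCondExp F μ T g ∧ Integrable g μ := by
  refine @SimpleFunc.induction Ω ℝ m _ (fun g => HasContCondExp F μ T g ∧ Integrable g μ)
    (fun c s hs => ?_) (fun _ _ _ h1 h2 => ⟨h1.1.add h2.1 h1.2 h2.2, h1.2.add h2.2⟩) g
  have h1 : (c • s.indicator fun _ => (1 : ℝ))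
      = @SimpleFunc.piecewise Ω ℝ m s hs (@SimpleFunc.const Ω ℝ m c) (@SimpleFunc.const Ω ℝ m 0) := by
    ext ω
    by_cases h1 : ω ∈ s <;> simp [h1]
  rw [← h1]
  exact ⟨(h s hs).smul c, ((integrable_const 1).indicator (hm s hs)).smul c⟩

theorem exists_simpleFunc {Ω : Type*} {m mΩ : MeasurableSpace Ω} {μ : Measure Ω} (hm : m ≤ mΩ)
    {f : Ω → ℝ} (hf : StronglyMeasurable[m] f) (hfi : Integrable f μ) {δ : ℝ} (hδ : 0 < δ) :
    ∃ g : @SimpleFunc Ω m ℝ, eLpNorm (f - ⇑g) 1 μ ≤ ENNReal.ofReal δ := by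
  have h1 : @MemLp Ω ℝ m _ _ f 1 (μ.trim hm) :=
    (@memLp_one_iff_integrable Ω ℝ m _ _ _ _).2 (hfi.trim hm hf)
  obtain ⟨g, hg, -⟩ := @MemLp.exists_simpleFunc_eLpNorm_sub_lt Ω m _ ℝ _ f _ h1 ENNReal.one_ne_top
    _ (ENNReal.ofReal_pos.2 hδ).ne'
  refine ⟨g, ?_⟩
  rw [← eLpNorm_trim hm (hf.sub g.stronglyMeasurable)]
  exact hg.le

/-- It is enough to consider indicators of the events known at the final time. -/
theorem of_forall_indicator (hT : 0 < T)
    (hF : ∀ s ∈ Icc 0 T, ∀ t ∈ Icc s T, F s ≤ F t)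
    (hFm : ∀ t ∈ Icc 0 T, F t ≤ mΩ)
    (h : ∀ A, MeasurableSet[F T] A → HasContCondExp F μ T (A.indicator fun _ => 1))
    (X : Ω → ℝ) : HasContCondExp F μ T X := by
  have hTm : F T ≤ mΩ := hFm T ⟨hT.le, le_rfl⟩
  have hXT : HasContCondExp F μ T (μ[X|F T]) := by
    refine of_forall_exists hT hF hFm integrable_condExp fun δ hδ => ?_
    obtain ⟨g, hg⟩ := exists_simpleFunc hTm (stronglyMeasurable_condExp (μ := μ) (f := X))
      integrable_condExp hδ
    exact ⟨g, (of_simpleFunc hTm h g).2, (of_simpleFunc hTm h g).1, hg⟩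
  obtain ⟨Z, hZc, hZ⟩ := hXT
  exact ⟨Z, hZc, fun t ht => (hZ t ht).trans (condExp_condExp_of_le (hF t ht T ⟨ht.2, le_rfl⟩) hTm)⟩

end HasContCondExp

end Closure

section Brownian

variable {Ω : Type*} [mΩ : MeasurableSpace Ω] {μ : Measure Ω} [IsProbabilityMeasure μ] {T : ℝ}
  {d : ℕ} {B : ℝ → Ω → (Fin d → ℝ)} {W : ℝ → (Fin d → ℝ) → Ω → ℝ}

/-- The case of a closed cylinder event of the path intersected with an event of the field: the
indicator of a closed set is a limit of continuous functions with values in `[0, 1]`. -/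
theorem IsBrownianOn.hasContCondExp_indicator_cylinder (hT : 0 < T) (hB : IsBrownianOn T B μ)
    (hW : fieldSigma W ≤ mΩ) (hBW : Indep (brownianSigma B T) (fieldSigma W) μ) (S : Finset ℝ)
    (hS : ∀ u ∈ S, u ∈ Icc 0 T) {D : ℝ → Set (Fin d → ℝ)} (hD : ∀ u, IsClosed (D u)) {G : Set Ω}
    (hG : MeasurableSet[fieldSigma W] G) :
    HasContCondExp (sigmaF B W) μ T
      (((⋂ u ∈ S, B u ⁻¹' D u) ∩ G).indicator fun _ => 1) := by
  set f : ℕ → ℝ → (Fin d → ℝ) →ᵇ ℝ := fun n u =>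
    BoundedContinuousFunction.ofNormedAddCommGroup (fun x => ((hD u).apprSeq n x : ℝ))
      (by fun_prop) 1 (fun x => by
        rw [Real.norm_of_nonneg (NNReal.coe_nonneg _)]
        exact_mod_cast HasOuterApproxClosed.apprSeq_apply_le_one (hD u) n x) with hf
  have hf01 : ∀ n u x, 0 ≤ f n u x ∧ f n u x ≤ 1 := fun n u x =>
    ⟨NNReal.coe_nonneg _, by
      exact_mod_cast HasOuterApproxClosed.apprSeq_apply_le_one (hD u) n x⟩
  refine HasContCondExp.of_tendsto_of_bounded hT (fun s _ t ht => sigmaF_mono B W ht.1)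
    (fun t ht => sup_le (hB.brownianSigma_le ht.2) hW)
    (X' := fun n => G.indicator fun ω => ∏ j ∈ S, f n j (B j ω))
    (fun n => hB.hasContCondExp_indicator_prod hT.le hW hBW S hS (f n) hG) (fun n => ?_)
    (fun n ω => ?_) fun ω => ?_
  · refine AEStronglyMeasurable.indicator (Measurable.aestronglyMeasurable ?_) (hW G hG)
    exact Finset.measurable_fun_prod _ fun j hj =>
      (f n j).continuous.measurable.comp (hB.measurable j (hS j hj))
  · by_cases h1 : ω ∈ G
    · rw [indicator_of_mem h1, abs_of_nonneg (Finset.prod_nonneg fun j _ => (hf01 n j _).1)]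
      exact Finset.prod_le_one (fun j _ => (hf01 n j _).1) fun j _ => (hf01 n j _).2
    · simp [h1]
  · by_cases h1 : ω ∈ G
    · have h2 : ((⋂ u ∈ S, B u ⁻¹' D u) ∩ G).indicator (fun _ => (1 : ℝ)) ω
          = ∏ j ∈ S, (((D j).indicator (fun _ => (1 : ℝ≥0)) (B j ω) : ℝ≥0) : ℝ) := by
        by_cases h3 : ω ∈ ⋂ u ∈ S, B u ⁻¹' D u
        · rw [indicator_of_mem (show ω ∈ (⋂ u ∈ S, B u ⁻¹' D u) ∩ G from ⟨h3, h1⟩),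
            Finset.prod_eq_one]
          intro j hj
          have h4 : B j ω ∈ D j := mem_iInter₂.1 h3 j hj
          rw [indicator_of_mem h4, NNReal.coe_one]
        · rw [indicator_of_notMem fun h => h3 h.1]
          simp only [mem_iInter₂, not_forall] at h3
          obtain ⟨j, hj, h4⟩ := h3
          refine (Finset.prod_eq_zero hj ?_).symm
          have h5 : B j ω ∉ D j := h4
          rw [indicator_of_notMem h5, NNReal.coe_zero]
      rw [h2]
      simp only [indicator_of_mem h1]
      refine tendsto_finsetProd _ fun j _ => ?_
      exact (NNReal.continuous_coe.tendsto _).comp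
        ((tendsto_pi_nhds.1 (HasOuterApproxClosed.tendsto_apprSeq (hD j))) (B j ω))
    · simp [h1]

/-- Closed cylinder events form a π-system generating the σ-algebra of the path. -/
theorem brownianSigma_eq_generateFrom {Ω : Type*} {d : ℕ} (B : ℝ → Ω → (Fin d → ℝ)) (T : ℝ) :
    brownianSigma B T = MeasurableSpace.generateFrom
      (piiUnionInter (fun u => {s | ∃ D, IsClosed D ∧ B u ⁻¹' D = s}) (Icc 0 T)) := by
  refine le_antisymm (iSup₂_le fun u hu => ?_) (MeasurableSpace.generateFrom_le ?_)
  · rw [BorelSpace.measurable_eq (α := Fin d → ℝ), borel_eq_generateFrom_isClosed,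
      MeasurableSpace.comap_generateFrom]
    exact le_generateFrom_piiUnionInter
      (π := fun u => {s | ∃ D, IsClosed D ∧ B u ⁻¹' D = s}) _ hu
  · rintro _ ⟨S, hS, f, hf, rfl⟩
    refine Finset.measurableSet_biInter _ fun u hu => ?_
    obtain ⟨D, hD, h1⟩ := hf u hu
    rw [← h1]
    exact measurable_brownianSigma B (hS hu) hD.measurableSet

/-- For the filtration of a Brownian motion, enlarged by an independent field, every closed
martingale has a continuous version. -/
theorem IsBrownianOn.hasContCondExp (hT : 0 < T) (hB : IsBrownianOn T B μ)
    (hW : fieldSigma W ≤ mΩ) (hBW : Indep (brownianSigma B T) (fieldSigma W) μ) (X : Ω → ℝ) :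
    HasContCondExp (sigmaF B W) μ T X := by
  have hF : ∀ s ∈ Icc 0 T, ∀ t ∈ Icc s T, sigmaF B W s ≤ sigmaF B W t :=
    fun s _ t ht => sigmaF_mono B W ht.1
  have hFm : ∀ t ∈ Icc 0 T, sigmaF B W t ≤ mΩ :=
    fun t ht => sup_le (hB.brownianSigma_le ht.2) hW
  have hone : HasContCondExp (sigmaF B W) μ T ((univ : Set Ω).indicator fun _ => 1) := by
    simpa using hB.hasContCondExp_indicator_cylinder hT hW hBW ∅ (by simp)
      (D := fun _ => ∅) (fun _ => isClosed_empty) (G := univ) MeasurableSet.univ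
  have hcyl : ∀ A, MeasurableSet[brownianSigma B T] A → ∀ G, MeasurableSet[fieldSigma W] G →
      HasContCondExp (sigmaF B W) μ T ((A ∩ G).indicator fun _ => 1) := by
    intro A hA G hG
    refine HasContCondExp.indicator_inter_of_isPiSystem hT hF hFm (hB.brownianSigma_le le_rfl)
      (brownianSigma_eq_generateFrom B T) (isPiSystem_piiUnionInter _ (fun u => ?_) _) (hW G hG) ?_
      ?_ hA
    · rintro _ ⟨D, hD, rfl⟩ _ ⟨D', hD', rfl⟩ _
      exact ⟨D ∩ D', hD.inter hD', preimage_inter⟩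
    · simpa using hB.hasContCondExp_indicator_cylinder hT hW hBW ∅ (by simp)
        (D := fun _ => ∅) (fun _ => isClosed_empty) hG
    · rintro _ ⟨S, hS, f, hf, rfl⟩
      choose! D hD hDf using hf
      classical
      have h1 := hB.hasContCondExp_indicator_cylinder hT hW hBW S (fun u hu => hS hu)
        (D := fun u => if u ∈ S then D u else ∅) (fun u => by
          by_cases hu : u ∈ S
          · simpa [hu] using hD u hu
          · simp [hu]) hG
      have h2 : ⋂ u ∈ S, f u = ⋂ u ∈ S, B u ⁻¹' (if u ∈ S then D u else ∅) :=
        iInter₂_congr fun u hu => by rw [if_pos hu, hDf u hu]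
      rwa [h2]
  refine HasContCondExp.of_forall_indicator hT hF hFm (fun A hA => ?_) X
  have h2 := HasContCondExp.indicator_inter_of_isPiSystem hT hF hFm (hFm T ⟨hT.le, le_rfl⟩)
    (sup_eq_generateFrom_inter _ _) (isPiSystem_inter _ _) MeasurableSet.univ hone (by
      rintro _ ⟨s, hs, t, ht, rfl⟩
      simpa using hcyl s hs t ht) hA
  simpa using h2

end Brownian

end FracBSDE

/-! ### Exponential moments of the path -/

namespace FracBSDE

variable {Ω : Type*} [mΩ : MeasurableSpace Ω] {μ : Measure Ω} {T : ℝ}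
  {d : ℕ} {B : ℝ → Ω → (Fin d → ℝ)} {W : ℝ → (Fin d → ℝ) → Ω → ℝ}

theorem IsBrownianOn.integrable_increment (hB : IsBrownianOn T B μ) {s t : ℝ} (hs : 0 ≤ s)
    (hst : s ≤ t) (ht : t ≤ T) :
    Integrable (fun ω => B t ω - B s ω) μ ∧ ∫ ω, (B t ω - B s ω) ∂μ = 0 := by
  have hm : Measurable fun ω => B t ω - B s ω :=
    (hB.measurable t ⟨hs.trans hst, ht⟩).sub (hB.measurable s ⟨hs, hst.trans ht⟩)
  have hlaw : ∀ i, μ.map (fun ω => (B t ω - B s ω) i) = gaussianReal 0 (t - s).toNNReal := by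
    intro i
    have h1 := Measure.map_map (μ := μ) (measurable_pi_apply (X := fun _ : Fin d => ℝ) i) hm
    rw [hB.law_increment s t hs hst ht, (measurePreserving_eval _ i).map_eq] at h1
    exact h1.symm
  have hmi : ∀ i, Measurable fun ω => (B t ω - B s ω) i := fun i =>
    (measurable_pi_apply i).comp hm
  have hint : ∀ i, Integrable (fun ω => (B t ω - B s ω) i) μ := by
    intro i
    have h1 : Integrable id (gaussianReal 0 (t - s).toNNReal) :=
      memLp_one_iff_integrable.1 (memLp_id_gaussianReal 1)
    rw [← hlaw i] at h1
    exact h1.comp_measurable (hmi i)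
  refine ⟨Integrable.of_eval hint, ?_⟩
  ext i
  rw [eval_integral hint]
  have h2 := integral_map (μ := μ) (hmi i).aemeasurable (f := fun x : ℝ => x) (by fun_prop)
  rw [hlaw i, integral_id_gaussianReal] at h2
  exact h2.symm

theorem IsBrownianOn.exists_integrable_exp_sq (hT : 0 ≤ T) (hB : IsBrownianOn T B μ) :
    ∃ θ > 0, Integrable (fun ω => Real.exp (θ * ‖B T ω‖ ^ 2)) μ := by
  obtain ⟨θ, hθ, hint⟩ := IsGaussian.exists_integrable_exp_sq (gaussianReal 0 (T - 0).toNNReal)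
  refine ⟨θ, hθ, ?_⟩
  have h1 : Integrable (fun x : Fin d → ℝ => ∏ i, Real.exp (θ * ‖x i‖ ^ 2))
      (Measure.pi fun _ => gaussianReal 0 (T - 0).toNNReal) :=
    Integrable.fintype_prod fun _ => hint
  have hm : Measurable fun ω => B T ω - B 0 ω :=
    (hB.measurable T ⟨hT, le_rfl⟩).sub (hB.measurable 0 ⟨le_rfl, hT⟩)
  rw [← hB.law_increment 0 T le_rfl hT le_rfl] at h1
  have h2 := h1.comp_measurable hm
  refine h2.mono' ?_ ?_
  · exact (by fun_prop : Measurable fun x : Fin d → ℝ => Real.exp (θ * ‖x‖ ^ 2)).comp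
      (hB.measurable T ⟨hT, le_rfl⟩) |>.aestronglyMeasurable
  · filter_upwards [hB.zero] with ω hω
    rw [Real.norm_of_nonneg (Real.exp_pos _).le, Function.comp, ← Real.exp_sum, ← Finset.mul_sum, hω]
    simp only [Pi.sub_apply, Pi.zero_apply, sub_zero]
    refine Real.exp_le_exp.2 (mul_le_mul_of_nonneg_left ?_ hθ.le)
    rw [← Real.sqrt_le_sqrt_iff (by positivity), Real.sqrt_sq (norm_nonneg _)]
    refine (pi_norm_le_iff_of_nonneg (Real.sqrt_nonneg _)).2 fun i => ?_
    refine Real.le_sqrt_of_sq_le ?_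
    exact Finset.single_le_sum (f := fun i => ‖B T ω i‖ ^ 2) (fun _ _ => by positivity)
      (Finset.mem_univ i)

theorem convexOn_exp_norm_sq {E : Type*} [SeminormedAddCommGroup E] [NormedSpace ℝ E] {θ : ℝ}
    (hθ : 0 ≤ θ) : ConvexOn ℝ univ fun x : E => Real.exp (θ * ‖x‖ ^ 2) := by
  have h1 : ConvexOn ℝ univ fun x : E => θ * ‖x‖ ^ 2 :=
    ((convexOn_univ_norm (E := E)).pow (fun _ _ => norm_nonneg _) 2).smul hθ
  refine ⟨convex_univ, fun x hx y hy a b ha hb hab => ?_⟩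
  exact (Real.exp_le_exp.2 (h1.2 hx hy ha hb hab)).trans
    (convexOn_exp.2 (mem_univ _) (mem_univ _) ha hb hab)

/-- `exp(θ |B|²)` is a submartingale, by Jensen's inequality. -/
theorem IsBrownianOn.exp_norm_sq_le_condExp [IsProbabilityMeasure μ] (hT : 0 ≤ T)
    (hB : IsBrownianOn T B μ) {θ : ℝ} (hθ : 0 ≤ θ)
    (hint : Integrable (fun ω => Real.exp (θ * ‖B T ω‖ ^ 2)) μ) {t : ℝ} (ht : t ∈ Icc 0 T) :
    ∀ᵐ ω ∂μ, Real.exp (θ * ‖B t ω‖ ^ 2)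
      ≤ (μ[fun ω => Real.exp (θ * ‖B T ω‖ ^ 2)|brownianSigma B t]) ω := by
  have hle := hB.brownianSigma_le ht.2
  have hBT : ∀ s ∈ Icc 0 T, Integrable (B s) μ := fun s hs =>
    (hB.integrable_increment le_rfl hs.1 hs.2).1.congr (by
      filter_upwards [hB.zero] with ω hω
      simp [hω])
  have hTi := hB.integrable_increment ht.1 ht.2 le_rfl
  have hmart : μ[B T|brownianSigma B t] =ᵐ[μ] B t := by
    have h1 : B T = B t + fun ω => B T ω - B t ω := by ext ω i; simp
    have h2 : μ[fun ω => B T ω - B t ω|brownianSigma B t]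
        =ᵐ[μ] fun _ => ∫ ω, (B T ω - B t ω) ∂μ :=
      condExp_indep_eq ((comap_increment_le B ht ⟨hT, le_rfl⟩).trans (hB.brownianSigma_le le_rfl))
        hle (comap_measurable (fun ω => B T ω - B t ω)).stronglyMeasurable
        (hB.indep_increment t T ht.1 ht.2 le_rfl).symm
    have h3 := condExp_add (hBT t ht) hTi.1 (brownianSigma B t)
    rw [← h1, condExp_of_stronglyMeasurable hle
      (measurable_brownianSigma B ⟨ht.1, le_rfl⟩).stronglyMeasurable (hBT t ht)] at h3
    filter_upwards [h2, h3] with ω h4 h5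
    rw [h5, Pi.add_apply, h4, hTi.2, add_zero]
  have hj := (convexOn_exp_norm_sq (E := Fin d → ℝ) hθ).map_condExp_le_of_finiteDimensional hle
    (hBT T ⟨hT, le_rfl⟩) hint
  filter_upwards [hmart, hj] with ω h1 h2
  rw [Function.comp, h1] at h2
  exact h2

/-- Since `2 * A < 2`, the growth of the field is beaten by every positive multiple of the square,
for which Gaussian exponential moments are available. -/
theorem exists_exp_rpow_le {A θ : ℝ} (hA0 : 0 ≤ A) (hA : A < 1) (hθ : 0 < θ) (c : ℝ) :
    ∃ L : ℝ, ∀ m : ℝ, 0 ≤ m → c * (1 + m) ^ (2 * A) ≤ θ * m ^ 2 + L := by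
  have h1 : Tendsto (fun y : ℝ => |c| * y ^ (-(2 - 2 * A))) atTop (𝓝 (|c| * 0)) :=
    (tendsto_rpow_neg_atTop (by linarith)).const_mul _
  rw [mul_zero] at h1
  obtain ⟨y0, hy0⟩ := eventually_atTop.1 (h1.eventually_le_const (half_pos hθ))
  refine ⟨θ + |c| * |y0| ^ (2 * A), fun m hm => ?_⟩
  have hc : c * (1 + m) ^ (2 * A) ≤ |c| * (1 + m) ^ (2 * A) :=
    mul_le_mul_of_nonneg_right (le_abs_self c) (by positivity)
  have h0 : 0 ≤ |c| * |y0| ^ (2 * A) := by positivity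
  refine hc.trans ?_
  rcases le_total y0 (1 + m) with h | h
  · have h2 := hy0 _ h
    have h3 : |c| * (1 + m) ^ (2 * A) = |c| * (1 + m) ^ (-(2 - 2 * A)) * (1 + m) ^ 2 := by
      rw [mul_assoc, ← Real.rpow_natCast, ← Real.rpow_add (by linarith)]
      congr 2
      push_cast
      ring
    rw [h3]
    have h4 := mul_le_mul_of_nonneg_right h2 (sq_nonneg (1 + m))
    nlinarith [sq_nonneg (1 - m)]
  · have h2 : (1 + m) ^ (2 * A) ≤ |y0| ^ (2 * A) :=
      Real.rpow_le_rpow (by linarith) (h.trans (le_abs_self _)) (by linarith)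
    have h3 := mul_le_mul_of_nonneg_left h2 (abs_nonneg c)
    nlinarith [sq_nonneg m]

/-- A continuous version of the Brownian path has a running maximum with the exponential moments
required by the growth of the field. -/
theorem IsBrownianOn.exists_bound [IsProbabilityMeasure μ] (hT : 0 < T) (hB : IsBrownianOn T B μ)
    {b : ℝ → Ω → (Fin d → ℝ)} (hbc : ∀ ω, Continuous fun t => b t ω)
    (hbm : ∀ t, Measurable (b t)) (hbB : ∀ᵐ ω ∂μ, ∀ t ∈ Icc 0 T, b t ω = B t ω) {A : ℝ}
    (hA0 : 0 ≤ A) (hA : A < 1) :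
    ∃ M : Ω → ℝ, (∀ ω, ∀ t ∈ Icc 0 T, ‖b t ω‖ ≤ M ω) ∧
      ∀ c : ℝ, ∫⁻ ω, ENNReal.ofReal (Real.exp (c * (1 + M ω) ^ (2 * A))) ∂μ < ∞ := by
  obtain ⟨θ, hθ, hint⟩ := hB.exists_integrable_exp_sq hT.le
  set M : Ω → ℝ := fun ω => (⨆ n, gridSup T n fun t => ‖b t ω‖ₑ).toReal with hM
  have hmax : ∀ ω, ∃ t0 ∈ Icc 0 T, M ω = ‖b t0 ω‖ ∧ ∀ t ∈ Icc 0 T, ‖b t ω‖ ≤ ‖b t0 ω‖ := by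
    intro ω
    obtain ⟨t0, ht0, h1⟩ := isCompact_Icc.exists_isMaxOn ⟨0, left_mem_Icc.2 hT.le⟩
      (hbc ω).norm.continuousOn (s := Icc 0 T)
    have h2 : ∀ t ∈ Icc 0 T, ‖b t ω‖ ≤ ‖b t0 ω‖ := fun t ht => h1 ht
    refine ⟨t0, ht0, ?_, h2⟩
    simp only [hM]
    rw [iSup_gridSup_eq hT (hbc ω).enorm.continuousOn, ← toReal_enorm]
    congr 1
    refine le_antisymm (iSup₂_le fun t ht => enorm_le_iff_norm_le.2 (h2 t ht)) ?_
    exact le_iSup₂_of_le (f := fun t _ => ‖b t ω‖ₑ) t0 ht0 le_rfl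
  refine ⟨M, fun ω t ht => ?_, fun c => ?_⟩
  · obtain ⟨t0, -, h1, h2⟩ := hmax ω
    exact (h2 t ht).trans h1.ge
  set ψ : ℝ → Ω → ℝ := fun t ω => Real.exp (θ * ‖b t ω‖ ^ 2) with hψ
  set x : ℝ := 1 + ∫ ω, Real.exp (θ * ‖B T ω‖ ^ 2) ∂μ with hx
  have hx0 : 0 < x := by
    have : 0 ≤ ∫ ω, Real.exp (θ * ‖B T ω‖ ^ 2) ∂μ := integral_nonneg fun _ => (Real.exp_pos _).le
    linarith
  have hψc : ∀ ω, Continuous fun t => ψ t ω := fun ω => by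
    have := (hbc ω).norm
    simp only [hψ]
    fun_prop
  have hsup : supMoment μ T (1 / 2) ψ ≤ ENNReal.ofReal (1 / (1 - 1 / 2) * x ^ (1 / 2 : ℝ)) := by
    refine supMoment_le_of_gridSup hT (ae_of_all _ fun ω => (hψc ω).continuousOn) (fun t _ => ?_)
      fun n => ?_
    · exact (by fun_prop : Measurable fun y : Fin d → ℝ => Real.exp (θ * ‖y‖ ^ 2)).comp
        (hbm t) |>.aemeasurable
    refine le_trans (lintegral_mono_ae ?_) (lintegral_gridSup_condExp_le (μ := μ)
      (F := fun t => brownianSigma B t) (X := fun ω => Real.exp (θ * ‖B T ω‖ ^ 2)) hT.le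
      (fun s _ t ht => brownianSigma_mono B ht.1) (fun t ht => hB.brownianSigma_le ht.2)
      (by norm_num) (by norm_num) le_rfl
      (by rw [ENNReal.ofReal_one]; exact memLp_one_iff_integrable.2 hint) hx0 ?_ n)
    · have h1 : ∀ᵐ ω ∂μ, ∀ k ∈ Finset.range (2 ^ n + 1), Real.exp (θ * ‖B (gridPt T n k) ω‖ ^ 2)
          ≤ (μ[fun ω => Real.exp (θ * ‖B T ω‖ ^ 2)|brownianSigma B (gridPt T n k)]) ω :=
        (ae_ball_iff (Finset.countable_toSet _)).2 fun k hk =>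
          hB.exp_norm_sq_le_condExp hT.le hθ.le hint
            (gridPt_mem hT.le (by simpa [Nat.lt_succ_iff] using hk))
      filter_upwards [h1, hbB] with ω h2 h3
      refine iSup₂_mono fun k hk => ENNReal.rpow_le_rpow ?_ (by norm_num)
      have hk' := gridPt_mem hT.le (n := n) (k := k) (by simpa [Nat.lt_succ_iff] using hk)
      refine enorm_le_iff_norm_le.2 ?_
      rw [Real.norm_of_nonneg (Real.exp_pos _).le]
      simp only [h3 _ hk']
      exact (h2 k hk).trans (le_abs_self _)
    · rw [ENNReal.ofReal_one, eLpNorm_one_eq_lintegral_enorm,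
        ← ofReal_integral_norm_eq_lintegral_enorm hint]
      refine ENNReal.ofReal_le_ofReal ?_
      simp only [Real.norm_of_nonneg (Real.exp_pos _).le]
      linarith
  obtain ⟨L, hL⟩ := exists_exp_rpow_le hA0 hA (half_pos hθ) c
  refine lt_of_le_of_lt (lintegral_mono (g := fun ω => ENNReal.ofReal (Real.exp L) *
    ⨆ t ∈ Icc 0 T, ‖ψ t ω‖ₑ ^ (1 / 2 : ℝ)) fun ω => ?_) ?_
  · obtain ⟨t0, ht0, h1, -⟩ := hmax ω
    have h2 : ENNReal.ofReal (Real.exp (θ / 2 * M ω ^ 2)) = ‖ψ t0 ω‖ₑ ^ (1 / 2 : ℝ) := by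
      rw [Real.enorm_eq_ofReal (Real.exp_pos _).le,
        ENNReal.ofReal_rpow_of_pos (Real.exp_pos _), ← Real.exp_mul, h1]
      congr 2
      ring
    calc ENNReal.ofReal (Real.exp (c * (1 + M ω) ^ (2 * A)))
        ≤ ENNReal.ofReal (Real.exp L * Real.exp (θ / 2 * M ω ^ 2)) := by
          refine ENNReal.ofReal_le_ofReal ?_
          rw [← Real.exp_add, add_comm L]
          exact Real.exp_le_exp.2 (hL _ ENNReal.toReal_nonneg)
      _ = ENNReal.ofReal (Real.exp L) * ‖ψ t0 ω‖ₑ ^ (1 / 2 : ℝ) := by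
          rw [ENNReal.ofReal_mul (Real.exp_pos _).le, h2]
      _ ≤ _ := by
          refine mul_le_mul_right ?_ _
          exact le_iSup₂_of_le (f := fun t _ => ‖ψ t ω‖ₑ ^ (1 / 2 : ℝ)) t0 ht0 le_rfl
  · rw [lintegral_const_mul' _ _ ENNReal.ofReal_ne_top]
    exact ENNReal.mul_lt_top ENNReal.ofReal_lt_top (hsup.trans_lt ENNReal.ofReal_lt_top)

/-- The hypothesis `∑ i, (2 * H i - β i) < 2` says that the standard deviation of the field grows
with an exponent `A < 1`, which makes the exponential moments of `(1 + M) ^ (2 * A)` finite. -/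
theorem exists_model [IsProbabilityMeasure μ] (hT : 0 < T) {H0 : ℝ}
    (hH0 : H0 ∈ Ioo (1 / 2 : ℝ) 1) {H β : Fin d → ℝ}
    (hH : ∀ i, H i ∈ Ioo (1 / 2 : ℝ) 1) (hβ : ∀ i, β i ∈ Ioo (0 : ℝ) 2)
    (hβH : ∀ i, β i < 2 * H i) (hα : ∑ i, (2 * H i - β i) < 2) {ρ : (Fin d → ℝ) → ℝ}
    (hρ : Continuous ρ) (hρβ : ∃ C : ℝ, ∀ x, 0 ≤ ρ x ∧ ρ x ≤ C * ∏ i, (1 + |x i|) ^ (-β i))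
    (hB : IsBrownianOn T B μ) (hW : IsWeightedFractionalField H0 H ρ W μ)
    (hBW : Indep (brownianSigma B T) (fieldSigma W) μ) :
    ∃ C A b M, Model μ T H0 H ρ C A B b W M := by
  obtain ⟨C, hC⟩ := exists_hasGrowth hH (fun i => (hβ i).1) hβH hρβ
  obtain ⟨b, hbc, hbm, hbB⟩ := hB.exists_continuous_version hT.le
  have hA : ∑ i, (H i - β i / 2) < 1 := by
    have h1 : ∑ i, (2 * H i - β i) = 2 * ∑ i, (H i - β i / 2) := by
      rw [Finset.mul_sum]
      exact Finset.sum_congr rfl fun i _ => by ring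
    linarith
  obtain ⟨M, hM, hexp⟩ := hB.exists_bound hT hbc hbm hbB hC.A_nonneg hA
  exact ⟨C, _, b, M, hT, hH0, fun i => by linarith [(hH i).1], hρ, hC, hW, hB.measurable, hBW, hbc,
    hbm, hbB, hM, hexp⟩

end FracBSDE

/-! ### Exponentials of processes with small increments -/

namespace FracBSDE

variable {Ω : Type*} [mΩ : MeasurableSpace Ω] {μ : Measure Ω}

section Holder

theorem eLpNorm_mul_le_ennreal {f g : Ω → ℝ≥0∞} (hf : AEMeasurable f μ) (hg : AEMeasurable g μ)
    {p a b : ℝ} (hp : 0 < p) (hpa : p < a) (h : 1 / p = 1 / a + 1 / b) :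
    eLpNorm (fun ω => f ω * g ω) (ENNReal.ofReal p) μ
      ≤ eLpNorm f (ENNReal.ofReal a) μ * eLpNorm g (ENNReal.ofReal b) μ := by
  have ha : 0 < a := hp.trans hpa
  have hb : 0 < b := by
    have h1 : 1 / a < 1 / p := one_div_lt_one_div_of_lt hp hpa
    exact one_div_pos.1 (by linarith)
  have key : ∀ (f : Ω → ℝ≥0∞) {p : ℝ}, 0 < p →
      eLpNorm f (ENNReal.ofReal p) μ = (∫⁻ ω, f ω ^ p ∂μ) ^ (1 / p) := by
    intro f p hp
    rw [eLpNorm_eq_lintegral_rpow_enorm_toReal (by simpa using hp) ENNReal.ofReal_ne_top,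
      ENNReal.toReal_ofReal hp.le]
    simp only [enorm_eq_self]
  rw [key _ hp, key _ ha, key _ hb]
  exact ENNReal.lintegral_Lp_mul_le_Lq_mul_Lr hp hpa h μ hf hg

theorem eLpNorm_mul_le_real {f g : Ω → ℝ} (hf : AEStronglyMeasurable f μ)
    (hg : AEStronglyMeasurable g μ) {p a b : ℝ} (hp : 0 < p) (hpa : p < a)
    (h : 1 / p = 1 / a + 1 / b) :
    eLpNorm (fun ω => f ω * g ω) (ENNReal.ofReal p) μ
      ≤ eLpNorm f (ENNReal.ofReal a) μ * eLpNorm g (ENNReal.ofReal b) μ := by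
  have h1 := eLpNorm_mul_le_ennreal hf.enorm hg.enorm hp hpa h
  rw [eLpNorm_enorm, eLpNorm_enorm] at h1
  refine le_trans (le_of_eq ?_) h1
  rw [← eLpNorm_enorm]
  simp only [enorm_mul]

theorem abs_exp_sub_exp_le (x y : ℝ) :
    |Real.exp x - Real.exp y| ≤ |x - y| * (Real.exp x + Real.exp y) := by
  have key : ∀ x y : ℝ, Real.exp x - Real.exp y ≤ |x - y| * (Real.exp x + Real.exp y) := by
    intro x y
    have h1 := Real.add_one_le_exp (y - x)
    have h2 : Real.exp y = Real.exp x * Real.exp (y - x) := by rw [← Real.exp_add]; ring_nf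
    have h3 : Real.exp x - Real.exp y ≤ Real.exp x * (x - y) := by
      rw [h2]
      nlinarith [Real.exp_pos x]
    have h4 : Real.exp x * (x - y) ≤ |x - y| * Real.exp x := by
      rw [mul_comm]
      exact mul_le_mul_of_nonneg_right (le_abs_self _) (Real.exp_pos _).le
    nlinarith [mul_nonneg (abs_nonneg (x - y)) (Real.exp_pos y).le]
  refine abs_le.2 ⟨?_, key x y⟩
  have h := key y x
  rw [abs_sub_comm, add_comm (Real.exp y)] at h
  linarith

theorem eLpNorm_exp_sub_exp_le {f g : Ω → ℝ} (hf : AEStronglyMeasurable f μ)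
    (hg : AEStronglyMeasurable g μ) {p : ℝ} (hp : 1 ≤ p) :
    eLpNorm (fun ω => Real.exp (f ω) - Real.exp (g ω)) (ENNReal.ofReal p) μ
      ≤ eLpNorm (f - g) (ENNReal.ofReal (2 * p)) μ
        * (eLpNorm (fun ω => Real.exp (f ω)) (ENNReal.ofReal (2 * p)) μ
          + eLpNorm (fun ω => Real.exp (g ω)) (ENNReal.ofReal (2 * p)) μ) := by
  have hfe : AEStronglyMeasurable (fun ω => Real.exp (f ω)) μ :=
    Real.continuous_exp.comp_aestronglyMeasurable hf
  have hge : AEStronglyMeasurable (fun ω => Real.exp (g ω)) μ :=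
    Real.continuous_exp.comp_aestronglyMeasurable hg
  have h1 : eLpNorm (fun ω => Real.exp (f ω) - Real.exp (g ω)) (ENNReal.ofReal p) μ
      ≤ eLpNorm (fun ω => (f - g) ω * (Real.exp (f ω) + Real.exp (g ω))) (ENNReal.ofReal p) μ := by
    refine eLpNorm_mono fun ω => ?_
    rw [norm_mul, Real.norm_eq_abs, Real.norm_eq_abs, Real.norm_of_nonneg (by positivity)]
    exact abs_exp_sub_exp_le _ _
  refine h1.trans ((eLpNorm_mul_le_real (a := 2 * p) (b := 2 * p) (hf.sub hg) (hfe.add hge)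
    (by linarith) (by linarith) (by field_simp; norm_num)).trans (mul_le_mul_right ?_ _))
  exact eLpNorm_add_le hfe hge (by rw [ENNReal.one_le_ofReal]; linarith)

end Holder

section SupMoment

variable {T : ℝ}

theorem supMoment_congr {p : ℝ} {f g : ℝ → Ω → ℝ}
    (h : ∀ᵐ ω ∂μ, ∀ t ∈ Icc 0 T, f t ω = g t ω) : supMoment μ T p f = supMoment μ T p g := by
  refine lintegral_congr_ae ?_
  filter_upwards [h] with ω hω
  exact iSup_congr fun t => iSup_congr fun ht => by rw [hω t ht]

theorem biSup_rpow {ι : Type*} (s : Set ι) (f : ι → ℝ≥0∞) {p : ℝ} (hp : 0 < p) :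
    ⨆ i ∈ s, f i ^ p = (⨆ i ∈ s, f i) ^ p := by
  have h := (ENNReal.orderIsoRpow p hp).map_iSup₂ (fun i (_ : i ∈ s) => f i)
  exact h.symm

/-- The running supremum of the absolute value of a process. -/
noncomputable def supAbs (T : ℝ) (f : ℝ → Ω → ℝ) (ω : Ω) : ℝ≥0∞ := ⨆ t ∈ Icc 0 T, ‖f t ω‖ₑ

theorem supMoment_eq_lintegral {p : ℝ} (hp : 0 < p) (f : ℝ → Ω → ℝ) :
    supMoment μ T p f = ∫⁻ ω, supAbs T f ω ^ p ∂μ :=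
  lintegral_congr fun _ => biSup_rpow _ _ hp

theorem aemeasurable_supAbs (hT : 0 < T) {f : ℝ → Ω → ℝ}
    (hc : ∀ᵐ ω ∂μ, ContinuousOn (fun t => f t ω) (Icc 0 T))
    (hm : ∀ t ∈ Icc 0 T, AEMeasurable (f t) μ) : AEMeasurable (supAbs T f) μ := by
  have h := aemeasurable_iSup_enorm_rpow (p := 1) hT hc hm
  simpa only [ENNReal.rpow_one] using! h

theorem supMoment_mul_le (hT : 0 < T) {f g : ℝ → Ω → ℝ}
    (hfc : ∀ᵐ ω ∂μ, ContinuousOn (fun t => f t ω) (Icc 0 T))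
    (hfm : ∀ t ∈ Icc 0 T, AEMeasurable (f t) μ)
    (hgc : ∀ᵐ ω ∂μ, ContinuousOn (fun t => g t ω) (Icc 0 T))
    (hgm : ∀ t ∈ Icc 0 T, AEMeasurable (g t) μ) {p a b : ℝ} (hp : 0 < p) (hpa : p < a)
    (h : 1 / p = 1 / a + 1 / b) :
    supMoment μ T p (fun t ω => f t ω * g t ω)
      ≤ supMoment μ T a f ^ (p / a) * supMoment μ T b g ^ (p / b) := by
  have ha : 0 < a := hp.trans hpa
  have hb : 0 < b := by
    have h1 : 1 / a < 1 / p := one_div_lt_one_div_of_lt hp hpa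
    exact one_div_pos.1 (by linarith)
  rw [supMoment_eq_lintegral hp, supMoment_eq_lintegral ha, supMoment_eq_lintegral hb]
  have h1 := ENNReal.lintegral_Lp_mul_le_Lq_mul_Lr hp hpa h μ (aemeasurable_supAbs hT hfc hfm)
    (aemeasurable_supAbs hT hgc hgm)
  have h2 := ENNReal.rpow_le_rpow h1 hp.le
  rw [← ENNReal.rpow_mul, one_div_mul_cancel hp.ne', ENNReal.rpow_one,
    ENNReal.mul_rpow_of_nonneg _ _ hp.le, ← ENNReal.rpow_mul, ← ENNReal.rpow_mul,
    one_div_mul_eq_div, one_div_mul_eq_div] at h2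
  refine le_trans (lintegral_mono fun ω => ENNReal.rpow_le_rpow ?_ hp.le) h2
  refine iSup₂_le fun t ht => ?_
  rw [enorm_mul]
  exact mul_le_mul' (le_iSup₂_of_le (f := fun t _ => ‖f t ω‖ₑ) t ht le_rfl)
    (le_iSup₂_of_le (f := fun t _ => ‖g t ω‖ₑ) t ht le_rfl)

theorem supMoment_add_le (hT : 0 < T) {f g : ℝ → Ω → ℝ}
    (hfc : ∀ᵐ ω ∂μ, ContinuousOn (fun t => f t ω) (Icc 0 T))
    (hfm : ∀ t ∈ Icc 0 T, AEMeasurable (f t) μ) {p : ℝ} (hp : 1 ≤ p) :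
    supMoment μ T p (fun t ω => f t ω + g t ω)
      ≤ 2 ^ (p - 1) * (supMoment μ T p f + supMoment μ T p g) := by
  have hp0 : 0 < p := by linarith
  rw [supMoment_eq_lintegral hp0, supMoment_eq_lintegral hp0, supMoment_eq_lintegral hp0,
    ← lintegral_add_left' ((aemeasurable_supAbs hT hfc hfm).pow_const p),
    ← lintegral_const_mul' _ _ (ENNReal.rpow_ne_top_of_nonneg (by linarith) (by norm_num))]
  refine lintegral_mono fun ω => ?_
  refine le_trans (ENNReal.rpow_le_rpow ?_ hp0.le) (ENNReal.rpow_add_le_mul_rpow_add_rpow _ _ hp)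
  refine iSup₂_le fun t ht => (enorm_add_le _ _).trans ?_
  exact add_le_add (le_iSup₂_of_le (f := fun t _ => ‖f t ω‖ₑ) t ht le_rfl)
    (le_iSup₂_of_le (f := fun t _ => ‖g t ω‖ₑ) t ht le_rfl)

end SupMoment

/-- Adapted continuous processes `X` whose increments over intervals of length `h` are of size
`h ^ H` in every `Lᵖ`, and for which `exp (± X)` has moments of every order; the constants are
collected in the function `K`. -/
structure ExpProcess (F : ℝ → MeasurableSpace Ω) (μ : Measure Ω) (T H : ℝ) (K : ℝ → ℝ)
    (X : ℝ → Ω → ℝ) : Prop where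
  continuous : ∀ᵐ ω ∂μ, ContinuousOn (fun t => X t ω) (Icc 0 T)
  adapted : ∀ t ∈ Icc 0 T, AEStronglyMeasurable[F t] (X t) μ
  increment : ∀ p, 1 ≤ p → ∀ s ∈ Icc 0 T, ∀ t ∈ Icc s T,
    eLpNorm (X t - X s) (ENNReal.ofReal p) μ ≤ ENNReal.ofReal (K p * (t - s) ^ H)
  exp : ∀ p, 1 ≤ p → ∀ t ∈ Icc 0 T,
    eLpNorm (fun ω => Real.exp (X t ω)) (ENNReal.ofReal p) μ ≤ ENNReal.ofReal (K p)
  exp_neg : ∀ p, 1 ≤ p → ∀ t ∈ Icc 0 T,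
    eLpNorm (fun ω => Real.exp (-X t ω)) (ENNReal.ofReal p) μ ≤ ENNReal.ofReal (K p)

namespace ExpProcess

variable {F : ℝ → MeasurableSpace Ω} {T H : ℝ} {K : ℝ → ℝ} {X X' : ℝ → Ω → ℝ}

theorem aestronglyMeasurable (hX : ExpProcess F μ T H K X) (hFm : ∀ t ∈ Icc 0 T, F t ≤ mΩ) {t : ℝ}
    (ht : t ∈ Icc 0 T) : AEStronglyMeasurable (X t) μ :=
  (hX.adapted t ht).mono (hFm t ht)

theorem aestronglyMeasurable_exp_neg (hX : ExpProcess F μ T H K X)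
    (hFm : ∀ t ∈ Icc 0 T, F t ≤ mΩ) {t : ℝ} (ht : t ∈ Icc 0 T) :
    AEStronglyMeasurable (fun ω => Real.exp (-X t ω)) μ :=
  Real.continuous_exp.comp_aestronglyMeasurable (hX.aestronglyMeasurable hFm ht).neg

theorem continuous_exp_neg (hX : ExpProcess F μ T H K X) :
    ∀ᵐ ω ∂μ, ContinuousOn (fun t => Real.exp (-X t ω)) (Icc 0 T) := by
  filter_upwards [hX.continuous] with ω hω
  exact Real.continuous_exp.comp_continuousOn hω.neg

theorem eLpNorm_exp_neg_sub_le (hX : ExpProcess F μ T H K X) (hFm : ∀ t ∈ Icc 0 T, F t ≤ mΩ)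
    (hK : ∀ p, 0 ≤ K p) {p : ℝ} (hp : 1 ≤ p) {s t : ℝ} (hs : s ∈ Icc 0 T) (ht : t ∈ Icc s T) :
    eLpNorm ((fun ω => Real.exp (-X t ω)) - fun ω => Real.exp (-X s ω)) (ENNReal.ofReal p) μ
      ≤ ENNReal.ofReal (2 * K (2 * p) ^ 2 * (t - s) ^ H) := by
  have ht' : t ∈ Icc 0 T := ⟨hs.1.trans ht.1, ht.2⟩
  have h2p : 1 ≤ 2 * p := by linarith
  refine (eLpNorm_exp_sub_exp_le (hX.aestronglyMeasurable hFm ht').neg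
    (hX.aestronglyMeasurable hFm hs).neg hp).trans ?_
  have h1 : (-X t) - (-X s) = -(X t - X s) := by ring
  have hd : 0 ≤ (t - s) ^ H := Real.rpow_nonneg (by linarith [ht.1]) _
  rw [h1, eLpNorm_neg]
  refine (mul_le_mul' (hX.increment _ h2p s hs t ht)
    (add_le_add (hX.exp_neg _ h2p t ht') (hX.exp_neg _ h2p s hs))).trans (le_of_eq ?_)
  rw [← ENNReal.ofReal_add (hK _) (hK _), ← ENNReal.ofReal_mul (mul_nonneg (hK _) hd)]
  congr 1
  ring

theorem exists_supMoment_exp_neg_le (hT : 0 < T) (hH : 1 / 2 < H)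
    (hFm : ∀ t ∈ Icc 0 T, F t ≤ mΩ) (hK : ∀ p, 0 ≤ K p) {p : ℝ} (hp : 2 ≤ p) :
    ∃ D : ℝ≥0∞, D < ∞ ∧ ∀ X, ExpProcess F μ T H K X →
      supMoment μ T p (fun t ω => Real.exp (-X t ω)) ≤ D := by
  have hp1 : 1 ≤ p := by linarith
  obtain ⟨m, hm⟩ := exists_supMoment_le (μ := μ) hT (C := 2 * K (2 * p) ^ 2) (by positivity) hp hH
    one_pos
  refine ⟨(∑ _i ∈ Finset.range (2 ^ m + 1), ENNReal.ofReal (K p) + ENNReal.ofReal 1) ^ p,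
    ENNReal.rpow_lt_top_of_nonneg (by linarith) ?_, fun X hX => ?_⟩
  · exact ENNReal.add_ne_top.2 ⟨by simp [ENNReal.mul_eq_top], ENNReal.ofReal_ne_top⟩
  · refine (hm _ (fun t ht => hX.aestronglyMeasurable_exp_neg hFm ht) hX.continuous_exp_neg
      fun s hs t ht => hX.eLpNorm_exp_neg_sub_le hFm hK hp1 hs ht).trans
      (ENNReal.rpow_le_rpow (add_le_add_left (Finset.sum_le_sum fun i hi => ?_) _) (by linarith))
    exact hX.exp_neg p hp1 _ (gridPt_mem hT.le (by simpa [Nat.lt_succ_iff] using hi))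

theorem tendsto_eLpNorm_exp {ι : Type*} {l : Filter ι} {Xs : ι → ℝ → Ω → ℝ}
    (hFm : ∀ t ∈ Icc 0 T, F t ≤ mΩ) (hX : ExpProcess F μ T H K X)
    (hXs : ∀ᶠ z in l, ExpProcess F μ T H K (Xs z)) {t : ℝ} (ht : t ∈ Icc 0 T)
    (hlim : ∀ p, 1 ≤ p →
      Tendsto (fun z => eLpNorm (Xs z t - X t) (ENNReal.ofReal p) μ) l (𝓝 0))
    {p : ℝ} (hp : 1 ≤ p) :
    Tendsto (fun z => eLpNorm (fun ω => Real.exp (Xs z t ω) - Real.exp (X t ω))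
      (ENNReal.ofReal p) μ) l (𝓝 0) ∧
    Tendsto (fun z => eLpNorm (fun ω => Real.exp (-Xs z t ω) - Real.exp (-X t ω))
      (ENNReal.ofReal p) μ) l (𝓝 0) := by
  have h2p : 1 ≤ 2 * p := by linarith
  have h0 : Tendsto (fun z => eLpNorm (Xs z t - X t) (ENNReal.ofReal (2 * p)) μ
      * (ENNReal.ofReal (K (2 * p)) + ENNReal.ofReal (K (2 * p)))) l (𝓝 0) := by
    have := ENNReal.Tendsto.mul_const (b := ENNReal.ofReal (K (2 * p)) + ENNReal.ofReal (K (2 * p)))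
      (hlim (2 * p) h2p) (Or.inr (by simp))
    rwa [zero_mul] at this
  constructor
  · refine tendsto_of_tendsto_of_tendsto_of_le_of_le' tendsto_const_nhds h0
      (Eventually.of_forall fun _ => zero_le) ?_
    filter_upwards [hXs] with z hz
    exact (eLpNorm_exp_sub_exp_le (hz.aestronglyMeasurable hFm ht)
      (hX.aestronglyMeasurable hFm ht) hp).trans
      (mul_le_mul_right (add_le_add (hz.exp _ h2p t ht) (hX.exp _ h2p t ht)) _)
  · refine tendsto_of_tendsto_of_tendsto_of_le_of_le' tendsto_const_nhds h0
      (Eventually.of_forall fun _ => zero_le) ?_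
    filter_upwards [hXs] with z hz
    refine (eLpNorm_exp_sub_exp_le (hz.aestronglyMeasurable hFm ht).neg
      (hX.aestronglyMeasurable hFm ht).neg hp).trans ?_
    have h1 : (-Xs z t) - (-X t) = -(Xs z t - X t) := by ring
    rw [h1, eLpNorm_neg]
    exact mul_le_mul_right (add_le_add (hz.exp_neg _ h2p t ht) (hX.exp_neg _ h2p t ht)) _

end ExpProcess

/-- Kolmogorov's criterion for convergence: processes whose increments are uniformly controlled, and
which tend to zero at every time, tend to zero uniformly in time. -/
theorem tendsto_supMoment_of_increments {T : ℝ} (hT : 0 < T) {C p H : ℝ} (hC : 0 ≤ C) (hp : 2 ≤ p)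
    (hH : 1 / 2 < H) {ι : Type*} {l : Filter ι} {U : ι → ℝ → Ω → ℝ}
    (hm : ∀ᶠ z in l, ∀ t ∈ Icc 0 T, AEStronglyMeasurable (U z t) μ)
    (hc : ∀ᶠ z in l, ∀ᵐ ω ∂μ, ContinuousOn (fun t => U z t ω) (Icc 0 T))
    (hinc : ∀ᶠ z in l, ∀ s ∈ Icc 0 T, ∀ t ∈ Icc s T,
      eLpNorm (U z t - U z s) (ENNReal.ofReal p) μ ≤ ENNReal.ofReal (C * (t - s) ^ H))
    (hlim : ∀ t ∈ Icc 0 T, Tendsto (fun z => eLpNorm (U z t) (ENNReal.ofReal p) μ) l (𝓝 0)) :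
    Tendsto (fun z => supMoment μ T p (U z)) l (𝓝 0) := by
  have hp0 : 0 < p := by linarith
  rw [ENNReal.tendsto_nhds_zero]
  intro κ hκ
  have h1 : Tendsto (fun δ : ℝ => (ENNReal.ofReal δ + ENNReal.ofReal δ) ^ p) (𝓝[>] 0) (𝓝 0) := by
    have h2 : Continuous fun δ : ℝ => (ENNReal.ofReal δ + ENNReal.ofReal δ) ^ p :=
      ENNReal.continuous_rpow_const.comp (ENNReal.continuous_ofReal.add ENNReal.continuous_ofReal)
    have h3 := h2.tendsto 0
    rw [ENNReal.ofReal_zero, add_zero, ENNReal.zero_rpow_of_pos hp0] at h3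
    exact h3.mono_left nhdsWithin_le_nhds
  obtain ⟨δ, hδκ, hδ⟩ := ((h1.eventually_le_const hκ).and self_mem_nhdsWithin).exists
  obtain ⟨m, hmδ⟩ := exists_supMoment_le (μ := μ) hT hC hp hH hδ
  have h4 : Tendsto (fun z => ∑ i ∈ Finset.range (2 ^ m + 1),
      eLpNorm (U z (gridPt T m i)) (ENNReal.ofReal p) μ) l (𝓝 0) := by
    have := tendsto_finsetSum (Finset.range (2 ^ m + 1)) fun i hi =>
      hlim _ (gridPt_mem hT.le (n := m) (k := i) (by simpa [Nat.lt_succ_iff] using hi))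
    rwa [Finset.sum_const_zero] at this
  filter_upwards [hm, hc, hinc, h4.eventually_le_const (ENNReal.ofReal_pos.2 hδ)] with z h5 h6 h7 h8
  exact (hmδ _ h5 h6 h7).trans ((ENNReal.rpow_le_rpow (add_le_add_left h8 _) hp0.le).trans hδκ)

/-- Pointwise convergence in time together with increment bounds that are uniform along the family
gives convergence of `exp (-X)` uniformly in time. -/
theorem ExpProcess.tendsto_supMoment_exp_neg {F : ℝ → MeasurableSpace Ω} {T H : ℝ} {K : ℝ → ℝ}
    {X : ℝ → Ω → ℝ} (hT : 0 < T) (hH : 1 / 2 < H) {ι : Type*} {l : Filter ι}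
    {Xs : ι → ℝ → Ω → ℝ} (hFm : ∀ t ∈ Icc 0 T, F t ≤ mΩ) (hK : ∀ p, 0 ≤ K p)
    (hX : ExpProcess F μ T H K X) (hXs : ∀ᶠ z in l, ExpProcess F μ T H K (Xs z))
    (hlim : ∀ p, 1 ≤ p → ∀ t ∈ Icc 0 T,
      Tendsto (fun z => eLpNorm (Xs z t - X t) (ENNReal.ofReal p) μ) l (𝓝 0))
    {p : ℝ} (hp : 2 ≤ p) :
    Tendsto (fun z => supMoment μ T p fun t ω => Real.exp (-Xs z t ω) - Real.exp (-X t ω))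
      l (𝓝 0) := by
  have hp1 : 1 ≤ p := by linarith
  refine tendsto_supMoment_of_increments hT (C := 4 * K (2 * p) ^ 2) (by positivity) hp hH
    ?_ ?_ ?_ fun t ht => (ExpProcess.tendsto_eLpNorm_exp hFm hX hXs ht
      (fun p hp => hlim p hp t ht) hp1).2
  · filter_upwards [hXs] with z hz t ht
    exact (hz.aestronglyMeasurable_exp_neg hFm ht).sub (hX.aestronglyMeasurable_exp_neg hFm ht)
  · filter_upwards [hXs] with z hz
    filter_upwards [hz.continuous_exp_neg, hX.continuous_exp_neg] with ω h1 h2 using h1.sub h2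
  · filter_upwards [hXs] with z hz s hs t ht
    have ht' : t ∈ Icc 0 T := ⟨hs.1.trans ht.1, ht.2⟩
    have e1 : ((fun ω => Real.exp (-Xs z t ω) - Real.exp (-X t ω))
        - fun ω => Real.exp (-Xs z s ω) - Real.exp (-X s ω))
        = ((fun ω => Real.exp (-Xs z t ω)) - fun ω => Real.exp (-Xs z s ω))
          - ((fun ω => Real.exp (-X t ω)) - fun ω => Real.exp (-X s ω)) := by
      ext ω
      simp only [Pi.sub_apply]
      ring
    have hd : 0 ≤ (t - s) ^ H := Real.rpow_nonneg (by linarith [ht.1]) _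
    rw [e1]
    refine (eLpNorm_sub_le
      ((hz.aestronglyMeasurable_exp_neg hFm ht').sub (hz.aestronglyMeasurable_exp_neg hFm hs))
      ((hX.aestronglyMeasurable_exp_neg hFm ht').sub (hX.aestronglyMeasurable_exp_neg hFm hs))
      (by rw [ENNReal.one_le_ofReal]; exact hp1)).trans
      ((add_le_add (hz.eLpNorm_exp_neg_sub_le hFm hK hp1 hs ht)
        (hX.eLpNorm_exp_neg_sub_le hFm hK hp1 hs ht)).trans (le_of_eq ?_))
    rw [← ENNReal.ofReal_add (by positivity) (by positivity)]
    congr 1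
    ring

end FracBSDE

/-! ### Conditional expectations of exponential functionals -/

namespace FracBSDE

variable {Ω : Type*} [mΩ : MeasurableSpace Ω] {μ : Measure Ω} {F : ℝ → MeasurableSpace Ω} {T : ℝ}

/-- An almost surely continuous process each of whose variables is almost surely equal to an adapted
one has a version that is adapted in the strict sense. The filtration need not contain the null
sets: the version is the upper limit of the values at the dyadic times before `t`. -/
theorem exists_adapted_version (hT : 0 < T) (hF : ∀ s ∈ Icc 0 T, ∀ t ∈ Icc s T, F s ≤ F t)
    {ψ : ℝ → Ω → ℝ} (hc : ∀ᵐ ω ∂μ, ContinuousOn (fun t => ψ t ω) (Icc 0 T))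
    (hψ : ∀ t ∈ Icc 0 T, AEStronglyMeasurable[F t] (ψ t) μ) :
    ∃ ψ' : ℝ → Ω → ℝ, (∀ t ∈ Icc 0 T, Measurable[F t] (ψ' t)) ∧
      ∀ᵐ ω ∂μ, ∀ t ∈ Icc 0 T, ψ' t ω = ψ t ω := by
  have h1 : ∀ t ∈ Icc 0 T, ∃ g : Ω → ℝ, StronglyMeasurable[F t] g ∧ ψ t =ᵐ[μ] g := hψ
  choose! g hgm hg using h1
  refine ⟨fun t ω => limsup (fun n => g (gridPt T n (gridFloor T t n)) ω) atTop,
    fun t ht => Measurable.limsup fun n => ?_, ?_⟩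
  · have h2 := gridPt_mem hT.le (gridFloor_le hT ht n)
    exact (hgm _ h2).measurable.mono (hF _ h2 _ ⟨gridPt_gridFloor_le hT ht n, ht.2⟩) le_rfl
  · have h2 : ∀ᵐ ω ∂μ, ∀ n, ∀ k ∈ Finset.range (2 ^ n + 1),
        ψ (gridPt T n k) ω = g (gridPt T n k) ω :=
      ae_all_iff.2 fun n => (ae_ball_iff (Finset.countable_toSet _)).2 fun k hk =>
        hg _ (gridPt_mem hT.le (by simpa [Nat.lt_succ_iff] using hk))
    filter_upwards [h2, hc] with ω h3 h4 t ht
    refine Tendsto.limsup_eq ?_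
    refine ((h4 t ht).tendsto.comp (tendsto_gridPt_gridFloor hT ht)).congr fun n => ?_
    exact h3 n _ (by simpa [Nat.lt_succ_iff] using gridFloor_le hT ht n)

/-- The maximal inequality, with the norm of the terminal value on the right-hand side. -/
theorem supMoment_le_eLpNorm_rpow [IsProbabilityMeasure μ] (hT : 0 < T)
    (hF : ∀ s ∈ Icc 0 T, ∀ t ∈ Icc s T, F s ≤ F t) (hFm : ∀ t ∈ Icc 0 T, F t ≤ mΩ) {X : Ω → ℝ}
    {p r : ℝ} (hp : 0 < p) (hpr : p < r) (hr : 1 ≤ r) (hX : MemLp X (ENNReal.ofReal r) μ)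
    {Z : ℝ → Ω → ℝ} (hc : ∀ᵐ ω ∂μ, ContinuousOn (fun t => Z t ω) (Icc 0 T))
    (hZ : ∀ t ∈ Icc 0 T, Z t =ᵐ[μ] μ[X|F t]) :
    supMoment μ T p Z ≤ ENNReal.ofReal (r / (r - p)) * eLpNorm X (ENNReal.ofReal r) μ ^ p := by
  have h0 : 0 ≤ r / (r - p) := div_nonneg (by linarith) (by linarith)
  have h1 : ∀ δ : ℝ, 0 < δ → supMoment μ T p Z ≤ ENNReal.ofReal (r / (r - p))
      * (eLpNorm X (ENNReal.ofReal r) μ + ENNReal.ofReal δ) ^ p := by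
    intro δ hδ
    have hx : 0 < (eLpNorm X (ENNReal.ofReal r) μ).toReal + δ := by positivity
    have hx' : ENNReal.ofReal ((eLpNorm X (ENNReal.ofReal r) μ).toReal + δ)
        = eLpNorm X (ENNReal.ofReal r) μ + ENNReal.ofReal δ := by
      rw [ENNReal.ofReal_add ENNReal.toReal_nonneg hδ.le, ENNReal.ofReal_toReal hX.2.ne]
    have h2 := supMoment_le_of_condExp hT hF hFm hp hpr hr hX hx (by rw [hx']; exact le_self_add)
      hc hZ
    rwa [ENNReal.ofReal_mul h0, ← ENNReal.ofReal_rpow_of_pos hx, hx'] at h2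
  have h2 : Tendsto (fun δ : ℝ => ENNReal.ofReal (r / (r - p))
      * (eLpNorm X (ENNReal.ofReal r) μ + ENNReal.ofReal δ) ^ p) (𝓝[>] 0)
      (𝓝 (ENNReal.ofReal (r / (r - p)) * (eLpNorm X (ENNReal.ofReal r) μ + 0) ^ p)) := by
    refine ENNReal.Tendsto.const_mul ?_ (Or.inr ENNReal.ofReal_ne_top)
    refine (ENNReal.continuous_rpow_const.tendsto _).comp (tendsto_const_nhds.add ?_)
    have := ENNReal.continuous_ofReal.tendsto 0
    rw [ENNReal.ofReal_zero] at this
    exact this.mono_left nhdsWithin_le_nhds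
  rw [add_zero] at h2
  exact ge_of_tendsto h2 (eventually_mem_nhdsWithin.mono fun δ hδ => h1 δ hδ)

/-- Hölder's inequality with a factor in `Lᑫ`. -/
theorem eLpNorm_mul_le_of_lt {ξ g : Ω → ℝ} (hξ : AEStronglyMeasurable ξ μ)
    (hg : AEStronglyMeasurable g μ) {p q : ℝ} (hp : 1 ≤ p) (hpq : p < q) :
    eLpNorm (fun ω => ξ ω * g ω) (ENNReal.ofReal p) μ
      ≤ eLpNorm ξ (ENNReal.ofReal q) μ * eLpNorm g (ENNReal.ofReal (p * q / (q - p))) μ := by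
  have h1 : q - p ≠ 0 := by linarith
  have h2 : p ≠ 0 := by linarith
  have h3 : q ≠ 0 := by linarith
  refine eLpNorm_mul_le_real hξ hg (by linarith) hpq ?_
  field_simp
  ring

theorem one_le_mul_div_sub {p q : ℝ} (hp : 1 ≤ p) (hpq : p < q) : 1 ≤ p * q / (q - p) := by
  rw [le_div_iff₀ (by linarith)]
  nlinarith

/-- For `p < q` there are Hölder exponents `a < q` and `b ≥ 2` with `1 / p = 1 / b + 1 / a`. -/
theorem exists_holder_exponents {p q : ℝ} (hp : 1 ≤ p) (hpq : p < q) :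
    ∃ a b : ℝ, p < a ∧ a < q ∧ 2 ≤ b ∧ p < b ∧ 1 / p = 1 / b + 1 / a := by
  obtain ⟨a, ha⟩ : ∃ a, a = min ((p + q) / 2) (2 * p) := ⟨_, rfl⟩
  have h1 : a ≤ 2 * p := ha ▸ min_le_right _ _
  have h2 : a ≤ (p + q) / 2 := ha ▸ min_le_left _ _
  have h3 : p < a := ha ▸ lt_min (by linarith) (by linarith)
  have h4 : a - p ≠ 0 := by linarith
  have h5 : p ≠ 0 := by linarith
  have h6 : a ≠ 0 := by linarith
  refine ⟨a, p * a / (a - p), h3, by linarith, ?_, ?_, ?_⟩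
  · rw [le_div_iff₀ (by linarith)]
    nlinarith
  · rw [lt_div_iff₀ (by linarith)]
    nlinarith
  · field_simp
    ring

/-- `Y` is an adapted version of the process `e^{-X_t} M_t`, where `M` is a continuous version of
the martingale `t ↦ E[ξ e^{X_T} | F_t]`; thus `Y_t = E[ξ e^{X_T - X_t} | F_t]`. -/
structure IsExpSolution (F : ℝ → MeasurableSpace Ω) (μ : Measure Ω) (T : ℝ) (ξ : Ω → ℝ)
    (X Y M : ℝ → Ω → ℝ) : Prop where
  adapted : ∀ t ∈ Icc 0 T, Measurable[F t] (Y t)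
  continuous : ∀ᵐ ω ∂μ, ContinuousOn (fun t => M t ω) (Icc 0 T)
  condExp : ∀ t ∈ Icc 0 T, M t =ᵐ[μ] μ[fun ω => ξ ω * Real.exp (X T ω) | F t]
  eq : ∀ᵐ ω ∂μ, ∀ t ∈ Icc 0 T, Y t ω = Real.exp (-X t ω) * M t ω

variable {H : ℝ} {K : ℝ → ℝ} {ξ : Ω → ℝ} {q : ℝ} {X Y M : ℝ → Ω → ℝ}

namespace ExpProcess

theorem exists_isExpSolution (hX : ExpProcess F μ T H K X) (hT : 0 < T)
    (hF : ∀ s ∈ Icc 0 T, ∀ t ∈ Icc s T, F s ≤ F t)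
    (hcont : ∀ Z : Ω → ℝ, HasContCondExp F μ T Z) (ξ : Ω → ℝ) :
    ∃ Y M, IsExpSolution F μ T ξ X Y M := by
  obtain ⟨M, hMc, hM⟩ := hcont fun ω => ξ ω * Real.exp (X T ω)
  obtain ⟨Y, hYm, hY⟩ := exists_adapted_version hT hF
    (ψ := fun t ω => Real.exp (-X t ω) * M t ω) (μ := μ) (by
      filter_upwards [hX.continuous, hMc] with ω h1 h2
      exact (Real.continuous_exp.comp_continuousOn h1.neg).mul h2) fun t ht => by
      refine AEStronglyMeasurable.mul
        (Real.continuous_exp.comp_aestronglyMeasurable (hX.adapted t ht).neg) ?_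
      exact (stronglyMeasurable_condExp.aestronglyMeasurable).congr (hM t ht).symm
  exact ⟨Y, M, hYm, hMc, hM, hY⟩

theorem eLpNorm_mul_exp_le (hX : ExpProcess F μ T H K X) (hT : 0 < T)
    (hFm : ∀ t ∈ Icc 0 T, F t ≤ mΩ) (hξ : MemLp ξ (ENNReal.ofReal q) μ) {p : ℝ} (hp : 1 ≤ p)
    (hpq : p < q) :
    eLpNorm (fun ω => ξ ω * Real.exp (X T ω)) (ENNReal.ofReal p) μ
      ≤ eLpNorm ξ (ENNReal.ofReal q) μ * ENNReal.ofReal (K (p * q / (q - p))) := by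
  have hT' : T ∈ Icc 0 T := ⟨hT.le, le_rfl⟩
  exact (eLpNorm_mul_le_of_lt hξ.1 (Real.continuous_exp.comp_aestronglyMeasurable
    (hX.aestronglyMeasurable hFm hT')) hp hpq).trans
    (mul_le_mul_right (hX.exp _ (one_le_mul_div_sub hp hpq) T hT') _)

theorem memLp_mul_exp (hX : ExpProcess F μ T H K X) (hT : 0 < T)
    (hFm : ∀ t ∈ Icc 0 T, F t ≤ mΩ) (hξ : MemLp ξ (ENNReal.ofReal q) μ) {p : ℝ} (hp : 1 ≤ p)
    (hpq : p < q) : MemLp (fun ω => ξ ω * Real.exp (X T ω)) (ENNReal.ofReal p) μ :=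
  ⟨hξ.1.mul (Real.continuous_exp.comp_aestronglyMeasurable
    (hX.aestronglyMeasurable hFm ⟨hT.le, le_rfl⟩)),
    (hX.eLpNorm_mul_exp_le hT hFm hξ hp hpq).trans_lt (ENNReal.mul_lt_top hξ.2 (by simp))⟩

theorem memLp_exp_neg (hX : ExpProcess F μ T H K X) (hFm : ∀ t ∈ Icc 0 T, F t ≤ mΩ) {p : ℝ}
    (hp : 1 ≤ p) {t : ℝ} (ht : t ∈ Icc 0 T) :
    MemLp (fun ω => Real.exp (-X t ω)) (ENNReal.ofReal p) μ :=
  ⟨hX.aestronglyMeasurable_exp_neg hFm ht, (hX.exp_neg p hp t ht).trans_lt (by simp)⟩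

end ExpProcess

namespace IsExpSolution

theorem aemeasurable (hY : IsExpSolution F μ T ξ X Y M) (hFm : ∀ t ∈ Icc 0 T, F t ≤ mΩ) {t : ℝ}
    (ht : t ∈ Icc 0 T) : AEMeasurable (M t) μ :=
  (stronglyMeasurable_condExp.mono (hFm t ht)).measurable.aemeasurable.congr
    (hY.condExp t ht).symm

theorem continuous_solution (hY : IsExpSolution F μ T ξ X Y M) (hX : ExpProcess F μ T H K X) :
    ∀ᵐ ω ∂μ, ContinuousOn (fun t => Y t ω) (Icc 0 T) := by
  filter_upwards [hY.continuous, hX.continuous_exp_neg, hY.eq] with ω h1 h2 h3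
  exact (h2.mul h1).congr h3

theorem isCondExpVersion [IsProbabilityMeasure μ] (hY : IsExpSolution F μ T ξ X Y M)
    (hX : ExpProcess F μ T H K X) (hT : 0 < T) (hFm : ∀ t ∈ Icc 0 T, F t ≤ mΩ) (hq : 2 < q)
    (hξ : MemLp ξ (ENNReal.ofReal q) μ) {V : ℝ → Ω → ℝ}
    (hV : ∀ t ∈ Icc 0 T, V t =ᵐ[μ] X T - X t) : IsCondExpVersion F μ T ξ V Y := by
  intro t ht
  have e1 : (fun ω => ξ ω * Real.exp (V t ω)) =ᵐ[μ]
      (fun ω => Real.exp (-X t ω)) * fun ω => ξ ω * Real.exp (X T ω) := by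
    filter_upwards [hV t ht] with ω hω
    rw [hω, Pi.mul_apply, Pi.sub_apply, sub_eq_add_neg, Real.exp_add]
    ring
  have h1 := hX.memLp_mul_exp hT hFm hξ (p := 2) (by norm_num) hq
  have h2 := hX.memLp_exp_neg hFm (p := 2) (by norm_num) ht
  rw [ENNReal.ofReal_ofNat] at h1 h2
  have h3 := h2.integrable_mul h1
  refine ⟨h3.congr e1.symm, ?_⟩
  have h4 := condExp_mul_of_aestronglyMeasurable_left (m := F t)
    (Real.continuous_exp.comp_aestronglyMeasurable (hX.adapted t ht).neg) h3
    (h1.integrable (by norm_num))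
  filter_upwards [h4, condExp_congr_ae (m := F t) e1, hY.eq, hY.condExp t ht] with ω h5 h6 h7 h8
  rw [h6, h7 t ht, h8]
  exact h5.symm

/-- Moments of the maximum of the martingale part, uniformly over the class of processes. -/
theorem supMoment_martingale_le [IsProbabilityMeasure μ] (hY : IsExpSolution F μ T ξ X Y M)
    (hX : ExpProcess F μ T H K X) (hT : 0 < T)
    (hF : ∀ s ∈ Icc 0 T, ∀ t ∈ Icc s T, F s ≤ F t) (hFm : ∀ t ∈ Icc 0 T, F t ≤ mΩ)
    (hξ : MemLp ξ (ENNReal.ofReal q) μ) {p r : ℝ} (hp : 1 ≤ p) (hpr : p < r) (hrq : r < q) :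
    supMoment μ T p M ≤ ENNReal.ofReal (r / (r - p))
      * (eLpNorm ξ (ENNReal.ofReal q) μ * ENNReal.ofReal (K (r * q / (q - r)))) ^ p := by
  have hr : 1 ≤ r := hp.trans hpr.le
  exact (supMoment_le_eLpNorm_rpow hT hF hFm (by linarith) hpr hr
    (hX.memLp_mul_exp hT hFm hξ hr hrq) hY.continuous hY.condExp).trans
    (mul_le_mul_right (ENNReal.rpow_le_rpow (hX.eLpNorm_mul_exp_le hT hFm hξ hr hrq)
      (by linarith)) _)

theorem memSp [IsProbabilityMeasure μ] (hY : IsExpSolution F μ T ξ X Y M)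
    (hX : ExpProcess F μ T H K X) (hT : 0 < T) (hH : 1 / 2 < H) (hK : ∀ p, 0 ≤ K p)
    (hF : ∀ s ∈ Icc 0 T, ∀ t ∈ Icc s T, F s ≤ F t) (hFm : ∀ t ∈ Icc 0 T, F t ≤ mΩ)
    (hξ : MemLp ξ (ENNReal.ofReal q) μ) {p : ℝ} (hp : 1 ≤ p) (hpq : p < q) :
    MemSp F μ T p Y := by
  refine ⟨hY.adapted, hY.continuous_solution hX, ?_⟩
  obtain ⟨a, b, hpa, haq, hb, hpb, hba⟩ := exists_holder_exponents hp hpq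
  have hp0 : 0 < p := by linarith
  obtain ⟨D, hD, hDX⟩ := ExpProcess.exists_supMoment_exp_neg_le (μ := μ) hT hH hFm hK hb
  obtain ⟨r, har, hrq⟩ := exists_between haq
  rw [supMoment_congr hY.eq]
  refine (supMoment_mul_le hT hX.continuous_exp_neg
    (fun t ht => (hX.aestronglyMeasurable_exp_neg hFm ht).aemeasurable) hY.continuous
    (fun t ht => hY.aemeasurable hFm ht) hp0 hpb hba).trans_lt (ENNReal.mul_lt_top ?_ ?_)
  · exact ENNReal.rpow_lt_top_of_nonneg (by positivity) ((hDX X hX).trans_lt hD).ne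
  · refine ENNReal.rpow_lt_top_of_nonneg (div_nonneg hp0.le (by linarith)) (ne_top_of_le_ne_top ?_
      (hY.supMoment_martingale_le hX hT hF hFm hξ (by linarith) har hrq))
    exact ENNReal.mul_ne_top ENNReal.ofReal_ne_top (ENNReal.rpow_ne_top_of_nonneg (by linarith)
      (ENNReal.mul_ne_top hξ.2.ne ENNReal.ofReal_ne_top))

/-- The maximal inequality reduces uniform convergence of the martingales to convergence of their
terminal values `ξ e^{X_T}` in `Lʳ`. -/
theorem tendsto_supMoment_martingale [IsProbabilityMeasure μ] {ι : Type*} {l : Filter ι}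
    {Xs Ys Ms : ι → ℝ → Ω → ℝ} (hY : IsExpSolution F μ T ξ X Y M)
    (hYs : ∀ᶠ z in l, IsExpSolution F μ T ξ (Xs z) (Ys z) (Ms z))
    (hX : ExpProcess F μ T H K X) (hXs : ∀ᶠ z in l, ExpProcess F μ T H K (Xs z)) (hT : 0 < T)
    (hF : ∀ s ∈ Icc 0 T, ∀ t ∈ Icc s T, F s ≤ F t) (hFm : ∀ t ∈ Icc 0 T, F t ≤ mΩ)
    (hξ : MemLp ξ (ENNReal.ofReal q) μ)
    (hlim : ∀ p, 1 ≤ p → ∀ t ∈ Icc 0 T,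
      Tendsto (fun z => eLpNorm (Xs z t - X t) (ENNReal.ofReal p) μ) l (𝓝 0))
    {p : ℝ} (hp : 1 ≤ p) (hpq : p < q) :
    Tendsto (fun z => supMoment μ T p fun t ω => Ms z t ω - M t ω) l (𝓝 0) := by
  obtain ⟨r, hpr, hrq⟩ := exists_between hpq
  have hp0 : 0 < p := by linarith
  have hr : 1 ≤ r := by linarith
  have hT' : T ∈ Icc 0 T := ⟨hT.le, le_rfl⟩
  have h1 := (ExpProcess.tendsto_eLpNorm_exp hFm hX hXs hT' (fun p hp => hlim p hp T hT')
    (one_le_mul_div_sub hr hrq)).1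
  have h2 : Tendsto (fun z => ENNReal.ofReal (r / (r - p)) * (eLpNorm ξ (ENNReal.ofReal q) μ
      * eLpNorm (fun ω => Real.exp (Xs z T ω) - Real.exp (X T ω))
        (ENNReal.ofReal (r * q / (q - r))) μ) ^ p) l (𝓝 0) := by
    have h3 := ENNReal.Tendsto.const_mul h1 (Or.inr hξ.2.ne)
    rw [mul_zero] at h3
    have h4 := ENNReal.Tendsto.const_mul (a := ENNReal.ofReal (r / (r - p)))
      ((ENNReal.continuous_rpow_const (y := p)).continuousAt.tendsto.comp h3)
      (Or.inr ENNReal.ofReal_ne_top)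
    rwa [ENNReal.zero_rpow_of_pos hp0, mul_zero] at h4
  refine tendsto_of_tendsto_of_tendsto_of_le_of_le' tendsto_const_nhds h2
    (Eventually.of_forall fun _ => zero_le) ?_
  filter_upwards [hYs, hXs] with z hz hXz
  have h5 := hXz.memLp_mul_exp hT hFm hξ hr hrq
  have h6 := hX.memLp_mul_exp hT hFm hξ hr hrq
  have h1r : (1 : ℝ≥0∞) ≤ ENNReal.ofReal r := by rwa [ENNReal.one_le_ofReal]
  refine (supMoment_le_eLpNorm_rpow hT hF hFm hp0 hpr hr (h5.sub h6) (by
    filter_upwards [hz.continuous, hY.continuous] with ω h7 h8 using h7.sub h8) fun t ht => by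
    filter_upwards [hz.condExp t ht, hY.condExp t ht, condExp_sub (h5.integrable h1r)
      (h6.integrable h1r) (F t)] with ω h7 h8 h9
    rw [h7, h8, h9, Pi.sub_apply]).trans
    (mul_le_mul_right (ENNReal.rpow_le_rpow ?_ hp0.le) _)
  refine le_trans (le_of_eq ?_) (eLpNorm_mul_le_of_lt hξ.1
    ((Real.continuous_exp.comp_aestronglyMeasurable (hXz.aestronglyMeasurable hFm hT')).sub
      (Real.continuous_exp.comp_aestronglyMeasurable (hX.aestronglyMeasurable hFm hT'))) hr hrq)
  congr 1
  ext ω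
  simp only [Pi.sub_apply, mul_sub]

/-- Stability of `Y = exp (-X) * M`: both factors converge in the supremum moments, and the
difference of products is estimated by Hölder's inequality with exponents that use `p < q`. -/
theorem tendsto_supMoment_sub [IsProbabilityMeasure μ] {ι : Type*} {l : Filter ι}
    {Xs Ys Ms : ι → ℝ → Ω → ℝ} (hY : IsExpSolution F μ T ξ X Y M)
    (hYs : ∀ᶠ z in l, IsExpSolution F μ T ξ (Xs z) (Ys z) (Ms z))
    (hX : ExpProcess F μ T H K X) (hXs : ∀ᶠ z in l, ExpProcess F μ T H K (Xs z)) (hT : 0 < T)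
    (hH : 1 / 2 < H) (hK : ∀ p, 0 ≤ K p)
    (hF : ∀ s ∈ Icc 0 T, ∀ t ∈ Icc s T, F s ≤ F t) (hFm : ∀ t ∈ Icc 0 T, F t ≤ mΩ)
    (hξ : MemLp ξ (ENNReal.ofReal q) μ)
    (hlim : ∀ p, 1 ≤ p → ∀ t ∈ Icc 0 T,
      Tendsto (fun z => eLpNorm (Xs z t - X t) (ENNReal.ofReal p) μ) l (𝓝 0))
    {p : ℝ} (hp : 1 ≤ p) (hpq : p < q) :
    Tendsto (fun z => supMoment μ T p fun t ω => Ys z t ω - Y t ω) l (𝓝 0) := by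
  obtain ⟨a, b, hpa, haq, hb, hpb, hba⟩ := exists_holder_exponents hp hpq
  have hp0 : 0 < p := by linarith
  have ha0 : 0 < a := by linarith
  have hb0 : 0 < b := by linarith
  obtain ⟨D, hD, hDX⟩ := ExpProcess.exists_supMoment_exp_neg_le (μ := μ) hT hH hFm hK hb
  obtain ⟨r, har, hrq⟩ := exists_between haq
  have hM := tendsto_supMoment_martingale hY hYs hX hXs hT hF hFm hξ hlim (by linarith) haq
  have hE := ExpProcess.tendsto_supMoment_exp_neg hT hH hFm hK hX hXs hlim hb
  obtain ⟨D', hD', hDM⟩ : ∃ D' : ℝ≥0∞, D' ≠ ∞ ∧ ∀ᶠ z in l, supMoment μ T a (Ms z) ≤ D' := by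
    refine ⟨_, ?_, (hYs.and hXs).mono fun z hz =>
      hz.1.supMoment_martingale_le hz.2 hT hF hFm hξ (by linarith) har hrq⟩
    exact ENNReal.mul_ne_top ENNReal.ofReal_ne_top (ENNReal.rpow_ne_top_of_nonneg (by linarith)
      (ENNReal.mul_ne_top hξ.2.ne ENNReal.ofReal_ne_top))
  have hpow : ∀ {c : ℝ} {f : ι → ℝ≥0∞}, 0 < c → Tendsto f l (𝓝 0) →
      Tendsto (fun z => f z ^ c) l (𝓝 0) := by
    intro c f hc hf
    have := (ENNReal.continuous_rpow_const (y := c)).continuousAt.tendsto.comp hf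
    rwa [ENNReal.zero_rpow_of_pos hc] at this
  have hlim' : Tendsto (fun z => 2 ^ (p - 1) *
      ((supMoment μ T b fun t ω => Real.exp (-Xs z t ω) - Real.exp (-X t ω)) ^ (p / b)
          * D' ^ (p / a)
        + D ^ (p / b) * (supMoment μ T a fun t ω => Ms z t ω - M t ω) ^ (p / a))) l (𝓝 0) := by
    have h1 := ENNReal.Tendsto.mul_const (b := D' ^ (p / a)) (hpow (div_pos hp0 hb0) hE)
      (Or.inr (ENNReal.rpow_ne_top_of_nonneg (by positivity) hD'))
    have h2 := ENNReal.Tendsto.const_mul (a := D ^ (p / b)) (hpow (div_pos hp0 ha0) hM)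
      (Or.inr (ENNReal.rpow_ne_top_of_nonneg (by positivity) hD.ne))
    have h3 := ENNReal.Tendsto.const_mul (a := 2 ^ (p - 1)) (h1.add h2)
      (Or.inr (ENNReal.rpow_ne_top_of_nonneg (by linarith) (by norm_num)))
    simpa only [zero_mul, mul_zero, add_zero] using h3
  refine tendsto_of_tendsto_of_tendsto_of_le_of_le' tendsto_const_nhds hlim'
    (Eventually.of_forall fun _ => zero_le) ?_
  filter_upwards [hYs, hXs, hDM] with z hz hXz hMz
  -- `Y^z - Y = (e^{-X^z} - e^{-X}) M^z + e^{-X} (M^z - M)`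
  have e1 : ∀ᵐ ω ∂μ, ∀ t ∈ Icc 0 T, Ys z t ω - Y t ω
      = (Real.exp (-Xs z t ω) - Real.exp (-X t ω)) * Ms z t ω
        + Real.exp (-X t ω) * (Ms z t ω - M t ω) := by
    filter_upwards [hY.eq, hz.eq] with ω h1 h2 t ht
    rw [h1 t ht, h2 t ht]
    ring
  have hEc : ∀ᵐ ω ∂μ, ContinuousOn
      (fun t => Real.exp (-Xs z t ω) - Real.exp (-X t ω)) (Icc 0 T) := by
    filter_upwards [hXz.continuous_exp_neg, hX.continuous_exp_neg] with ω h1 h2 using h1.sub h2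
  have hEm : ∀ t ∈ Icc 0 T, AEMeasurable
      (fun ω => Real.exp (-Xs z t ω) - Real.exp (-X t ω)) μ := fun t ht =>
    ((hXz.aestronglyMeasurable_exp_neg hFm ht).sub
      (hX.aestronglyMeasurable_exp_neg hFm ht)).aemeasurable
  have hMc : ∀ᵐ ω ∂μ, ContinuousOn (fun t => Ms z t ω - M t ω) (Icc 0 T) := by
    filter_upwards [hz.continuous, hY.continuous] with ω h1 h2 using h1.sub h2
  rw [supMoment_congr e1]
  refine (supMoment_add_le hT (by
      filter_upwards [hEc, hz.continuous] with ω h1 h2 using h1.mul h2)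
    (fun t ht => (hEm t ht).mul (hz.aemeasurable hFm ht)) hp).trans
    (mul_le_mul_right (add_le_add ?_ ?_) _)
  · exact (supMoment_mul_le hT hEc hEm hz.continuous (fun t ht => hz.aemeasurable hFm ht) hp0 hpb
      hba).trans (mul_le_mul_right (ENNReal.rpow_le_rpow hMz (by positivity)) _)
  · exact (supMoment_mul_le hT hX.continuous_exp_neg
      (fun t ht => (hX.aestronglyMeasurable_exp_neg hFm ht).aemeasurable) hMc
      (fun t ht => (hz.aemeasurable hFm ht).sub (hY.aemeasurable hFm ht)) hp0 hpb hba).trans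
      (mul_le_mul_left (ENNReal.rpow_le_rpow (hDX X hX) (by positivity)) _)

end IsExpSolution

end FracBSDE

/-! ### The nonlinear integral as a process -/

namespace FracBSDE

section Limit

variable {Ω : Type*} [mΩ : MeasurableSpace Ω] {μ : Measure Ω} {F : ℝ → MeasurableSpace Ω}
  {T H : ℝ} {K : ℝ → ℝ}

/-- An almost sure limit of almost surely `F`-measurable variables is almost surely
`F`-measurable. -/
theorem aestronglyMeasurable_of_tendsto {Ω : Type*} {m mΩ : MeasurableSpace Ω} {μ : Measure Ω}
    {f : ℕ → Ω → ℝ} {g : Ω → ℝ} (hf : ∀ n, AEStronglyMeasurable[m] (f n) μ)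
    (hlim : ∀ᵐ ω ∂μ, Tendsto (fun n => f n ω) atTop (𝓝 (g ω))) : AEStronglyMeasurable[m] g μ := by
  have hf' : ∀ n, ∃ h : Ω → ℝ, StronglyMeasurable[m] h ∧ f n =ᵐ[μ] h := hf
  choose h hm hfh using hf'
  refine ⟨fun ω => limsup (fun n => h n ω) atTop,
    (Measurable.limsup fun n => (hm n).measurable).stronglyMeasurable, ?_⟩
  filter_upwards [hlim, ae_all_iff.2 hfh] with ω h1 h2
  exact (Tendsto.limsup_eq (h1.congr h2)).symm

/-- A family of exponential processes that is Cauchy in every `Lᵖ` at each time has a limit, which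
is again an exponential process with the same bounds. -/
theorem ExpProcess.exists_limit (hT : 0 < T) (hH : 1 / 2 < H) (hFm : ∀ t ∈ Icc 0 T, F t ≤ mΩ)
    (hK : ∀ p, 0 ≤ K p) {ι : Type*} {l : Filter ι} [l.NeBot] [l.IsCountablyGenerated]
    {Xs : ι → ℝ → Ω → ℝ} (hXs : ∀ᶠ z in l, ExpProcess F μ T H K (Xs z))
    (hcau : ∀ p, 1 ≤ p → ∀ t ∈ Icc 0 T, Tendsto (fun z : ι × ι =>
      eLpNorm (Xs z.1 t - Xs z.2 t) (ENNReal.ofReal p) μ) (l ×ˢ l) (𝓝 0)) :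
    ∃ X, ExpProcess F μ T H K X ∧ ∀ p, 1 ≤ p → ∀ t ∈ Icc 0 T,
      Tendsto (fun z => eLpNorm (Xs z t - X t) (ENNReal.ofReal p) μ) l (𝓝 0) := by
  have hsup : Tendsto (fun z : ι × ι => supMoment μ T 2 (Xs z.1 - Xs z.2)) (l ×ˢ l) (𝓝 0) := by
    have hXX := hXs.prod_mk hXs
    refine tendsto_supMoment_of_increments hT (C := 2 * K 2) (by linarith [hK 2]) le_rfl hH
      ?_ ?_ ?_ (hcau 2 (by norm_num))
    · filter_upwards [hXX] with z hz t ht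
      exact (hz.1.aestronglyMeasurable hFm ht).sub (hz.2.aestronglyMeasurable hFm ht)
    · filter_upwards [hXX] with z hz
      filter_upwards [hz.1.continuous, hz.2.continuous] with ω h1 h2 using h1.sub h2
    · filter_upwards [hXX] with z hz s hs t ht
      have ht' : t ∈ Icc 0 T := ⟨hs.1.trans ht.1, ht.2⟩
      have e1 : (Xs z.1 - Xs z.2) t - (Xs z.1 - Xs z.2) s
          = (Xs z.1 t - Xs z.1 s) - (Xs z.2 t - Xs z.2 s) := by
        simp only [Pi.sub_apply]
        ring
      have hd : 0 ≤ (t - s) ^ H := Real.rpow_nonneg (by linarith [ht.1]) _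
      rw [e1]
      refine (eLpNorm_sub_le
        ((hz.1.aestronglyMeasurable hFm ht').sub (hz.1.aestronglyMeasurable hFm hs))
        ((hz.2.aestronglyMeasurable hFm ht').sub (hz.2.aestronglyMeasurable hFm hs))
        (by rw [ENNReal.one_le_ofReal]; norm_num)).trans
        ((add_le_add (hz.1.increment 2 (by norm_num) s hs t ht)
          (hz.2.increment 2 (by norm_num) s hs t ht)).trans (le_of_eq ?_))
      rw [← ENNReal.ofReal_add (mul_nonneg (hK _) hd) (mul_nonneg (hK _) hd)]
      congr 1
      ring
  obtain ⟨u, hu⟩ := exists_seq_tendsto l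
  have hsub : ∀ n : ℕ, ∀ᶠ k in atTop, ∀ i ≥ k, ExpProcess F μ T H K (Xs (u i)) ∧
      ∀ j ≥ k, supMoment μ T 2 (Xs (u i) - Xs (u j)) ≤ ENNReal.ofReal ((1 / 4) ^ n) ^ (2 : ℝ) := by
    intro n
    have h1 : (0 : ℝ≥0∞) < ENNReal.ofReal ((1 / 4) ^ n) ^ (2 : ℝ) :=
      ENNReal.rpow_pos (by simp) ENNReal.ofReal_ne_top
    have h2 := (hsup.comp (hu.prodMap hu)).eventually_le_const h1
    rw [prod_atTop_atTop_eq, eventually_atTop_prod_self] at h2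
    obtain ⟨k₁, hk₁⟩ := h2
    obtain ⟨k₂, hk₂⟩ := eventually_atTop.1 (hu.eventually hXs)
    filter_upwards [eventually_ge_atTop (max k₁ k₂)] with k hk i hi
    exact ⟨hk₂ i (by omega), fun j hj => hk₁ i j (by omega) (by omega)⟩
  obtain ⟨φ, hφ, hφn⟩ := extraction_forall_of_eventually hsub
  obtain ⟨z, hz⟩ : ∃ z : ℕ → ι, z = u ∘ φ := ⟨_, rfl⟩
  have hzl : Tendsto z atTop l := hz ▸ hu.comp hφ.tendsto_atTop
  have hzX : ∀ n, ExpProcess F μ T H K (Xs (z n)) := fun n => hz ▸ (hφn n _ le_rfl).1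
  have hun := ae_tendstoUniformlyOn hT two_pos (Z := fun n => Xs (z n))
    (fun n => (hzX n).continuous) (fun n t ht => ((hzX n).aestronglyMeasurable hFm ht).aemeasurable)
    fun n => hz ▸ (hφn n _ (hφ.monotone n.le_succ)).2 _ le_rfl
  obtain ⟨X, hX⟩ : ∃ X : ℝ → Ω → ℝ, X = fun t ω => limUnder atTop fun n => Xs (z n) t ω := ⟨_, rfl⟩
  have hXu : ∀ᵐ ω ∂μ, TendstoUniformlyOn (fun n t => Xs (z n) t ω) (fun t => X t ω) atTop
      (Icc 0 T) := by
    filter_upwards [hun] with ω ⟨x, hx⟩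
    rw [hX]
    exact hx.congr_right fun t ht => (hx.tendsto_at ht).limUnder_eq.symm
  have hXt : ∀ t ∈ Icc 0 T, ∀ᵐ ω ∂μ, Tendsto (fun n => Xs (z n) t ω) atTop (𝓝 (X t ω)) := by
    intro t ht
    filter_upwards [hXu] with ω hω using hω.tendsto_at ht
  have hzm : ∀ n, ∀ t ∈ Icc 0 T, AEStronglyMeasurable (Xs (z n) t) μ :=
    fun n t ht => (hzX n).aestronglyMeasurable hFm ht
  refine ⟨X, ⟨?_, ?_, ?_, ?_, ?_⟩, ?_⟩
  · filter_upwards [hXu, ae_all_iff.2 fun n => (hzX n).continuous] with ω h1 h2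
    exact h1.continuousOn (Frequently.of_forall h2)
  · exact fun t ht => aestronglyMeasurable_of_tendsto (fun n => (hzX n).adapted t ht) (hXt t ht)
  · intro p hp s hs t ht
    have ht' : t ∈ Icc 0 T := ⟨hs.1.trans ht.1, ht.2⟩
    refine Lp.eLpNorm_le_of_ae_tendsto (u := atTop)
      (Eventually.of_forall fun n => (hzX n).increment p hp s hs t ht)
      (fun n => (hzm n t ht').sub (hzm n s hs)) ?_
    filter_upwards [hXt t ht', hXt s hs] with ω h1 h2 using h1.sub h2
  · intro p hp t ht
    refine Lp.eLpNorm_le_of_ae_tendsto (u := atTop)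
      (Eventually.of_forall fun n => (hzX n).exp p hp t ht)
      (fun n => Real.continuous_exp.comp_aestronglyMeasurable (hzm n t ht)) ?_
    filter_upwards [hXt t ht] with ω h1 using (Real.continuous_exp.tendsto _).comp h1
  · intro p hp t ht
    refine Lp.eLpNorm_le_of_ae_tendsto (u := atTop)
      (Eventually.of_forall fun n => (hzX n).exp_neg p hp t ht)
      (fun n => Real.continuous_exp.comp_aestronglyMeasurable (hzm n t ht).neg) ?_
    filter_upwards [hXt t ht] with ω h1 using (Real.continuous_exp.tendsto _).comp h1.neg
  · intro p hp t ht
    rw [ENNReal.tendsto_nhds_zero]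
    intro δ hδ
    filter_upwards [((hcau p hp t ht).eventually_le_const hδ).curry, hXs] with w hw hwX
    refine Lp.eLpNorm_le_of_ae_tendsto (u := atTop)
      (hzl.eventually hw)
      (fun n => (hwX.aestronglyMeasurable hFm ht).sub (hzm n t ht)) ?_
    filter_upwards [hXt t ht] with ω h1 using tendsto_const_nhds.sub h1

/-- On a probability space, a norm of real order is bounded by a moment of integer order. -/
theorem eLpNorm_le_lintegral_pow_ceil [IsProbabilityMeasure μ] {f : Ω → ℝ}
    (hf : AEStronglyMeasurable f μ) {p : ℝ} (hp : 1 ≤ p) :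
    eLpNorm f (ENNReal.ofReal p) μ ≤ (∫⁻ ω, ‖f ω‖ₑ ^ ⌈p⌉₊ ∂μ) ^ (1 / (⌈p⌉₊ : ℝ)) := by
  have h1 : p ≤ (⌈p⌉₊ : ℝ) := Nat.le_ceil p
  have h0 : (0 : ℝ) < ⌈p⌉₊ := by linarith
  refine (eLpNorm_le_eLpNorm_of_exponent_le (ENNReal.ofReal_le_ofReal h1) hf).trans ?_
  rw [eLpNorm_le_iff_lintegral _ h0, ← ENNReal.rpow_mul, one_div_mul_cancel h0.ne',
    ENNReal.rpow_one]
  simp only [ENNReal.rpow_natCast]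
  exact le_rfl

/-- A bound on an exponential moment gives a bound on a norm of the exponential. -/
theorem eLpNorm_exp_le {f : Ω → ℝ} {p : ℝ} (hp : 1 ≤ p) {K : ℝ≥0∞} (hK : K < ∞)
    (h : ∫⁻ ω, ENNReal.ofReal (Real.exp (p * f ω)) ∂μ ≤ K) :
    eLpNorm (fun ω => Real.exp (f ω)) (ENNReal.ofReal p) μ ≤ ENNReal.ofReal (1 + K.toReal) := by
  rw [eLpNorm_le_iff_lintegral _ (by linarith)]
  have h1 : ∀ ω, ‖Real.exp (f ω)‖ₑ ^ p = ENNReal.ofReal (Real.exp (p * f ω)) := by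
    intro ω
    rw [Real.enorm_eq_ofReal (Real.exp_pos _).le, ENNReal.ofReal_rpow_of_pos (Real.exp_pos _),
      ← Real.exp_mul, mul_comm]
  have h2 : (1 : ℝ≥0∞) ≤ ENNReal.ofReal (1 + K.toReal) := by
    rw [ENNReal.one_le_ofReal]
    linarith [ENNReal.toReal_nonneg (a := K)]
  simp only [h1]
  refine h.trans (le_trans ?_ (ENNReal.le_rpow_self_of_one_le h2 hp))
  rw [ENNReal.ofReal_add zero_le_one ENNReal.toReal_nonneg, ENNReal.ofReal_toReal hK.ne]
  exact le_add_self

end Limit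

namespace Model

variable {Ω : Type*} [MeasurableSpace Ω] {d : ℕ} {μ : Measure Ω} {T H0 : ℝ}
  {H : Fin d → ℝ} {ρ : (Fin d → ℝ) → ℝ} {C A : ℝ}
  {B b : ℝ → Ω → (Fin d → ℝ)} {W : ℝ → (Fin d → ℝ) → Ω → ℝ} {M : Ω → ℝ}

theorem pathInt_diag_sub_ae_eq [IsProbabilityMeasure μ] (hm : Model μ T H0 H ρ C A B b W M)
    {ε η : ℝ} (hε : 0 < ε) (hη : 0 < η) {s t : ℝ} (hs : s ∈ Icc 0 T) (ht : t ∈ Icc 0 T) :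
    (fun ω => pathInt W b ε η 0 t (ω, ω)) - (fun ω => pathInt W b ε η 0 s (ω, ω))
      =ᵐ[μ] fun ω => pathInt W b ε η s t (ω, ω) := by
  filter_upwards [(ae_of_ae_diagSum (hm.pathInt_eq_sub hε hη)).2] with ω hω
  exact (hω s hs t ht).symm

/-- The integral over `[t, T]` is the difference of two values of the process started at `0`; the
path may be replaced by its everywhere continuous version. -/
theorem integralApprox_ae_eq [IsProbabilityMeasure μ] (hm : Model μ T H0 H ρ C A B b W M)
    {ε η : ℝ} (hε : 0 < ε) (hη : 0 < η) {t : ℝ} (ht : t ∈ Icc 0 T) :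
    integralApprox B W T ε η t =ᵐ[μ]
      (fun ω => pathInt W b ε η 0 T (ω, ω)) - fun ω => pathInt W b ε η 0 t (ω, ω) := by
  refine EventuallyEq.trans ?_
    (hm.pathInt_diag_sub_ae_eq hε hη ht ⟨hm.T_pos.le, le_rfl⟩).symm
  filter_upwards [hm.ae_eq] with ω hω
  refine intervalIntegral.integral_congr fun r hr => ?_
  rw [uIcc_of_le ht.2] at hr
  simp only [hω r ⟨ht.1.trans hr.1, hr.2⟩]

/-- The regularised integrals along the Brownian path are exponential processes, with bounds uniform
in the regularisation parameters as long as `ε` remains bounded. -/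
theorem exists_expProcess [IsProbabilityMeasure μ] (hm : Model μ T H0 H ρ C A B b W M) (E : ℝ) :
    ∃ K : ℝ → ℝ, (∀ p, 0 ≤ K p) ∧ ∀ ε ∈ Ioc 0 E, ∀ η > 0,
      ExpProcess (sigmaF B W) μ T H0 K fun t ω => pathInt W b ε η 0 t (ω, ω) := by
  have h1 : ∀ p : ℝ, ∃ K, 0 ≤ K ∧ (1 ≤ p → ∀ ε ∈ Ioc 0 E, ∀ η > 0, ∀ s ∈ Icc 0 T, ∀ t ∈ Icc s T,
      ∫⁻ ω, ‖pathInt W b ε η s t (ω, ω)‖ₑ ^ ⌈p⌉₊ ∂μ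
        ≤ ENNReal.ofReal (K * ((t - s) ^ H0) ^ ⌈p⌉₊)) := by
    intro p
    by_cases hp : 1 ≤ p
    · obtain ⟨K, hK, h⟩ := hm.exists_lintegral_pathInt_pow_le E
        (k := ⌈p⌉₊) (Nat.ceil_pos.2 (by linarith)).ne'
      exact ⟨K, hK, fun _ => h⟩
    · exact ⟨0, le_rfl, fun h => absurd h hp⟩
  choose K₁ hK₁ hK₁' using h1
  choose K₂ hK₂ hK₂' using hm.exists_lintegral_exp_pathInt_le E
  have h0T : (0 : ℝ) ∈ Icc 0 T := ⟨le_rfl, hm.T_pos.le⟩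
  have hn : ∀ p, 0 ≤ (K₂ p).toReal := fun p => ENNReal.toReal_nonneg
  refine ⟨fun p => (1 + K₁ p) + (1 + (K₂ p).toReal) + (1 + (K₂ (-p)).toReal), fun p => by
    linarith [hK₁ p, hn p, hn (-p)], fun ε hε η hη => ?_⟩
  have hmeas : ∀ t ∈ Icc 0 T, AEStronglyMeasurable (fun ω => pathInt W b ε η 0 t (ω, ω)) μ :=
    fun t ht => (hm.aestronglyMeasurable_sigmaF_pathInt hε.1 hη ht).mono (hm.sigmaF_le ht.2)
  refine ⟨hm.ae_continuousOn_pathInt hε.1 hη,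
    fun t ht => hm.aestronglyMeasurable_sigmaF_pathInt hε.1 hη ht, ?_, ?_, ?_⟩
  · intro p hp s hs t ht
    have ht' : t ∈ Icc 0 T := ⟨hs.1.trans ht.1, ht.2⟩
    have hk : ⌈p⌉₊ ≠ 0 := (Nat.ceil_pos.2 (by linarith)).ne'
    have hk0 : (0 : ℝ) < ⌈p⌉₊ := by positivity
    have hd : 0 ≤ (t - s) ^ H0 := Real.rpow_nonneg (by linarith [ht.1]) _
    have e1 := hm.pathInt_diag_sub_ae_eq hε.1 hη hs ht'
    have h2 : ∫⁻ ω, ‖pathInt W b ε η s t (ω, ω)‖ₑ ^ ⌈p⌉₊ ∂μ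
        ≤ ENNReal.ofReal ((1 + K₁ p) * (t - s) ^ H0) ^ (⌈p⌉₊ : ℝ) := by
      refine (hK₁' p hp ε hε η hη s hs t ht).trans ?_
      rw [ENNReal.rpow_natCast, ← ENNReal.ofReal_pow (mul_nonneg (by linarith [hK₁ p]) hd), mul_pow]
      refine ENNReal.ofReal_le_ofReal (mul_le_mul_of_nonneg_right ?_ (pow_nonneg hd _))
      exact (by linarith : K₁ p ≤ 1 + K₁ p).trans (le_self_pow₀ (by linarith [hK₁ p]) hk)
    refine (eLpNorm_congr_ae e1).trans_le
      ((eLpNorm_le_lintegral_pow_ceil (((hmeas t ht').sub (hmeas s hs)).congr e1) hp).trans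
      ((ENNReal.rpow_le_rpow h2 (by positivity)).trans ?_))
    rw [← ENNReal.rpow_mul, mul_one_div_cancel hk0.ne', ENNReal.rpow_one]
    exact ENNReal.ofReal_le_ofReal (mul_le_mul_of_nonneg_right (by linarith [hn p, hn (-p)]) hd)
  · intro p hp t ht
    exact (eLpNorm_exp_le hp (hK₂ p) (hK₂' p ε hε η hη 0 h0T t ht)).trans
      (ENNReal.ofReal_le_ofReal (by linarith [hK₁ p, hn (-p)]))
  · intro p hp t ht
    refine (eLpNorm_exp_le hp (hK₂ (-p)) ?_).trans
      (ENNReal.ofReal_le_ofReal (by linarith [hK₁ p, hn p]))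
    simp only [mul_neg, ← neg_mul]
    exact hK₂' (-p) ε hε η hη 0 h0T t ht

/-- The regularised integrals form a Cauchy family in every `Lᵖ`. -/
theorem tendsto_eLpNorm_pathInt_sub [IsProbabilityMeasure μ] (hm : Model μ T H0 H ρ C A B b W M)
    {p : ℝ} (hp : 1 ≤ p) {t : ℝ} (ht : t ∈ Icc 0 T) :
    Tendsto (fun z : (ℝ × ℝ) × (ℝ × ℝ) => eLpNorm ((fun ω => pathInt W b z.1.1 z.1.2 0 t (ω, ω))
        - fun ω => pathInt W b z.2.1 z.2.2 0 t (ω, ω)) (ENNReal.ofReal p) μ)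
      ((𝓝[>] 0 ×ˢ 𝓝[>] 0) ×ˢ (𝓝[>] 0 ×ˢ 𝓝[>] 0)) (𝓝 0) := by
  have hk : ⌈p⌉₊ ≠ 0 := (Nat.ceil_pos.2 (by linarith)).ne'
  have h1 := (ENNReal.continuous_rpow_const (y := 1 / (⌈p⌉₊ : ℝ))).continuousAt.tendsto.comp
    (hm.tendsto_lintegral_pathInt_sub hk ht)
  rw [ENNReal.zero_rpow_of_pos (by positivity)] at h1
  have hpos : ∀ᶠ z : ℝ × ℝ in 𝓝[>] 0 ×ˢ 𝓝[>] 0, 0 < z.1 ∧ 0 < z.2 :=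
    (eventually_mem_nhdsWithin (s := Ioi (0 : ℝ))).prod_mk
      (eventually_mem_nhdsWithin (s := Ioi (0 : ℝ)))
  refine tendsto_of_tendsto_of_tendsto_of_le_of_le' tendsto_const_nhds h1
    (Eventually.of_forall fun _ => zero_le) ?_
  have hmeas : ∀ z : ℝ × ℝ, 0 < z.1 ∧ 0 < z.2 →
      AEStronglyMeasurable (fun ω => pathInt W b z.1 z.2 0 t (ω, ω)) μ := fun z hz =>
    (hm.aestronglyMeasurable_sigmaF_pathInt hz.1 hz.2 ht).mono (hm.sigmaF_le ht.2)
  filter_upwards [hpos.prod_mk hpos] with z hz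
  exact eLpNorm_le_lintegral_pow_ceil ((hmeas _ hz.1).sub (hmeas _ hz.2)) hp

end Model

theorem ExpProcess.memLp_two_increment {Ω : Type*} [mΩ : MeasurableSpace Ω]
    {μ : Measure Ω} {F : ℝ → MeasurableSpace Ω} {T H : ℝ} {K : ℝ → ℝ} {X : ℝ → Ω → ℝ}
    (hX : ExpProcess F μ T H K X) (hFm : ∀ t ∈ Icc 0 T, F t ≤ mΩ) {s t : ℝ} (hs : s ∈ Icc 0 T)
    (ht : t ∈ Icc s T) : MemLp (X t - X s) 2 μ := by
  have h1 := hX.increment 2 (by norm_num) s hs t ht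
  rw [ENNReal.ofReal_ofNat] at h1
  exact ⟨(hX.aestronglyMeasurable hFm ⟨hs.1.trans ht.1, ht.2⟩).sub (hX.aestronglyMeasurable hFm hs),
    h1.trans_lt ENNReal.ofReal_lt_top⟩

end FracBSDE

/-! ### Convergence of the regularised solutions -/

theorem theorem3p5 {Ω : Type*} [MeasurableSpace Ω] (μ : Measure Ω) [IsProbabilityMeasure μ]
    (d : ℕ) (T : ℝ) (hT : 0 < T)
    (H0 : ℝ) (hH0 : H0 ∈ Ioo (1 / 2 : ℝ) 1)
    (H β : Fin d → ℝ) (hH : ∀ i, H i ∈ Ioo (1 / 2 : ℝ) 1)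
    (hβ : ∀ i, β i ∈ Ioo (0 : ℝ) 2) (hβH : ∀ i, β i < 2 * H i)
    (hα : ∑ i, (2 * H i - β i) < 2)
    (ρ : (Fin d → ℝ) → ℝ) (hρ : Continuous ρ)
    (hρβ : ∃ C : ℝ, ∀ x, 0 ≤ ρ x ∧ ρ x ≤ C * ∏ i, (1 + |x i|) ^ (-β i))
    (B : ℝ → Ω → (Fin d → ℝ)) (hB : FracBSDE.IsBrownianOn T B μ)
    (W : ℝ → (Fin d → ℝ) → Ω → ℝ) (hW : FracBSDE.IsWeightedFractionalField H0 H ρ W μ)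
    (hBW : Indep (FracBSDE.brownianSigma B T) (FracBSDE.fieldSigma W) μ)
    (q : ℝ) (hq : 2 < q) (ξ : Ω → ℝ) (hξ : MemLp ξ (ENNReal.ofReal q) μ) :
    ∃ (V Y : ℝ → Ω → ℝ) (Yapp : ℝ → ℝ → ℝ → Ω → ℝ),
      (∀ t ∈ Icc 0 T, FracBSDE.IsNonlinearIntegral B W μ T t (V t)) ∧
      FracBSDE.IsCondExpVersion (FracBSDE.sigmaF B W) μ T ξ V Y ∧
      (∀ ε > 0, ∀ η > 0, FracBSDE.IsCondExpVersion (FracBSDE.sigmaF B W) μ T ξ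
        (FracBSDE.integralApprox B W T ε η) (Yapp ε η)) ∧
      ∀ p ∈ Ico 1 q,
        FracBSDE.MemSp (FracBSDE.sigmaF B W) μ T p Y ∧
        (∀ ε > 0, ∀ η > 0, FracBSDE.MemSp (FracBSDE.sigmaF B W) μ T p (Yapp ε η)) ∧
        Tendsto (fun z : ℝ × ℝ =>
            FracBSDE.supMoment μ T p (fun t ω => Yapp z.1 z.2 t ω - Y t ω))
          (𝓝[>] 0 ×ˢ 𝓝[>] 0) (𝓝 0) := by
  obtain ⟨C, A, b, M, hm⟩ :=
    FracBSDE.exists_model hT hH0 hH hβ hβH hα hρ hρβ hB hW hBW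
  have hHalf : 1 / 2 < H0 := hH0.1
  have hF : ∀ s ∈ Icc 0 T, ∀ t ∈ Icc s T, FracBSDE.sigmaF B W s ≤ FracBSDE.sigmaF B W t :=
    fun s _ t ht => FracBSDE.sigmaF_mono B W ht.1
  have hFm : ∀ t ∈ Icc 0 T, FracBSDE.sigmaF B W t ≤ (inferInstance : MeasurableSpace Ω) :=
    fun t ht => hm.sigmaF_le ht.2
  have hcont := hB.hasContCondExp hT hm.fieldSigma_le hBW
  have hT' : T ∈ Icc 0 T := ⟨hT.le, le_rfl⟩
  let Xs : ℝ × ℝ → ℝ → Ω → ℝ := fun z t ω => FracBSDE.pathInt W b z.1 z.2 0 t (ω, ω)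
  obtain ⟨K, hK, hKX⟩ := hm.exists_expProcess 1
  have hXs : ∀ᶠ z : ℝ × ℝ in 𝓝[>] 0 ×ˢ 𝓝[>] 0,
      FracBSDE.ExpProcess (FracBSDE.sigmaF B W) μ T H0 K (Xs z) :=
    (Eventually.prod_mk (pa := fun x : ℝ => x ∈ Ioc 0 1) (Ioc_mem_nhdsGT one_pos)
      (eventually_mem_nhdsWithin (s := Ioi (0 : ℝ)))).mono
      fun z hz => hKX z.1 hz.1 z.2 hz.2
  obtain ⟨X, hX, hlim⟩ := FracBSDE.ExpProcess.exists_limit hT hHalf hFm hK hXs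
    fun p hp t ht => hm.tendsto_eLpNorm_pathInt_sub hp ht
  obtain ⟨Y, N, hY⟩ := hX.exists_isExpSolution hT hF hcont ξ
  have hYs : ∀ ε > 0, ∀ η > 0, ∃ Y N,
      FracBSDE.IsExpSolution (FracBSDE.sigmaF B W) μ T ξ (Xs (ε, η)) Y N := by
    intro ε hε η hη
    obtain ⟨K', -, hKX'⟩ := hm.exists_expProcess ε
    exact (hKX' ε ⟨hε, le_rfl⟩ η hη).exists_isExpSolution hT hF hcont ξ
  choose! Yapp Napp hYapp using hYs
  refine ⟨fun t ω => X T ω - X t ω, Y, Yapp, fun t ht => ⟨fun ε hε η hη => ?_, ?_, ?_⟩,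
    hY.isCondExpVersion hX hT hFm hq hξ fun t _ => EventuallyEq.rfl, fun ε hε η hη => ?_,
    fun p hp => ⟨hY.memSp hX hT hHalf hK hF hFm hξ hp.1 hp.2, fun ε hε η hη => ?_, ?_⟩⟩
  · obtain ⟨K', -, hKX'⟩ := hm.exists_expProcess ε
    refine MemLp.ae_eq (hm.integralApprox_ae_eq hε hη ht).symm ?_
    exact (hKX' ε ⟨hε, le_rfl⟩ η hη).memLp_two_increment hFm ht ⟨ht.2, le_rfl⟩
  · exact hX.memLp_two_increment hFm ht ⟨ht.2, le_rfl⟩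
  · have h1 := (hlim 2 (by norm_num) T hT').add (hlim 2 (by norm_num) t ht)
    rw [add_zero] at h1
    simp only [ENNReal.ofReal_ofNat] at h1
    refine tendsto_of_tendsto_of_tendsto_of_le_of_le' tendsto_const_nhds h1
      (Eventually.of_forall fun _ => zero_le) ?_
    filter_upwards [hXs, (eventually_mem_nhdsWithin (s := Ioi (0 : ℝ))).prod_mk
      (eventually_mem_nhdsWithin (s := Ioi (0 : ℝ)))] with z hz hz0
    refine (eLpNorm_congr_ae (g := (Xs z T - X T) - (Xs z t - X t)) ?_).trans_le
      (eLpNorm_sub_le ((hz.aestronglyMeasurable hFm hT').sub (hX.aestronglyMeasurable hFm hT'))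
        ((hz.aestronglyMeasurable hFm ht).sub (hX.aestronglyMeasurable hFm ht)) (by norm_num))
    filter_upwards [hm.integralApprox_ae_eq hz0.1 hz0.2 ht] with ω hω
    rw [hω]
    simp only [Pi.sub_apply, Xs]
    ring
  · obtain ⟨K', -, hKX'⟩ := hm.exists_expProcess ε
    exact (hYapp ε hε η hη).isCondExpVersion (hKX' ε ⟨hε, le_rfl⟩ η hη) hT hFm hq hξ
      fun t ht => hm.integralApprox_ae_eq hε hη ht
  · obtain ⟨K', hK', hKX'⟩ := hm.exists_expProcess ε
    exact (hYapp ε hε η hη).memSp (hKX' ε ⟨hε, le_rfl⟩ η hη) hT hHalf hK' hF hFm hξ hp.1 hp.2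
  · refine hY.tendsto_supMoment_sub (Xs := Xs) (Ys := fun z => Yapp z.1 z.2)
      (Ms := fun z => Napp z.1 z.2) ?_ hX hXs hT hHalf hK hF hFm hξ hlim hp.1 hp.2
    filter_upwards [(eventually_mem_nhdsWithin (s := Ioi (0 : ℝ))).prod_mk
      (eventually_mem_nhdsWithin (s := Ioi (0 : ℝ)))] with z hz using hYapp _ hz.1 _ hz.2
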